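/- Let Sol be the space $\mathbb R^3$ with coordinates $(x,y,z)$ and the Riemannian metric $ds^2=e^{2z}dx^2+e^{-2z}dy^2+dz^2$, and let $R=\{z=0\}$, on which this metric induces the Euclidean metric $dx^2+dy^2$. Let $\Gamma\subset R$ be a smooth closed embedded curve, and let $M$ be a compact smooth surface with boundary, smoothly immersed in Sol with constant mean curvature $H$, which spans $\Gamma$, that is, the immersion maps $\partial M$ diffeomorphically onto $\Gamma$. (The mean curvature is half the trace of the second fundamental form with respect to a unit normal; its sign depends on the choice of the normal, and no orientation of $M$ is assumed.) Then $$|H|\le\frac{\int_\Gamma\sqrt{1+x^2+y^2}\,ds}{2A(D)},$$ where $D\subset R$ is the bounded domain with boundary $\Gamma$, $A(D)$ is its area, and $ds$ is the arc length element of $\Gamma$. In particular, if $\Gamma$ is a circle in $R$ of (intrinsic) curvature $c$, then $|H|\le\sqrt{c^2+1}$. -/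

import Mathlib

open Set MeasureTheory
open scoped Manifold ContDiff

noncomputable section

namespace SolSpace

/-- The underlying manifold `ℝ³` of the space Sol, with its canonical coordinates
`x = p 0`, `y = p 1`, `z = p 2`. -/
abbrev Sol : Type := Fin 3 → ℝ

/-- The matrix of the metric `ds² = e^{2z} dx² + e^{-2z} dy² + dz²` at the point `p`. -/
def metric (p : Sol) : Matrix (Fin 3) (Fin 3) ℝ :=
  Matrix.diagonal ![Real.exp (2 * p 2), Real.exp (-(2 * p 2)), 1]

/-- The inner product `⟨v, w⟩` of two tangent vectors of Sol at `p`. -/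
def inner (p v w : Sol) : ℝ := ∑ a, ∑ b, metric p a b * v a * w b

/-- The length `|v|` of a tangent vector of Sol at `p`. -/
def norm (p v : Sol) : ℝ := √(inner p v v)

/-- The partial derivative `∂_l g_{ab}` of a coefficient of the metric at `p`. -/
def metricDeriv (p : Sol) (l a b : Fin 3) : ℝ :=
  fderiv ℝ (fun q : Sol => metric q a b) p (Pi.single l 1)

/-- The Christoffel symbols
`Γ^k_{ab} = ½ ∑ₗ g^{kl} (∂_a g_{bl} + ∂_b g_{al} - ∂_l g_{ab})` of Sol at `p`. -/
def christoffel (p : Sol) (k a b : Fin 3) : ℝ :=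
  (1 / 2) * ∑ l, (metric p)⁻¹ k l * (metricDeriv p a b l + metricDeriv p b a l - metricDeriv p l a b)

/-! ### Parametrized surfaces

Local parametrizations are defined on (relatively open subsets of) the closed half plane, so all
derivatives are taken within the half plane, the range of the model with corners `𝓡∂ 2`. -/

/-- The `i`-th partial derivative, within the half plane, of a map to `ℝ³`. -/
def pderiv (i : Fin 2) (V : EuclideanSpace ℝ (Fin 2) → Sol) (u : EuclideanSpace ℝ (Fin 2)) : Sol :=
  fderivWithin ℝ V (range (𝓡∂ 2)) u (EuclideanSpace.single i 1)

/-- The Levi-Civita covariant derivative `∇_{∂_i} V` of a vector field `V` along `F`. -/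
def covDeriv (F V : EuclideanSpace ℝ (Fin 2) → Sol) (i : Fin 2)
    (u : EuclideanSpace ℝ (Fin 2)) : Sol :=
  fun k => pderiv i V u k + ∑ a, ∑ b, christoffel (F u) k a b * pderiv i F u a * V u b

/-- The coefficients `⟨∂_i F, ∂_j F⟩` of the first fundamental form. -/
def firstForm (F : EuclideanSpace ℝ (Fin 2) → Sol) (u : EuclideanSpace ℝ (Fin 2))
    (i j : Fin 2) : ℝ :=
  inner (F u) (pderiv i F u) (pderiv j F u)

/-- The coefficients `⟨n, ∇_{∂_i} ∂_j F⟩` of the second fundamental form with respect to `n`. -/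
def secondForm (F : EuclideanSpace ℝ (Fin 2) → Sol) (n : Sol) (u : EuclideanSpace ℝ (Fin 2))
    (i j : Fin 2) : ℝ :=
  inner (F u) n (covDeriv F (pderiv j F) i u)

/-- `n` is a unit vector at `F u`, normal to the parametrized surface `F`. -/
def IsUnitNormal (F : EuclideanSpace ℝ (Fin 2) → Sol) (n : Sol)
    (u : EuclideanSpace ℝ (Fin 2)) : Prop :=
  inner (F u) n n = 1 ∧ ∀ i, inner (F u) n (pderiv i F u) = 0

/-- The mean curvature `½ (E g - 2 F f + G e) / (E G - F²)` at `u` with respect to the unit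
normal vector `n`. -/
def meanCurvature (F : EuclideanSpace ℝ (Fin 2) → Sol) (n : Sol)
    (u : EuclideanSpace ℝ (Fin 2)) : ℝ :=
  (1 / 2) *
    ((firstForm F u 0 0 * secondForm F n u 1 1 - 2 * (firstForm F u 0 1 * secondForm F n u 0 1)
        + firstForm F u 1 1 * secondForm F n u 0 0)
      / (firstForm F u 0 0 * firstForm F u 1 1 - firstForm F u 0 1 ^ 2))

/-! ### Immersed surfaces with boundary -/

section Surface

variable {M : Type*} [TopologicalSpace M] [ChartedSpace (EuclideanHalfSpace 2) M]

/-- `f : M → Sol` is a smooth immersion of the surface with boundary `M` (which then carries the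
induced metric). -/
def IsSmoothImmersion (f : M → Sol) : Prop :=
  ContMDiff (𝓡∂ 2) 𝓘(ℝ, Sol) ∞ f ∧
    ∀ p, Function.Injective (mfderiv (𝓡∂ 2) 𝓘(ℝ, Sol) f p)

/-- The immersed surface `f : M → Sol` has constant mean curvature `H`: in the charts of `M`, at
every point, the mean curvature is `H` with respect to one of the two unit normal vectors.
No orientation of `M` is assumed. If `H ≠ 0` the vector `n` is unique at each point and equals the
mean curvature vector divided by `H`, so it is automatically a global smooth unit normal field;
if `H = 0` its choice is irrelevant. -/
def HasConstantMeanCurvature (f : M → Sol) (H : ℝ) : Prop :=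
  ∀ p : M, ∀ u ∈ (extChartAt (𝓡∂ 2) p).target, ∃ n : Sol,
    IsUnitNormal (f ∘ (extChartAt (𝓡∂ 2) p).symm) n u ∧
      meanCurvature (f ∘ (extChartAt (𝓡∂ 2) p).symm) n u = H

/-- `Γ` is the boundary of the immersed surface `f : M → Sol`, i.e. `f` maps `∂M`
diffeomorphically onto `Γ`. For an immersion `f` and an embedded curve `Γ` this means that
`f` maps `∂M` bijectively onto `Γ`, the restriction of `f` to `∂M` being an immersion. -/
def Spans (f : M → Sol) (Γ : Set Sol) : Prop :=
  BijOn f ((𝓡∂ 2).boundary M) Γ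

end Surface

/-! ### Closed curves in the plane `R = {z = 0}` -/

/-- `γ` is a regular `T`-periodic parametrization of a smooth closed embedded curve, which is
traversed once over a period. The curve itself is `range γ`. -/
structure IsClosedEmbeddedCurve (γ : ℝ → Sol) (T : ℝ) : Prop where
  period_pos : 0 < T
  smooth : ContDiff ℝ ∞ γ
  periodic : Function.Periodic γ T
  regular : ∀ t, deriv γ t ≠ 0
  injOn : InjOn γ (Ico 0 T)

/-- The line integral `∫_Γ φ ds`, where `ds` is the arc length element of Sol. -/
def lineIntegral (γ : ℝ → Sol) (T : ℝ) (φ : Sol → ℝ) : ℝ :=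
  ∫ t in (0 : ℝ)..T, φ (γ t) * norm (γ t) (deriv γ t)

/-- The plane `R = {z = 0}`, in the coordinates `(x, y)`. -/
def planeR (q : ℝ × ℝ) : Sol := ![q.1, q.2, 0]

/-- `D` (a set in the coordinates `(x, y)` of the plane `R`) is the bounded domain of `R` whose
boundary is the curve `Γ`. -/
structure IsDomainBoundedBy (D : Set (ℝ × ℝ)) (Γ : Set Sol) : Prop where
  isOpen : IsOpen D
  isConnected : IsConnected D
  isBounded : Bornology.IsBounded D
  boundary : planeR '' frontier D = Γ

/-- The area `A(D)` of a subset of the plane `R`, for the metric induced by Sol; the coordinate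
vectors are `∂/∂x` and `∂/∂y`. -/
def area (D : Set (ℝ × ℝ)) : ℝ :=
  ∫ q in D, √(inner (planeR q) ![1, 0, 0] ![1, 0, 0] * inner (planeR q) ![0, 1, 0] ![0, 1, 0]
    - inner (planeR q) ![1, 0, 0] ![0, 1, 0] ^ 2)

/-- `Γ` is a circle in `R`; the metric that Sol induces on `R` is the Euclidean one. -/
def IsCircleInR (Γ : Set Sol) : Prop :=
  ∃ a b r : ℝ, 0 < r ∧ Γ = planeR '' {q | (q.1 - a) ^ 2 + (q.2 - b) ^ 2 = r ^ 2}

/-- The (intrinsic, unsigned) curvature `|x' y'' - y' x''| / (x'² + y'²)^{3/2}` of a regular curve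
in `R`, for the induced Euclidean metric `dx² + dy²`. -/
def curvatureInR (γ : ℝ → Sol) (t : ℝ) : ℝ :=
  |deriv γ t 0 * deriv (deriv γ) t 1 - deriv γ t 1 * deriv (deriv γ) t 0|
    / √(deriv γ t 0 ^ 2 + deriv γ t 1 ^ 2) ^ 3

end SolSpace

end

open Filter
open scoped Topology

noncomputable section

namespace SolSpace

-- The proof is a flux argument. The maps (x, y, z) ↦ (e^{-t} x, e^t y, z + t) are isometries of
-- Sol. Together with the translations in x and y they give the Killing fields K = -(x - a) ∂x + (y
-- - b) ∂y + ∂z (`killing`). The flux 2-form ι_K vol is exact, with primitive β = (x - a) dy - (x -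
-- a)(y - b) dz (`beta`).
--
-- On a surface with unit normal n and mean curvature h, consider the 1-form Ω(v) = det(K, n, v) +
-- 2hβ(v) (`fluxForm`). When h is locally constant, Ω is closed: the derivative of n contributes -2h
-- ι_K vol by the Weingarten formula, which cancels 2h dβ, and the derivative of K contributes the
-- tangential divergence of K, which vanishes for a Killing field (`fluxForm_closed`). Replacing n
-- by -n changes the sign of both h and Ω, so Ω is a twisted form. For a smooth function g, dg ∧ Ω
-- is then a density, whose integral is independent of charts, and Stokes' theorem holds with no
-- orientation of M (`Reparam.wedge`, `IsCMC.sum_boundary_integral`).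
--
-- For H ≠ 0 the sign of h relates the chart direction of the boundary to the direction of γ. This
-- sign is constant along the connected parameter line (`BoundaryLift.exists_sign`), so the β-terms
-- add up to ±2|H| ∫_γ β, while |det(K, n, v)| ≤ |K||v|. This gives 2|H| |∫_γ β| ≤ ∫_Γ |K| ds
-- (`flux_inequality`).
--
-- On R one has β(γ') = (x - a) y' and |K|² = 1 + (x - a)² + (y - b)². With a = b = 0, Green's
-- theorem identifies |∫_γ β| with A(D). It is proved for a domain given only by its frontier, by
-- showing that the domain lies on one side of the curve in normal coordinates
-- (`IsPlaneLoop.exists_setIntegral_fderiv`). For a circle of radius r, centring K at the centre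
-- makes |K| = √(1 + r²) constant on Γ, and 2|∫_γ β| = r · length, so the length cancels
-- (`IsClosedEmbeddedCurve.circle_flux`).

local notation "HP" => range (𝓡∂ 2)

/-! ### Pointwise geometry of Sol: connection, cross product, unit normals -/

lemma inner_apply (p v w : Sol) :
    inner p v w = Real.exp (2 * p 2) * v 0 * w 0 + Real.exp (-(2 * p 2)) * v 1 * w 1
      + v 2 * w 2 := by
  simp [inner, metric, Fin.sum_univ_three, Matrix.diagonal]

lemma metricDeriv_apply (p : Sol) (l a b : Fin 3) :
    metricDeriv p l a b = if l = 2 then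
      Matrix.diagonal ![2 * Real.exp (2 * p 2), -(2 * Real.exp (-(2 * p 2))), 0] a b else 0 := by
  have h2 : HasFDerivAt (fun q : Sol => q 2) (ContinuousLinearMap.proj (R := ℝ) (2 : Fin 3)) p :=
    hasFDerivAt_apply 2 p
  have e1 := (h2.const_mul 2).exp
  have e2 := (h2.const_mul 2).fun_neg.exp
  unfold metricDeriv metric
  fin_cases a <;> fin_cases b <;>
    simp [Matrix.diagonal]
  · rw [e1.fderiv]; fin_cases l <;> simp; ring
  · rw [e2.fderiv]; fin_cases l <;> simp; ring

lemma metric_inv (p : Sol) :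
    (metric p)⁻¹ = Matrix.diagonal ![Real.exp (-(2 * p 2)), Real.exp (2 * p 2), 1] := by
  apply Matrix.inv_eq_right_inv
  rw [metric, Matrix.diagonal_mul_diagonal, ← Matrix.diagonal_one]
  congr 1
  ext i
  fin_cases i <;> simp [← Real.exp_add]

/-- The covariant derivative along a curve with velocity `v` of a field with value `w` and
componentwise derivative `dw`. -/
def cov (z : ℝ) (v w dw : Sol) : Sol :=
  ![dw 0 + v 0 * w 2 + v 2 * w 0, dw 1 - v 1 * w 2 - v 2 * w 1,
    dw 2 - Real.exp (2 * z) * v 0 * w 0 + Real.exp (-(2 * z)) * v 1 * w 1]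

/-- Up to symmetry the only nonzero Christoffel symbols are Γ^x_{xz} = 1, Γ^y_{yz} = -1, Γ^z_{xx} =
-e^{2z} and Γ^z_{yy} = e^{-2z}. Working with `cov` separates the algebra of the connection from the
differentiation. -/
lemma covDeriv_eq_cov (F V : EuclideanSpace ℝ (Fin 2) → Sol) (i : Fin 2)
    (u : EuclideanSpace ℝ (Fin 2)) :
    covDeriv F V i u = cov (F u 2) (pderiv i F u) (V u) (pderiv i V u) := by
  have h : Real.exp (-(2 * F u 2)) * Real.exp (2 * F u 2) = 1 := by
    rw [← Real.exp_add]; simp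
  ext k
  fin_cases k <;>
    simp [covDeriv, cov, christoffel, metric_inv, metricDeriv_apply, Fin.sum_univ_three,
      Matrix.diagonal]
  · linear_combination (pderiv i F u 0 * V u 2 + pderiv i F u 2 * V u 0) * h
  · linear_combination (-pderiv i F u 1 * V u 2 - pderiv i F u 2 * V u 1) * h
  · ring

/-- The determinant of three vectors, which is the volume form of Sol. -/
def det3 (a b c : Sol) : ℝ :=
  a 0 * (b 1 * c 2 - b 2 * c 1) - a 1 * (b 0 * c 2 - b 2 * c 0) + a 2 * (b 0 * c 1 - b 1 * c 0)

/-- The cross product of Sol at height `z`: `⟨cross z v w, c⟩ = det3 v w c`. -/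
def cross (z : ℝ) (v w : Sol) : Sol :=
  ![Real.exp (-(2 * z)) * (v 1 * w 2 - v 2 * w 1), Real.exp (2 * z) * (v 2 * w 0 - v 0 * w 2),
    v 0 * w 1 - v 1 * w 0]

lemma exp_mul_exp_neg (z : ℝ) : Real.exp (2 * z) * Real.exp (-(2 * z)) = 1 := by
  rw [← Real.exp_add]; simp

/-- The metric has determinant 1, so the coordinate determinant is the volume form without a density
factor. -/
lemma inner_cross (p v w c : Sol) : inner p (cross (p 2) v w) c = det3 v w c := by
  simp [inner_apply, cross, det3]
  linear_combination ((v 1 * w 2 - v 2 * w 1) * c 0 + (v 2 * w 0 - v 0 * w 2) * c 1) *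
    exp_mul_exp_neg (p 2)

lemma inner_comm (p v w : Sol) : inner p v w = inner p w v := by
  simp [inner_apply]; ring

/-- The Gram determinant of two tangent vectors. -/
def gramDet (p v w : Sol) : ℝ := inner p v v * inner p w w - inner p v w ^ 2

lemma gramDet_eq (p v w : Sol) :
    gramDet p v w = inner p (cross (p 2) v w) (cross (p 2) v w) := by
  rw [inner_cross]
  simp [gramDet, inner_apply, cross, det3]
  linear_combination ((v 0 * w 1 - v 1 * w 0) ^ 2) * exp_mul_exp_neg (p 2)

lemma inner_self_nonneg (p v : Sol) : 0 ≤ inner p v v := by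
  rw [inner_apply]
  nlinarith [mul_nonneg (Real.exp_pos (2 * p 2)).le (mul_self_nonneg (v 0)),
    mul_nonneg (Real.exp_pos (-(2 * p 2))).le (mul_self_nonneg (v 1)), mul_self_nonneg (v 2)]

lemma gramDet_nonneg (p v w : Sol) : 0 ≤ gramDet p v w := by
  rw [gramDet_eq]; exact inner_self_nonneg _ _

lemma inner_smul_left (p v w : Sol) (c : ℝ) : inner p (c • v) w = c * inner p v w := by
  simp [inner_apply]; ring

lemma inner_neg_left (p v w : Sol) : inner p (-v) w = -inner p v w := by
  simp [inner_apply]; ring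

/-- The unit normal of the plane spanned by `v` and `w`. -/
def unitNormal (p v w : Sol) : Sol := (√(gramDet p v w))⁻¹ • cross (p 2) v w

lemma inner_unitNormal (p v w c : Sol) :
    inner p (unitNormal p v w) c = (√(gramDet p v w))⁻¹ * det3 v w c := by
  rw [unitNormal, inner_smul_left, inner_cross]

lemma inner_unitNormal_self {p v w : Sol} (h : gramDet p v w ≠ 0) :
    inner p (unitNormal p v w) (unitNormal p v w) = 1 := by
  rw [unitNormal, inner_smul_left, inner_comm, inner_smul_left, ← gramDet_eq]
  have h0 := gramDet_nonneg p v w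
  have := Real.sq_sqrt h0
  have h1 : √(gramDet p v w) ≠ 0 := by
    rw [Real.sqrt_ne_zero h0]; exact h
  field_simp
  linear_combination -this

lemma det3_self_left (v w : Sol) : det3 v w v = 0 := by simp [det3]; ring
lemma det3_self_right (v w : Sol) : det3 v w w = 0 := by simp [det3]; ring

/-- The cross product of two vectors of the plane orthogonal to n is a multiple of n, and pairing
with n gives the factor. Linear independence of v and w plays no role. -/
lemma cross_eq_of_unit {p v w n : Sol} (hn : inner p n n = 1) (hv : inner p n v = 0)
    (hw : inner p n w = 0) : cross (p 2) v w = det3 v w n • n := by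
  have h := exp_mul_exp_neg (p 2)
  set P := Real.exp (2 * p 2)
  set Q := Real.exp (-(2 * p 2))
  simp only [inner_apply] at hn hv hw
  change P * n 0 * n 0 + Q * n 1 * n 1 + _ = _ at hn
  change P * n 0 * v 0 + Q * n 1 * v 1 + _ = _ at hv
  change P * n 0 * w 0 + Q * n 1 * w 1 + _ = _ at hw
  have hP : P ≠ 0 := (Real.exp_pos _).ne'
  have hQ : Q ≠ 0 := (Real.exp_pos _).ne'
  ext k
  fin_cases k <;> simp [cross, det3]
  · change Q * _ = _
    linear_combination (-Q * (v 1 * w 2 - v 2 * w 1)) * hn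
      + (Q * (n 1 * w 2 - n 2 * w 1)) * hv - (Q * (n 1 * v 2 - n 2 * v 1)) * hw
      + (n 0 * (v 1 * w 2 * n 0 - v 1 * n 2 * w 0 - w 2 * n 1 * v 0 - v 2 * w 1 * n 0
        + v 2 * n 1 * w 0 + w 1 * n 2 * v 0)) * h
  · change P * _ = _
    linear_combination (-P * (v 2 * w 0 - v 0 * w 2)) * hn
      + (P * (n 2 * w 0 - n 0 * w 2)) * hv - (P * (n 2 * v 0 - n 0 * v 2)) * hw
      + (n 1 * (v 2 * w 0 * n 1 - v 2 * n 0 * w 1 - w 0 * n 2 * v 1 - v 0 * w 2 * n 1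
        + v 0 * n 2 * w 1 + w 2 * n 0 * v 1)) * h
  · linear_combination (-(v 0 * w 1 - v 1 * w 0)) * hn
      + (n 0 * w 1 - n 1 * w 0) * hv - (n 0 * v 1 - n 1 * v 0) * hw

lemma gramDet_eq_sq_of_unit {p v w n : Sol} (hn : inner p n n = 1) (hv : inner p n v = 0)
    (hw : inner p n w = 0) : gramDet p v w = det3 v w n ^ 2 := by
  rw [gramDet_eq, cross_eq_of_unit hn hv hw, inner_smul_left, inner_comm, inner_smul_left, hn]
  ring

lemma unitNormal_eq_or_neg {p v w n : Sol} (h : gramDet p v w ≠ 0) (hn : inner p n n = 1)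
    (hv : inner p n v = 0) (hw : inner p n w = 0) :
    n = unitNormal p v w ∨ n = -unitNormal p v w := by
  have hg := gramDet_eq_sq_of_unit hn hv hw
  have hd : det3 v w n ≠ 0 := by
    rintro h0; rw [h0] at hg; apply h; rw [hg]; ring
  rw [unitNormal, cross_eq_of_unit hn hv hw, hg, Real.sqrt_sq_eq_abs, smul_smul]
  rcases abs_cases (det3 v w n) with ⟨h1, -⟩ | ⟨h1, -⟩
  · left; rw [h1, inv_mul_cancel₀ hd, one_smul]
  · right; rw [h1, inv_neg, neg_mul, inv_mul_cancel₀ hd, neg_smul, one_smul, neg_neg]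

/-- The trace identity for the derivative of a unit normal, in an orthonormal frame. -/
lemma frame_trace_identity (n a b m k y : Fin 3 → ℝ) (h E F G : ℝ)
    (hn : n 0 * n 0 + n 1 * n 1 + n 2 * n 2 = 1)
    (na : n 0 * a 0 + n 1 * a 1 + n 2 * a 2 = 0) (nb : n 0 * b 0 + n 1 * b 1 + n 2 * b 2 = 0)
    (nm : n 0 * m 0 + n 1 * m 1 + n 2 * m 2 = 0) (nk : n 0 * k 0 + n 1 * k 1 + n 2 * k 2 = 0)
    (hE : E = a 0 * a 0 + a 1 * a 1 + a 2 * a 2) (hF : F = a 0 * b 0 + a 1 * b 1 + a 2 * b 2)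
    (hG : G = b 0 * b 0 + b 1 * b 1 + b 2 * b 2) (hne : E * G - F ^ 2 ≠ 0)
    (sym : m 0 * b 0 + m 1 * b 1 + m 2 * b 2 = k 0 * a 0 + k 1 * a 1 + k 2 * a 2)
    (tr : 2 * h * (E * G - F ^ 2) = -(E * (k 0 * b 0 + k 1 * b 1 + k 2 * b 2)
      - 2 * (F * (m 0 * b 0 + m 1 * b 1 + m 2 * b 2)) + G * (m 0 * a 0 + m 1 * a 1 + m 2 * a 2))) :
    det3 y m b - det3 y k a = -2 * h * det3 y a b := by
  have c0 : a 1 * b 2 - a 2 * b 1 = det3 a b n * n 0 := by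
    simp only [det3]
    linear_combination (-(a 1 * b 2 - a 2 * b 1)) * hn
      + (n 1 * b 2 - n 2 * b 1) * na - (n 1 * a 2 - n 2 * a 1) * nb
  have c1 : a 2 * b 0 - a 0 * b 2 = det3 a b n * n 1 := by
    simp only [det3]
    linear_combination (-(a 2 * b 0 - a 0 * b 2)) * hn
      + (n 2 * b 0 - n 0 * b 2) * na - (n 2 * a 0 - n 0 * a 2) * nb
  have c2 : a 0 * b 1 - a 1 * b 0 = det3 a b n * n 2 := by
    simp only [det3]
    linear_combination (-(a 0 * b 1 - a 1 * b 0)) * hn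
      + (n 0 * b 1 - n 1 * b 0) * na - (n 0 * a 1 - n 1 * a 0) * nb
  -- Cramer's rule for a vector of the tangent plane in the basis a, b, multiplied by the Gram
  -- determinant. The error term is det(a, b, v) a × b, which vanishes because a × b is a multiple
  -- of n.
  have key : ∀ v : Fin 3 → ℝ, n 0 * v 0 + n 1 * v 1 + n 2 * v 2 = 0 →
      ∀ i, (E * G - F ^ 2) * v i =
        (G * (v 0 * a 0 + v 1 * a 1 + v 2 * a 2) - F * (v 0 * b 0 + v 1 * b 1 + v 2 * b 2)) * a i
        + (E * (v 0 * b 0 + v 1 * b 1 + v 2 * b 2)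
          - F * (v 0 * a 0 + v 1 * a 1 + v 2 * a 2)) * b i := by
    intro v hv
    have hc : (a 1 * b 2 - a 2 * b 1) * v 0 + (a 2 * b 0 - a 0 * b 2) * v 1
        + (a 0 * b 1 - a 1 * b 0) * v 2 = 0 := by
      rw [c0, c1, c2]; linear_combination det3 a b n * hv
    intro i
    fin_cases i <;> simp only [hE, hF, hG, Fin.zero_eta, Fin.mk_one, Fin.reduceFinMk]
    · linear_combination (a 1 * b 2 - a 2 * b 1) * hc
    · linear_combination (a 2 * b 0 - a 0 * b 2) * hc
    · linear_combination (a 0 * b 1 - a 1 * b 0) * hc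
  have km := key m nm
  have kk := key k nk
  apply mul_left_cancel₀ hne
  simp only [det3]
  generalize m 0 * a 0 + m 1 * a 1 + m 2 * a 2 = ma at *
  generalize hmb : m 0 * b 0 + m 1 * b 1 + m 2 * b 2 = mb at *
  generalize k 0 * a 0 + k 1 * a 1 + k 2 * a 2 = ka at *
  generalize k 0 * b 0 + k 1 * b 1 + k 2 * b 2 = kb at *
  generalize E * G - F ^ 2 = Δ at *
  subst sym
  -- After substitution of the two expansions every term is a multiple of det(y, a, b). By symmetry
  -- the coefficients add up to G⟨m,a⟩ - 2F⟨m,b⟩ + E⟨k,b⟩, the trace in `tr`.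
  linear_combination (y 1 * b 2 * (-1) + y 2 * b 1) * km 0 + (y 0 * b 2 - y 2 * b 0) * km 1
    + (y 1 * b 0 - y 0 * b 1) * km 2 - ((y 1 * a 2 * (-1) + y 2 * a 1) * kk 0
    + (y 0 * a 2 - y 2 * a 0) * kk 1 + (y 1 * a 0 - y 0 * a 1) * kk 2)
    + (y 0 * (a 1 * b 2 - a 2 * b 1) - y 1 * (a 0 * b 2 - a 2 * b 0)
      + y 2 * (a 0 * b 1 - a 1 * b 0)) * tr

/-- The vector `v` in the orthonormal frame `e^{-z} ∂x, e^z ∂y, ∂z`. -/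
def toFrame (z : ℝ) (v : Sol) : Sol := ![Real.exp z * v 0, Real.exp (-z) * v 1, v 2]

lemma exp_two_mul' (z : ℝ) : Real.exp (2 * z) = Real.exp z * Real.exp z := by
  rw [← Real.exp_add]; ring_nf

lemma exp_neg_two_mul (z : ℝ) : Real.exp (-(2 * z)) = Real.exp (-z) * Real.exp (-z) := by
  rw [← Real.exp_add]; ring_nf

lemma exp_mul_neg (z : ℝ) : Real.exp z * Real.exp (-z) = 1 := by
  rw [← Real.exp_add]; simp

lemma inner_eq_dot (p v w : Sol) : inner p v w = toFrame (p 2) v 0 * toFrame (p 2) w 0 +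
    toFrame (p 2) v 1 * toFrame (p 2) w 1 + toFrame (p 2) v 2 * toFrame (p 2) w 2 := by
  simp [inner_apply, toFrame, exp_two_mul', exp_neg_two_mul]; ring

lemma det3_toFrame (z : ℝ) (a b c : Sol) :
    det3 (toFrame z a) (toFrame z b) (toFrame z c) = det3 a b c := by
  simp [det3, toFrame]
  linear_combination (a 0 * (b 1 * c 2 - b 2 * c 1) - a 1 * (b 0 * c 2 - b 2 * c 0)
    + a 2 * (b 0 * c 1 - b 1 * c 0)) * exp_mul_neg z

/-! ### The Killing field, the primitive of its flux, and derivatives along curves -/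

/-- The Killing field `-(x - a) ∂x + (y - b) ∂y + ∂z`. -/
def killing (a b : ℝ) (p : Sol) : Sol := ![-(p 0 - a), p 1 - b, 1]

/-- A primitive of the flux form of `killing a b`, a `1`-form on Sol. -/
def beta (a b : ℝ) (p v : Sol) : ℝ := (p 0 - a) * v 1 - (p 0 - a) * (p 1 - b) * v 2

section Curve

variable {x n w : ℝ → Sol} {x' n' w' : Sol} {t : ℝ}

/-- The connection is metric: its Christoffel terms absorb the derivative of the weights e^{±2z}. -/
lemma hasDerivAt_inner (hx : HasDerivAt x x' t) (hn : HasDerivAt n n' t)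
    (hw : HasDerivAt w w' t) :
    HasDerivAt (fun s => inner (x s) (n s) (w s))
      (inner (x t) (cov (x t 2) x' (n t) n') (w t)
        + inner (x t) (n t) (cov (x t 2) x' (w t) w')) t := by
  rw [hasDerivAt_pi] at hx hn hw
  simp only [inner_apply]
  refine ((((((hx 2).const_mul 2).exp.mul (hn 0)).mul (hw 0)).add
    (((((hx 2).const_mul 2).fun_neg.exp).mul (hn 1)).mul (hw 1))).add
    ((hn 2).mul (hw 2))).congr_deriv ?_
  simp [cov]
  ring

/-- The volume form is parallel: the connection matrix of `cov z x'` has diagonal (x' 2, -x' 2, 0),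
hence trace zero. The exponentials occur only off the diagonal, so z may be arbitrary. -/
lemma hasDerivAt_det3 {y : ℝ → Sol} {y' : Sol} (z : ℝ) (hy : HasDerivAt y y' t)
    (hn : HasDerivAt n n' t) (hw : HasDerivAt w w' t) :
    HasDerivAt (fun s => det3 (y s) (n s) (w s))
      (det3 (cov z x' (y t) y') (n t) (w t) + det3 (y t) (cov z x' (n t) n') (w t)
        + det3 (y t) (n t) (cov z x' (w t) w')) t := by
  rw [hasDerivAt_pi] at hy hn hw
  simp only [det3]
  refine ((((hy 0).mul (((hn 1).mul (hw 2)).sub ((hn 2).mul (hw 1)))).sub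
    ((hy 1).mul (((hn 0).mul (hw 2)).sub ((hn 2).mul (hw 0))))).add
    ((hy 2).mul (((hn 0).mul (hw 1)).sub ((hn 1).mul (hw 0))))).congr_deriv ?_
  simp [cov]
  ring

lemma hasDerivAt_killing (a b : ℝ) (hx : HasDerivAt x x' t) :
    HasDerivAt (fun s => killing a b (x s)) ![-x' 0, x' 1, 0] t := by
  rw [hasDerivAt_pi] at hx ⊢
  intro i
  fin_cases i
  · simpa [killing] using ((hx 0).sub_const a).fun_neg
  · simpa [killing] using (hx 1).sub_const b
  · simpa [killing] using hasDerivAt_const t (1 : ℝ)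

lemma hasDerivAt_beta (a b : ℝ) (hx : HasDerivAt x x' t) (hw : HasDerivAt w w' t) :
    HasDerivAt (fun s => beta a b (x s) (w s))
      (x' 0 * w t 1 + (x t 0 - a) * w' 1 - (x' 0 * (x t 1 - b) + (x t 0 - a) * x' 1) * w t 2
        - (x t 0 - a) * (x t 1 - b) * w' 2) t := by
  rw [hasDerivAt_pi] at hx hw
  simp only [beta]
  refine ((((hx 0).sub_const a).mul (hw 1)).sub
    ((((hx 0).sub_const a).mul ((hx 1).sub_const b)).mul (hw 2))).congr_deriv ?_
  simp only [Pi.mul_apply]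
  ring

end Curve

/-- The connection is torsion free. -/
lemma cov_comm (z : ℝ) (v w d : Sol) : cov z v w d = cov z w v d := by
  ext k; fin_cases k <;> simp [cov] <;> ring

/-- The vector ![-v 0, v 1, 0] is the componentwise derivative of K in the direction v. The left
side is alternating in v and w, and on an orthonormal basis of the plane it is, up to sign, the
tangential divergence of K. This is zero since ∇K is skew. -/
lemma killing_identity {p n v w : Sol} (a b : ℝ) (hn : inner p n n = 1) (hv : inner p n v = 0)
    (hw : inner p n w = 0) :
    det3 (cov (p 2) v (killing a b p) ![-v 0, v 1, 0]) n w
      - det3 (cov (p 2) w (killing a b p) ![-w 0, w 1, 0]) n v = 0 := by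
  have hc := cross_eq_of_unit hn hv hw
  have c0 := congrFun hc 0
  have c1 := congrFun hc 1
  have c2 := congrFun hc 2
  simp only [cross, Pi.smul_apply, smul_eq_mul, Matrix.cons_val_zero, Matrix.cons_val_one,
    Matrix.cons_val] at c0 c1 c2
  have h := exp_mul_exp_neg (p 2)
  generalize det3 v w n = d at *
  simp [det3, cov, killing]
  generalize Real.exp (2 * p 2) = P at *
  generalize Real.exp (-(2 * p 2)) = Q at *
  have c0' : v 1 * w 2 - v 2 * w 1 = P * (d * n 0) := by
    linear_combination P * c0 - (v 1 * w 2 - v 2 * w 1) * h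
  have c1' : v 2 * w 0 - v 0 * w 2 = Q * (d * n 1) := by
    linear_combination Q * c1 - (v 2 * w 0 - v 0 * w 2) * h
  linear_combination (-(p 0 - a) * n 2) * c0' + ((p 0 - a) * n 0 * P + (p 1 - b) * n 1 * Q) * c2
    - ((p 1 - b) * n 2) * c1'

/-- The pointwise identity behind the flux formula: `n` is a unit normal of the plane spanned by
`v₀, v₁`, with covariant derivatives `m₀, m₁` in these directions. -/
lemma trace_identity {p n v₀ v₁ m₀ m₁ : Sol} (y : Sol) {h : ℝ} (hn : inner p n n = 1)
    (h0 : inner p n v₀ = 0) (h1 : inner p n v₁ = 0)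
    (hm0 : inner p m₀ n = 0) (hm1 : inner p m₁ n = 0) (hg : gramDet p v₀ v₁ ≠ 0)
    (sym : inner p m₀ v₁ = inner p m₁ v₀)
    (tr : 2 * h * gramDet p v₀ v₁ = -(inner p v₀ v₀ * inner p m₁ v₁
      - 2 * (inner p v₀ v₁ * inner p m₀ v₁) + inner p v₁ v₁ * inner p m₀ v₀)) :
    det3 y m₀ v₁ - det3 y m₁ v₀ = -2 * h * det3 y v₀ v₁ := by
  rw [inner_comm] at hm0 hm1
  simp only [gramDet, inner_eq_dot] at *
  rw [← det3_toFrame (p 2) y m₀, ← det3_toFrame (p 2) y m₁, ← det3_toFrame (p 2) y v₀]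
  exact frame_trace_identity _ _ _ _ _ _ h _ _ _ hn h0 h1 hm0 hm1 rfl rfl rfl hg sym tr

/-! ### Parametrized surfaces -/

lemma uniqueDiffOn_halfPlane : UniqueDiffOn ℝ HP := (𝓡∂ 2).uniqueDiffOn

/-- The unit normal `∂₀F × ∂₁F / |∂₀F × ∂₁F|`. -/
def normal (F : EuclideanSpace ℝ (Fin 2) → Sol) (u : EuclideanSpace ℝ (Fin 2)) : Sol :=
  unitNormal (F u) (pderiv 0 F u) (pderiv 1 F u)

/-- The Gram determinant of a parametrized surface. -/
def gram (F : EuclideanSpace ℝ (Fin 2) → Sol) (u : EuclideanSpace ℝ (Fin 2)) : ℝ :=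
  gramDet (F u) (pderiv 0 F u) (pderiv 1 F u)

/-- The mean curvature with respect to `normal F`. -/
def mc (F : EuclideanSpace ℝ (Fin 2) → Sol) (u : EuclideanSpace ℝ (Fin 2)) : ℝ :=
  meanCurvature F (normal F u) u

/-- The coefficients of the flux form: the flux of `killing a b` through curves in the surface,
plus `2h` times the primitive `beta a b`. -/
def fluxForm (a b : ℝ) (F : EuclideanSpace ℝ (Fin 2) → Sol) (i : Fin 2)
    (u : EuclideanSpace ℝ (Fin 2)) : ℝ :=
  det3 (killing a b (F u)) (normal F u) (pderiv i F u)
    + 2 * mc F u * beta a b (F u) (pderiv i F u)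

lemma gram_eq (F : EuclideanSpace ℝ (Fin 2) → Sol) (u : EuclideanSpace ℝ (Fin 2)) :
    firstForm F u 0 0 * firstForm F u 1 1 - firstForm F u 0 1 ^ 2 = gram F u := rfl

lemma isUnitNormal_normal {F : EuclideanSpace ℝ (Fin 2) → Sol} {u : EuclideanSpace ℝ (Fin 2)}
    (h : gram F u ≠ 0) : IsUnitNormal F (normal F u) u := by
  refine ⟨inner_unitNormal_self h, fun i => ?_⟩
  rw [normal, inner_unitNormal]
  fin_cases i <;> simp [det3_self_left, det3_self_right]

lemma meanCurvature_neg (F : EuclideanSpace ℝ (Fin 2) → Sol) (n : Sol)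
    (u : EuclideanSpace ℝ (Fin 2)) : meanCurvature F (-n) u = -meanCurvature F n u := by
  simp only [meanCurvature, secondForm, inner_neg_left]
  ring

/-- Division by zero yields 0, so a nonzero mean curvature forces a nonzero denominator. -/
lemma gram_ne_zero {F : EuclideanSpace ℝ (Fin 2) → Sol} {n : Sol} {u : EuclideanSpace ℝ (Fin 2)}
    (h : meanCurvature F n u ≠ 0) : gram F u ≠ 0 := by
  intro h0
  rw [meanCurvature, gram_eq, h0] at h
  simp at h

/-- The unit normal n may be either of two opposite vectors, so only the square can be compared with
the value for `normal F`. -/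
lemma mc_sq {F : EuclideanSpace ℝ (Fin 2) → Sol} {n : Sol} {u : EuclideanSpace ℝ (Fin 2)}
    (hn : IsUnitNormal F n u) (h : meanCurvature F n u ≠ 0) :
    mc F u ^ 2 = meanCurvature F n u ^ 2 := by
  rcases unitNormal_eq_or_neg (gram_ne_zero h) hn.1 (hn.2 0) (hn.2 1) with h1 | h1
  · rw [mc, normal, h1]
  · rw [h1, meanCurvature_neg, mc, normal, neg_sq]

section Smooth

variable {F : EuclideanSpace ℝ (Fin 2) → Sol} {u : EuclideanSpace ℝ (Fin 2)}

lemma contDiffWithinAt_pderiv (hF : ContDiffWithinAt ℝ ∞ F HP u) (hu : u ∈ HP) (i : Fin 2) :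
    ContDiffWithinAt ℝ ∞ (pderiv i F) HP u :=
  (hF.fderivWithin_right uniqueDiffOn_halfPlane (by simp) hu).clm_apply contDiffWithinAt_const

lemma contDiffWithinAt_inner {x v w : EuclideanSpace ℝ (Fin 2) → Sol}
    (hx : ContDiffWithinAt ℝ ∞ x HP u) (hv : ContDiffWithinAt ℝ ∞ v HP u)
    (hw : ContDiffWithinAt ℝ ∞ w HP u) :
    ContDiffWithinAt ℝ ∞ (fun u => inner (x u) (v u) (w u)) HP u := by
  rw [contDiffWithinAt_pi] at hx hv hw
  have hx := hx 2
  have hv0 := hv 0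
  have hv1 := hv 1
  have hv2 := hv 2
  have hw0 := hw 0
  have hw1 := hw 1
  have hw2 := hw 2
  simp only [inner_apply]
  fun_prop

lemma contDiffWithinAt_det3 {x v w : EuclideanSpace ℝ (Fin 2) → Sol}
    (hx : ContDiffWithinAt ℝ ∞ x HP u) (hv : ContDiffWithinAt ℝ ∞ v HP u)
    (hw : ContDiffWithinAt ℝ ∞ w HP u) :
    ContDiffWithinAt ℝ ∞ (fun u => det3 (x u) (v u) (w u)) HP u := by
  rw [contDiffWithinAt_pi] at hx hv hw
  have hx0 := hx 0
  have hx1 := hx 1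
  have hx2 := hx 2
  have hv0 := hv 0
  have hv1 := hv 1
  have hv2 := hv 2
  have hw0 := hw 0
  have hw1 := hw 1
  have hw2 := hw 2
  simp only [det3]
  fun_prop

lemma contDiffWithinAt_gram (hF : ContDiffWithinAt ℝ ∞ F HP u) (hu : u ∈ HP) :
    ContDiffWithinAt ℝ ∞ (gram F) HP u := by
  have h0 := contDiffWithinAt_pderiv hF hu 0
  have h1 := contDiffWithinAt_pderiv hF hu 1
  exact ((contDiffWithinAt_inner hF h0 h0).mul (contDiffWithinAt_inner hF h1 h1)).sub
    ((contDiffWithinAt_inner hF h0 h1).pow 2)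

lemma contDiffWithinAt_normal (hF : ContDiffWithinAt ℝ ∞ F HP u) (hu : u ∈ HP)
    (hg : gram F u ≠ 0) : ContDiffWithinAt ℝ ∞ (normal F) HP u := by
  have h0 := contDiffWithinAt_pderiv hF hu 0
  have h1 := contDiffWithinAt_pderiv hF hu 1
  have hg' := contDiffWithinAt_gram hF hu
  have hs : ContDiffWithinAt ℝ ∞ (fun u => (√(gram F u))⁻¹) HP u := by
    refine (hg'.sqrt hg).inv ?_
    exact (Real.sqrt_ne_zero (gramDet_nonneg _ _ _)).2 hg
  refine ContDiffWithinAt.smul hs ?_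
  rw [contDiffWithinAt_pi] at hF h0 h1 ⊢
  have hx := hF 2
  have h00 := h0 0
  have h01 := h0 1
  have h02 := h0 2
  have h10 := h1 0
  have h11 := h1 1
  have h12 := h1 2
  intro k
  fin_cases k <;> simp [cross] <;> fun_prop

lemma contDiffWithinAt_covDeriv {V : EuclideanSpace ℝ (Fin 2) → Sol}
    (hF : ContDiffWithinAt ℝ ∞ F HP u) (hV : ContDiffWithinAt ℝ ∞ V HP u) (hu : u ∈ HP)
    (i : Fin 2) : ContDiffWithinAt ℝ ∞ (covDeriv F V i) HP u := by
  have h0 := contDiffWithinAt_pderiv hF hu i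
  have h1 := contDiffWithinAt_pderiv hV hu i
  have : covDeriv F V i = fun u => cov (F u 2) (pderiv i F u) (V u) (pderiv i V u) :=
    funext fun u => covDeriv_eq_cov F V i u
  rw [this]
  rw [contDiffWithinAt_pi] at hF h0 h1 hV ⊢
  have hx := hF 2
  have h00 := h0 0
  have h01 := h0 1
  have h02 := h0 2
  have h10 := h1 0
  have h11 := h1 1
  have h12 := h1 2
  have hv0 := hV 0
  have hv1 := hV 1
  have hv2 := hV 2
  intro k
  fin_cases k <;> simp [cov] <;> fun_prop

lemma contDiffWithinAt_mc (hF : ContDiffWithinAt ℝ ∞ F HP u) (hu : u ∈ HP)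
    (hg : gram F u ≠ 0) : ContDiffWithinAt ℝ ∞ (mc F) HP u := by
  have hn := contDiffWithinAt_normal hF hu hg
  have h := contDiffWithinAt_pderiv hF hu
  have h1 : ∀ i j, ContDiffWithinAt ℝ ∞ (fun u => firstForm F u i j) HP u := fun i j =>
    contDiffWithinAt_inner hF (h i) (h j)
  have h2 : ∀ i j, ContDiffWithinAt ℝ ∞ (fun u => secondForm F (normal F u) u i j) HP u :=
    fun i j => contDiffWithinAt_inner hF hn (contDiffWithinAt_covDeriv hF (h j) hu i)
  have := contDiffWithinAt_gram hF hu
  refine contDiffWithinAt_const.mul (ContDiffWithinAt.div ((((h1 0 0).mul (h2 1 1)).sub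
    (contDiffWithinAt_const.mul ((h1 0 1).mul (h2 0 1)))).add ((h1 1 1).mul (h2 0 0))) this hg)

lemma contDiffWithinAt_beta (a b : ℝ) {V : EuclideanSpace ℝ (Fin 2) → Sol}
    (hF : ContDiffWithinAt ℝ ∞ F HP u) (hV : ContDiffWithinAt ℝ ∞ V HP u) :
    ContDiffWithinAt ℝ ∞ (fun u => beta a b (F u) (V u)) HP u := by
  rw [contDiffWithinAt_pi] at hF hV
  have h0 := hF 0
  have h1 := hF 1
  have h2 := hV 1
  have h3 := hV 2
  simp only [beta]
  fun_prop

lemma contDiffWithinAt_killing (a b : ℝ) (hF : ContDiffWithinAt ℝ ∞ F HP u) :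
    ContDiffWithinAt ℝ ∞ (fun u => killing a b (F u)) HP u := by
  rw [contDiffWithinAt_pi] at hF ⊢
  have h0 := hF 0
  have h1 := hF 1
  intro k
  fin_cases k <;> simp [killing] <;> fun_prop

lemma contDiffWithinAt_fluxForm (a b : ℝ) (hF : ContDiffWithinAt ℝ ∞ F HP u) (hu : u ∈ HP)
    (hg : gram F u ≠ 0) (i : Fin 2) : ContDiffWithinAt ℝ ∞ (fluxForm a b F i) HP u := by
  have hn := contDiffWithinAt_normal hF hu hg
  have h := contDiffWithinAt_pderiv hF hu
  exact (contDiffWithinAt_det3 (contDiffWithinAt_killing a b hF) hn (h i)).add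
    ((contDiffWithinAt_const.mul (contDiffWithinAt_mc hF hu hg)).mul
      (contDiffWithinAt_beta a b hF (h i)))

end Smooth

section Closed

variable {F : EuclideanSpace ℝ (Fin 2) → Sol} {u : EuclideanSpace ℝ (Fin 2)}

lemma mem_halfPlane_iff {u : EuclideanSpace ℝ (Fin 2)} : u ∈ HP ↔ 0 ≤ u 0 := by
  rw [range_modelWithCornersEuclideanHalfSpace]; rfl

lemma mem_interior_halfPlane_iff {u : EuclideanSpace ℝ (Fin 2)} : u ∈ interior HP ↔ 0 < u 0 := by
  rw [interior_range_modelWithCornersEuclideanHalfSpace]; rfl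

lemma hasDerivAt_line {V : EuclideanSpace ℝ (Fin 2) → Sol} (hu : u ∈ interior HP)
    (hV : ContDiffWithinAt ℝ ∞ V HP u) (i : Fin 2) :
    HasDerivAt (fun t : ℝ => V (u + t • EuclideanSpace.single i 1)) (pderiv i V u) 0 := by
  have h1 : HasFDerivAt V (fderivWithin ℝ V HP u) u := by
    rw [fderivWithin_of_mem_nhds (mem_interior_iff_mem_nhds.1 hu)]
    exact ((hV.contDiffAt (mem_interior_iff_mem_nhds.1 hu)).differentiableAt (by simp)).hasFDerivAt
  exact h1.hasLineDerivAt (EuclideanSpace.single i 1)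

lemma hasDerivAt_line_real {g : EuclideanSpace ℝ (Fin 2) → ℝ} (hu : u ∈ interior HP)
    (hg : ContDiffWithinAt ℝ ∞ g HP u) (i : Fin 2) :
    HasDerivAt (fun t : ℝ => g (u + t • EuclideanSpace.single i 1))
      (fderivWithin ℝ g HP u (EuclideanSpace.single i 1)) 0 := by
  have h1 : HasFDerivAt g (fderivWithin ℝ g HP u) u := by
    rw [fderivWithin_of_mem_nhds (mem_interior_iff_mem_nhds.1 hu)]
    exact ((hg.contDiffAt (mem_interior_iff_mem_nhds.1 hu)).differentiableAt (by simp)).hasFDerivAt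
  exact h1.hasLineDerivAt (EuclideanSpace.single i 1)

lemma pderiv_pderiv_eq (hu : u ∈ HP) (hF : ContDiffWithinAt ℝ ∞ F HP u) (i j : Fin 2) :
    pderiv i (pderiv j F) u = fderivWithin ℝ (fderivWithin ℝ F HP) HP u
      (EuclideanSpace.single i 1) (EuclideanSpace.single j 1) := by
  have h1 : DifferentiableWithinAt ℝ (fderivWithin ℝ F HP) HP u :=
    (hF.fderivWithin_right (m := ∞) uniqueDiffOn_halfPlane (by simp) hu).differentiableWithinAt
      (by simp)
  have : pderiv j F = fun u => fderivWithin ℝ F HP u (EuclideanSpace.single j 1) := rfl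
  rw [pderiv, this, fderivWithin_clm_apply (uniqueDiffOn_halfPlane u hu) h1
    (differentiableWithinAt_const _)]
  simp

/-- Boundary points are included: second derivatives within a set are symmetric at points in the
closure of its interior. -/
lemma pderiv_comm (hu : u ∈ HP) (hF : ContDiffWithinAt ℝ ∞ F HP u) (i j : Fin 2) :
    pderiv i (pderiv j F) u = pderiv j (pderiv i F) u := by
  rw [pderiv_pderiv_eq hu hF, pderiv_pderiv_eq hu hF]
  refine (hF.isSymmSndFDerivWithinAt (n := ∞)
    (by simpa using (ENat.LEInfty.out : (2 : WithTop ℕ∞) ≤ ∞)) uniqueDiffOn_halfPlane ?_ hu).eq _ _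
  exact (𝓡∂ 2).range_subset_closure_interior hu

lemma eventually_mem_line {s : Set (EuclideanSpace ℝ (Fin 2))} (hs : s ∈ 𝓝 u) (i : Fin 2) :
    ∀ᶠ t : ℝ in 𝓝 0, u + t • EuclideanSpace.single i 1 ∈ s := by
  have : ContinuousAt (fun t : ℝ => u + t • (EuclideanSpace.single i (1 : ℝ))) 0 := by fun_prop
  apply this
  simpa using hs

lemma gram_ne_zero_eventually (hu : u ∈ interior HP) (hF : ContDiffWithinAt ℝ ∞ F HP u)
    (hg : gram F u ≠ 0) : ∀ᶠ w in 𝓝 u, gram F w ≠ 0 := by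
  have h1 := (contDiffWithinAt_gram hF (interior_subset hu)).contDiffAt
    (mem_interior_iff_mem_nhds.1 hu)
  exact h1.continuousAt.eventually_ne hg

/-- The flux form of a surface of constant mean curvature is closed. -/
theorem fluxForm_closed (a b : ℝ) {h : ℝ} (hu : u ∈ interior HP)
    (hF : ContDiffWithinAt ℝ ∞ F HP u) (hg : gram F u ≠ 0) (hh : ∀ᶠ w in 𝓝 u, mc F w = h) :
    fderivWithin ℝ (fluxForm a b F 1) HP u (EuclideanSpace.single 0 1)
      = fderivWithin ℝ (fluxForm a b F 0) HP u (EuclideanSpace.single 1 1) := by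
  have hu' := interior_subset hu
  have hn := contDiffWithinAt_normal hF hu' hg
  have hA := contDiffWithinAt_pderiv hF hu'
  set p := F u with hp
  set n := normal F u with hndef
  set v₀ := pderiv 0 F u with hv0
  set v₁ := pderiv 1 F u with hv1
  set m : Fin 2 → Sol := fun i => cov (p 2) (pderiv i F u) n (pderiv i (normal F) u) with hm
  obtain ⟨hnn, hnv⟩ := isUnitNormal_normal hg
  have zero_add' : ∀ i : Fin 2, u + (0 : ℝ) • EuclideanSpace.single i (1 : ℝ) = u := by simp
  -- differentiate the relations
  have hmn : ∀ i, inner p (m i) n = 0 := by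
    intro i
    have h1 := hasDerivAt_inner (hasDerivAt_line hu hF i) (hasDerivAt_line hu hn i)
      (hasDerivAt_line hu hn i)
    simp only [zero_add'] at h1
    have h2 : (fun s : ℝ => inner (F (u + s • EuclideanSpace.single i 1))
        (normal F (u + s • EuclideanSpace.single i 1))
        (normal F (u + s • EuclideanSpace.single i 1))) =ᶠ[𝓝 0] fun _ => 1 := by
      filter_upwards [eventually_mem_line (gram_ne_zero_eventually hu hF hg) i] with s hs
      exact (isUnitNormal_normal hs).1
    have h3 := (h1.congr_of_eventuallyEq h2.symm).unique (hasDerivAt_const _ _)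
    rw [inner_comm p n] at h3
    change inner p (m i) n + inner p (m i) n = 0 at h3
    linarith
  have hmv : ∀ i j, inner p (m i) (pderiv j F u) = -secondForm F n u i j := by
    intro i j
    have h1 := hasDerivAt_inner (hasDerivAt_line hu hF i) (hasDerivAt_line hu hn i)
      (hasDerivAt_line hu (hA j) i)
    simp only [zero_add'] at h1
    have h2 : (fun s : ℝ => inner (F (u + s • EuclideanSpace.single i 1))
        (normal F (u + s • EuclideanSpace.single i 1))
        (pderiv j F (u + s • EuclideanSpace.single i 1))) =ᶠ[𝓝 0] fun _ => 0 := by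
      filter_upwards [eventually_mem_line (gram_ne_zero_eventually hu hF hg) i] with s hs
      exact (isUnitNormal_normal hs).2 j
    have h3 := (h1.congr_of_eventuallyEq h2.symm).unique (hasDerivAt_const _ _)
    rw [secondForm, covDeriv_eq_cov]
    linarith
  have hsymm : secondForm F n u 1 0 = secondForm F n u 0 1 := by
    rw [secondForm, secondForm, covDeriv_eq_cov, covDeriv_eq_cov, cov_comm,
      pderiv_comm hu' hF 1 0]
  -- The Weingarten relation `hmv` turns the definition of the mean curvature, cleared of its
  -- denominator, into the trace hypothesis of `trace_identity`.
  have hmc : 2 * h * gramDet p v₀ v₁ = -(inner p v₀ v₀ * inner p (m 1) v₁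
      - 2 * (inner p v₀ v₁ * inner p (m 0) v₁) + inner p v₁ v₁ * inner p (m 0) v₀) := by
    rw [hmv, hmv, hmv, ← hh.self_of_nhds, mc, meanCurvature, gram_eq]
    change 2 * (1 / 2 * (_ / gram F u)) * gram F u = _
    field_simp
    simp only [firstForm]
    ring
  have key := trace_identity (killing a b p) hnn (hnv 0) (hnv 1) (hmn 0) (hmn 1) hg
    (by rw [hmv, hmv, hsymm]) hmc
  have key2 := killing_identity a b hnn (hnv 0) (hnv 1)
  -- the derivatives of the flux form
  have hD : ∀ i j, fderivWithin ℝ (fluxForm a b F j) HP u (EuclideanSpace.single i 1) =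
      det3 (cov (p 2) (pderiv i F u) (killing a b p) ![-pderiv i F u 0, pderiv i F u 1, 0]) n
        (pderiv j F u) + det3 (killing a b p) (m i) (pderiv j F u)
      + det3 (killing a b p) n (cov (p 2) (pderiv i F u) (pderiv j F u) (pderiv i (pderiv j F) u))
      + 2 * h * (pderiv i F u 0 * pderiv j F u 1 + (p 0 - a) * pderiv i (pderiv j F) u 1
        - (pderiv i F u 0 * (p 1 - b) + (p 0 - a) * pderiv i F u 1) * pderiv j F u 2
        - (p 0 - a) * (p 1 - b) * pderiv i (pderiv j F) u 2) := by
    intro i j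
    have h1 := hasDerivAt_line_real hu (contDiffWithinAt_fluxForm a b hF hu' hg j) i
    have h2 := (hasDerivAt_det3 (x' := pderiv i F u) (p 2)
      (hasDerivAt_killing a b (hasDerivAt_line hu hF i)) (hasDerivAt_line hu hn i)
      (hasDerivAt_line hu (hA j) i)).add ((hasDerivAt_beta a b (hasDerivAt_line hu hF i)
        (hasDerivAt_line hu (hA j) i)).const_mul (2 * h))
    simp only [zero_add'] at h2
    refine (h1.congr_of_eventuallyEq ?_).unique h2
    -- Near u the mean curvature is the constant h, so it contributes no derivative term.
    filter_upwards [eventually_mem_line hh i] with s hs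
    have hs : mc F (u + s • EuclideanSpace.single i 1) = h := hs
    simp [fluxForm, hs]
  rw [hD, hD, pderiv_comm hu' hF 1 0, cov_comm (p 2) (pderiv 1 F u) (pderiv 0 F u)]
  simp only [← hv0, ← hv1]
  -- The identity dβ = ι_K vol, evaluated on v₀ and v₁. The second derivatives of F have already
  -- been matched by symmetry and vanishing torsion.
  have : det3 (killing a b p) v₀ v₁ = v₀ 0 * v₁ 1 - v₁ 0 * v₀ 1
      - (p 1 - b) * (v₀ 0 * v₁ 2 - v₁ 0 * v₀ 2) - (p 0 - a) * (v₀ 1 * v₁ 2 - v₁ 1 * v₀ 2) := by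
    simp [det3, killing]; ring
  rw [this] at key
  linear_combination key + key2

end Closed

/-! ### Behaviour under change of parametrization -/

/-- The partial derivative `∂_i τ^k` within the half plane. -/
def jac (τ : EuclideanSpace ℝ (Fin 2) → EuclideanSpace ℝ (Fin 2)) (i k : Fin 2)
    (u : EuclideanSpace ℝ (Fin 2)) : ℝ :=
  fderivWithin ℝ τ HP u (EuclideanSpace.single i 1) k

/-- The Jacobian determinant within the half plane. -/
def jacDet (τ : EuclideanSpace ℝ (Fin 2) → EuclideanSpace ℝ (Fin 2))
    (u : EuclideanSpace ℝ (Fin 2)) : ℝ :=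
  jac τ 0 0 u * jac τ 1 1 u - jac τ 0 1 u * jac τ 1 0 u

/-- `F' = F ∘ τ` near `u` in the half plane, where everything is smooth. -/
structure Reparam (F F' : EuclideanSpace ℝ (Fin 2) → Sol)
    (τ : EuclideanSpace ℝ (Fin 2) → EuclideanSpace ℝ (Fin 2)) (u : EuclideanSpace ℝ (Fin 2)) :
    Prop where
  mem : u ∈ HP
  eq : ∀ᶠ w in 𝓝[HP] u, F' w = F (τ w)
  mapsTo : ∀ᶠ w in 𝓝[HP] u, τ w ∈ HP
  smooth : ∀ᶠ w in 𝓝[HP] u, ContDiffWithinAt ℝ ∞ τ HP w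
  smooth' : ∀ᶠ w in 𝓝[HP] u, ContDiffWithinAt ℝ ∞ F HP (τ w)

lemma euclidean_two_eq (v : EuclideanSpace ℝ (Fin 2)) :
    v = v 0 • EuclideanSpace.single 0 (1 : ℝ) + v 1 • EuclideanSpace.single 1 (1 : ℝ) := by
  ext k
  fin_cases k <;> simp

/-- The chain rule within the half plane. -/
lemma fderivWithin_comp_jac {V : Type*} [NormedAddCommGroup V] [NormedSpace ℝ V]
    {G G' : EuclideanSpace ℝ (Fin 2) → V}
    {τ : EuclideanSpace ℝ (Fin 2) → EuclideanSpace ℝ (Fin 2)} {u : EuclideanSpace ℝ (Fin 2)}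
    (hu : u ∈ HP) (heq : G' =ᶠ[𝓝[HP] u] fun w => G (τ w))
    (hmaps : ∀ᶠ w in 𝓝[HP] u, τ w ∈ HP) (hτ : ContDiffWithinAt ℝ ∞ τ HP u)
    (hG : ContDiffWithinAt ℝ ∞ G HP (τ u)) (i : Fin 2) :
    fderivWithin ℝ G' HP u (EuclideanSpace.single i 1) =
      jac τ i 0 u • fderivWithin ℝ G HP (τ u) (EuclideanSpace.single 0 1)
      + jac τ i 1 u • fderivWithin ℝ G HP (τ u) (EuclideanSpace.single 1 1) := by
  have h1 : HasFDerivWithinAt τ (fderivWithin ℝ τ HP u) HP u :=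
    (hτ.differentiableWithinAt (by simp)).hasFDerivWithinAt
  have h2 : HasFDerivWithinAt G (fderivWithin ℝ G HP (τ u)) HP (τ u) :=
    (hG.differentiableWithinAt (by simp)).hasFDerivWithinAt
  have ht : Tendsto τ (𝓝[HP] u) (𝓝[HP] (τ u)) :=
    tendsto_nhdsWithin_iff.2 ⟨h1.continuousWithinAt, hmaps⟩
  have h3 := HasFDerivWithinAt.congr_of_eventuallyEq
    (h2.comp_of_tendsto u h1 ht) heq (heq.self_of_nhdsWithin hu)
  rw [h3.fderivWithin (uniqueDiffOn_halfPlane u hu)]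
  rw [ContinuousLinearMap.comp_apply, euclidean_two_eq (fderivWithin ℝ τ HP u _)]
  simp [jac]

section Reparam

variable {F F' : EuclideanSpace ℝ (Fin 2) → Sol}
  {τ : EuclideanSpace ℝ (Fin 2) → EuclideanSpace ℝ (Fin 2)} {u : EuclideanSpace ℝ (Fin 2)}

/-- The relation concerns germs, so it persists at nearby points. This allows the first-order chain
rule to be differentiated again. -/
lemma Reparam.eventually (h : Reparam F F' τ u) : ∀ᶠ w in 𝓝[HP] u, Reparam F F' τ w := by
  filter_upwards [eventually_eventually_nhdsWithin.2 h.eq,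
    eventually_eventually_nhdsWithin.2 h.mapsTo, eventually_eventually_nhdsWithin.2 h.smooth,
    eventually_eventually_nhdsWithin.2 h.smooth', self_mem_nhdsWithin] with w h1 h2 h3 h4 h5
  exact ⟨h5, h1, h2, h3, h4⟩

lemma Reparam.pderiv (h : Reparam F F' τ u) (i : Fin 2) :
    pderiv i F' u = jac τ i 0 u • pderiv 0 F (τ u) + jac τ i 1 u • pderiv 1 F (τ u) :=
  fderivWithin_comp_jac h.mem h.eq h.mapsTo (h.smooth.self_of_nhdsWithin h.mem)
    (h.smooth'.self_of_nhdsWithin h.mem) i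

lemma contDiffWithinAt_jac (hτ : ContDiffWithinAt ℝ ∞ τ HP u) (hu : u ∈ HP) (i k : Fin 2) :
    ContDiffWithinAt ℝ ∞ (jac τ i k) HP u := by
  have h := (hτ.fderivWithin_right (m := ∞) uniqueDiffOn_halfPlane (by simp) hu).clm_apply
    (contDiffWithinAt_const (c := EuclideanSpace.single i (1 : ℝ)))
  rw [contDiffWithinAt_euclidean] at h
  exact h k

lemma Reparam.pderiv_pderiv (h : Reparam F F' τ u) (i j : Fin 2) :
    SolSpace.pderiv i (SolSpace.pderiv j F') u =
      fderivWithin ℝ (jac τ j 0) HP u (EuclideanSpace.single i 1) • SolSpace.pderiv 0 F (τ u)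
      + jac τ j 0 u • (jac τ i 0 u • SolSpace.pderiv 0 (SolSpace.pderiv 0 F) (τ u)
        + jac τ i 1 u • SolSpace.pderiv 1 (SolSpace.pderiv 0 F) (τ u))
      + (fderivWithin ℝ (jac τ j 1) HP u (EuclideanSpace.single i 1) • SolSpace.pderiv 1 F (τ u)
      + jac τ j 1 u • (jac τ i 0 u • SolSpace.pderiv 0 (SolSpace.pderiv 1 F) (τ u)
        + jac τ i 1 u • SolSpace.pderiv 1 (SolSpace.pderiv 1 F) (τ u))) := by
  have hu := h.mem
  have hτ := h.smooth.self_of_nhdsWithin hu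
  have hF := h.smooth'.self_of_nhdsWithin hu
  have hm := h.mapsTo.self_of_nhdsWithin hu
  have hev : SolSpace.pderiv j F' =ᶠ[𝓝[HP] u] fun w =>
      jac τ j 0 w • SolSpace.pderiv 0 F (τ w) + jac τ j 1 w • SolSpace.pderiv 1 F (τ w) := by
    filter_upwards [h.eventually] with w hw using hw.pderiv j
  have hJ : ∀ k, DifferentiableWithinAt ℝ (jac τ j k) HP u := fun k =>
    (contDiffWithinAt_jac hτ hu j k).differentiableWithinAt (by simp)
  have ht : Tendsto τ (𝓝[HP] u) (𝓝[HP] (τ u)) :=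
    tendsto_nhdsWithin_iff.2 ⟨hτ.continuousWithinAt, h.mapsTo⟩
  have hA : ∀ k, DifferentiableWithinAt ℝ (fun w => SolSpace.pderiv k F (τ w)) HP u := fun k =>
    ((((contDiffWithinAt_pderiv hF hm k).differentiableWithinAt
      (by simp)).hasFDerivWithinAt.comp_of_tendsto
      u (hτ.differentiableWithinAt (by simp)).hasFDerivWithinAt ht)).differentiableWithinAt
  have hc : ∀ k, fderivWithin ℝ (fun w => SolSpace.pderiv k F (τ w)) HP u
      (EuclideanSpace.single i 1) = jac τ i 0 u • SolSpace.pderiv 0 (SolSpace.pderiv k F) (τ u)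
        + jac τ i 1 u • SolSpace.pderiv 1 (SolSpace.pderiv k F) (τ u) := fun k =>
    fderivWithin_comp_jac hu (EventuallyEq.rfl) h.mapsTo hτ (contDiffWithinAt_pderiv hF hm k) i
  have hU := uniqueDiffOn_halfPlane u hu
  conv_lhs => rw [SolSpace.pderiv]
  rw [hev.fderivWithin_eq (hev.self_of_nhdsWithin hu)]
  rw [fderivWithin_fun_add hU ((hJ 0).fun_smul (hA 0)) ((hJ 1).fun_smul (hA 1)),
    fderivWithin_fun_smul hU (hJ 0) (hA 0), fderivWithin_fun_smul hU (hJ 1) (hA 1)]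
  simp only [add_apply, smul_apply, hc,
    ContinuousLinearMap.smulRight_apply]
  abel

lemma cross_comb (z : ℝ) (v w : Sol) (a b c d : ℝ) :
    cross z (a • v + b • w) (c • v + d • w) = (a * d - b * c) • cross z v w := by
  ext k; fin_cases k <;> simp [cross] <;> ring

lemma gramDet_comb (p v w : Sol) (a b c d : ℝ) :
    gramDet p (a • v + b • w) (c • v + d • w) = (a * d - b * c) ^ 2 * gramDet p v w := by
  rw [gramDet_eq, gramDet_eq, cross_comb, inner_smul_left, inner_comm, inner_smul_left]
  ring

/-- The cross product scales by the determinant and its length by the absolute value, which leaves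
the sign. -/
lemma unitNormal_comb (p v w : Sol) {a b c d : ℝ} (h : a * d - b * c ≠ 0) :
    unitNormal p (a • v + b • w) (c • v + d • w)
      = ((SignType.sign (a * d - b * c) : SignType) : ℝ) • unitNormal p v w := by
  rw [unitNormal, unitNormal, cross_comb, gramDet_comb, Real.sqrt_mul (sq_nonneg _),
    Real.sqrt_sq_eq_abs, smul_smul]
  rcases lt_or_gt_of_ne h with h1 | h1
  · rw [sign_neg h1, abs_of_neg h1, smul_smul]
    congr 1
    rw [SignType.coe_neg, SignType.coe_one]
    field_simp
  · rw [sign_pos h1, abs_of_pos h1, smul_smul]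
    congr 1
    rw [SignType.coe_one]
    field_simp

lemma Reparam.gram (h : Reparam F F' τ u) :
    gram F' u = jacDet τ u ^ 2 * SolSpace.gram F (τ u) := by
  rw [SolSpace.gram, SolSpace.gram, h.pderiv, h.pderiv, gramDet_comb,
    h.eq.self_of_nhdsWithin h.mem, jacDet]

lemma Reparam.normal (h : Reparam F F' τ u) (hJ : jacDet τ u ≠ 0) :
    normal F' u = ((SignType.sign (jacDet τ u) : SignType) : ℝ) • SolSpace.normal F (τ u) := by
  rw [SolSpace.normal, SolSpace.normal, h.pderiv, h.pderiv,
    unitNormal_comb _ _ _ (by simpa [jacDet] using hJ), h.eq.self_of_nhdsWithin h.mem, jacDet]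

/-- The terms with second derivatives of τ are tangential, and n annihilates them. -/
lemma Reparam.secondForm (h : Reparam F F' τ u) {n : Sol} (hn : IsUnitNormal F n (τ u))
    (i j : Fin 2) : secondForm F' n u i j =
      jac τ i 0 u * jac τ j 0 u * SolSpace.secondForm F n (τ u) 0 0
      + jac τ i 0 u * jac τ j 1 u * SolSpace.secondForm F n (τ u) 0 1
      + jac τ i 1 u * jac τ j 0 u * SolSpace.secondForm F n (τ u) 1 0
      + jac τ i 1 u * jac τ j 1 u * SolSpace.secondForm F n (τ u) 1 1 := by
  have h0 := hn.2 0
  have h1 := hn.2 1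
  simp only [SolSpace.secondForm, covDeriv_eq_cov, h.pderiv, h.pderiv_pderiv,
    h.eq.self_of_nhdsWithin h.mem]
  simp only [inner_apply, cov, Pi.add_apply, Pi.smul_apply, smul_eq_mul, Matrix.cons_val_zero,
    Matrix.cons_val_one, Matrix.cons_val] at h0 h1 ⊢
  linear_combination (fderivWithin ℝ (jac τ j 0) HP u (EuclideanSpace.single i 1)) * h0
    + (fderivWithin ℝ (jac τ j 1) HP u (EuclideanSpace.single i 1)) * h1

lemma inner_comb (p v w : Sol) (a b c d : ℝ) :
    inner p (a • v + b • w) (c • v + d • w) = a * c * inner p v v + (a * d + b * c) * inner p v w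
      + b * d * inner p w w := by
  simp [inner_apply]; ring

lemma secondForm_comm {n : Sol} (hF : ContDiffWithinAt ℝ ∞ F HP u) (hu : u ∈ HP) :
    SolSpace.secondForm F n u 1 0 = SolSpace.secondForm F n u 0 1 := by
  rw [SolSpace.secondForm, SolSpace.secondForm, covDeriv_eq_cov, covDeriv_eq_cov, cov_comm,
    pderiv_comm hu hF 1 0]

lemma Reparam.meanCurvature (h : Reparam F F' τ u) (hJ : jacDet τ u ≠ 0) {n : Sol}
    (hn : IsUnitNormal F n (τ u)) :
    meanCurvature F' n u = SolSpace.meanCurvature F n (τ u) := by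
  rw [SolSpace.meanCurvature, SolSpace.meanCurvature, gram_eq, gram_eq, h.gram,
    h.secondForm hn, h.secondForm hn, h.secondForm hn,
    secondForm_comm (h.smooth'.self_of_nhdsWithin h.mem) (h.mapsTo.self_of_nhdsWithin h.mem)]
  simp only [firstForm, h.pderiv, inner_comb, h.eq.self_of_nhdsWithin h.mem]
  generalize inner (F (τ u)) (SolSpace.pderiv 0 F (τ u)) (SolSpace.pderiv 0 F (τ u)) = E
  generalize inner (F (τ u)) (SolSpace.pderiv 0 F (τ u)) (SolSpace.pderiv 1 F (τ u)) = f
  generalize inner (F (τ u)) (SolSpace.pderiv 1 F (τ u)) (SolSpace.pderiv 1 F (τ u)) = G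
  generalize SolSpace.secondForm F n (τ u) 0 0 = e'
  generalize SolSpace.secondForm F n (τ u) 0 1 = f'
  generalize SolSpace.secondForm F n (τ u) 1 1 = g'
  -- Numerator and denominator both scale by the squared Jacobian determinant.
  rw [← mul_div_mul_left (E * g' - 2 * (f * f') + G * e') (SolSpace.gram F (τ u))
    (pow_ne_zero 2 hJ)]
  congr 2
  rw [jacDet]
  ring

lemma Reparam.mc (h : Reparam F F' τ u) (hJ : jacDet τ u ≠ 0) (hg : SolSpace.gram F (τ u) ≠ 0) :
    mc F' u = ((SignType.sign (jacDet τ u) : SignType) : ℝ) * SolSpace.mc F (τ u) := by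
  have hn := h.meanCurvature hJ (isUnitNormal_normal hg)
  rw [SolSpace.mc, SolSpace.mc, h.normal hJ]
  rcases lt_or_gt_of_ne hJ with h1 | h1
  · rw [sign_neg h1, SignType.coe_neg, SignType.coe_one, neg_one_smul, meanCurvature_neg, hn]
    ring
  · rw [sign_pos h1, SignType.coe_one, one_smul, hn, one_mul]

/-- Both summands of the flux form are odd in the normal, the second through the mean curvature. It
is therefore pulled back as a twisted 1-form, with the sign of the Jacobian. -/
lemma Reparam.fluxForm (a b : ℝ) (h : Reparam F F' τ u) (hJ : jacDet τ u ≠ 0)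
    (hg : SolSpace.gram F (τ u) ≠ 0) (i : Fin 2) :
    fluxForm a b F' i u = ((SignType.sign (jacDet τ u) : SignType) : ℝ) *
      (jac τ i 0 u * SolSpace.fluxForm a b F 0 (τ u)
        + jac τ i 1 u * SolSpace.fluxForm a b F 1 (τ u)) := by
  rw [SolSpace.fluxForm, SolSpace.fluxForm, SolSpace.fluxForm, h.mc hJ hg, h.normal hJ, h.pderiv,
    h.eq.self_of_nhdsWithin h.mem]
  simp only [det3, beta, Pi.add_apply, Pi.smul_apply, smul_eq_mul]
  ring

/-- The density `dφ ∧ Ω`, with `Ω` the flux form, changes by the absolute value of the Jacobian. -/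
lemma Reparam.wedge (a b : ℝ) (h : Reparam F F' τ u) (hJ : jacDet τ u ≠ 0)
    (hg : SolSpace.gram F (τ u) ≠ 0) {φ φ' : EuclideanSpace ℝ (Fin 2) → ℝ}
    (hφ : φ' =ᶠ[𝓝[HP] u] fun w => φ (τ w)) (hs : ContDiffWithinAt ℝ ∞ φ HP (τ u)) :
    fderivWithin ℝ φ' HP u (EuclideanSpace.single 0 1) * SolSpace.fluxForm a b F' 1 u
      - fderivWithin ℝ φ' HP u (EuclideanSpace.single 1 1) * SolSpace.fluxForm a b F' 0 u
    = |jacDet τ u| * (fderivWithin ℝ φ HP (τ u) (EuclideanSpace.single 0 1)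
        * SolSpace.fluxForm a b F 1 (τ u)
      - fderivWithin ℝ φ HP (τ u) (EuclideanSpace.single 1 1)
        * SolSpace.fluxForm a b F 0 (τ u)) := by
  have hτ := h.smooth.self_of_nhdsWithin h.mem
  rw [fderivWithin_comp_jac h.mem hφ h.mapsTo hτ hs, fderivWithin_comp_jac h.mem hφ h.mapsTo hτ hs,
    h.fluxForm a b hJ hg, h.fluxForm a b hJ hg, ← sign_mul_self (jacDet τ u)]
  simp only [jacDet, smul_eq_mul]
  ring

end Reparam

/-! ### Stokes' theorem on the half plane -/

/-- Stokes' theorem on the half plane `{0 ≤ x}` for compactly supported fields. -/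
lemma integral_divergence_halfPlane {f g : ℝ × ℝ → ℝ} {f' g' : ℝ × ℝ → ℝ × ℝ →L[ℝ] ℝ} {R : ℝ}
    (hR : 0 ≤ R) (hf : ContinuousOn f {q | 0 ≤ q.1}) (hg : ContinuousOn g {q | 0 ≤ q.1})
    (hf' : ∀ q : ℝ × ℝ, 0 < q.1 → HasFDerivAt f (f' q) q)
    (hg' : ∀ q : ℝ × ℝ, 0 < q.1 → HasFDerivAt g (g' q) q)
    (hD : ContinuousOn (fun q => f' q (1, 0) + g' q (0, 1)) {q | 0 ≤ q.1})
    (hf0 : ∀ q : ℝ × ℝ, 0 ≤ q.1 → (R ≤ q.1 ∨ R ≤ |q.2|) → f q = 0)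
    (hg0 : ∀ q : ℝ × ℝ, 0 ≤ q.1 → (R ≤ q.1 ∨ R ≤ |q.2|) → g q = 0)
    (hD0 : ∀ q : ℝ × ℝ, 0 ≤ q.1 → (R < q.1 ∨ R < |q.2|) → f' q (1, 0) + g' q (0, 1) = 0) :
    ∫ q in {q : ℝ × ℝ | 0 ≤ q.1}, (f' q (1, 0) + g' q (0, 1)) = -∫ y, f (0, y) := by
  -- Everything happens in the box [0, R] × [-R, R], and only its side on the axis x = 0
  -- contributes.
  have hsub : Icc ((0 : ℝ), -R) (R, R) ⊆ {q : ℝ × ℝ | 0 ≤ q.1} := fun q hq => hq.1.1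
  have h1 : ∫ q in {q : ℝ × ℝ | 0 ≤ q.1}, (f' q (1, 0) + g' q (0, 1))
      = ∫ q in Icc ((0 : ℝ), -R) (R, R), (f' q (1, 0) + g' q (0, 1)) := by
    refine setIntegral_eq_of_subset_of_forall_sdiff_eq_zero
      (measurableSet_le measurable_const measurable_fst) hsub ?_
    rintro ⟨x, y⟩ ⟨hx, hq⟩
    refine hD0 _ hx ?_
    by_contra hcon
    push Not at hcon
    exact hq ⟨⟨hx, (abs_le.1 hcon.2).1⟩, ⟨hcon.1, (abs_le.1 hcon.2).2⟩⟩
  rw [h1, integral_divergence_prod_Icc_of_hasFDerivAt_of_le f g f' g' (0, -R) (R, R)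
    ⟨hR, by simpa using hR⟩ (hf.mono hsub) (hg.mono hsub) (fun q hq => hf' q hq.1.1)
    (fun q hq => hg' q hq.1.1) ((hD.mono hsub).integrableOn_compact isCompact_Icc)]
  have e1 : ∫ x in (0 : ℝ)..R, g (x, R) = 0 := by
    rw [intervalIntegral.integral_congr (g := fun _ => 0), intervalIntegral.integral_zero]
    intro x hx
    rw [uIcc_of_le hR] at hx
    exact hg0 _ hx.1 (Or.inr (le_abs_self R))
  have e2 : ∫ x in (0 : ℝ)..R, g (x, -R) = 0 := by
    rw [intervalIntegral.integral_congr (g := fun _ => 0), intervalIntegral.integral_zero]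
    intro x hx
    rw [uIcc_of_le hR] at hx
    exact hg0 _ hx.1 (Or.inr (by simpa using le_abs_self R))
  have e3 : ∫ y in (-R)..R, f (R, y) = 0 := by
    rw [intervalIntegral.integral_congr (g := fun _ => 0), intervalIntegral.integral_zero]
    intro x hx
    exact hf0 _ hR (Or.inl le_rfl)
  have e4 : ∫ y in (-R)..R, f (0, y) = ∫ y, f (0, y) := by
    rw [intervalIntegral.integral_of_le (by linarith)]
    refine setIntegral_eq_integral_of_forall_compl_eq_zero ?_
    intro y hy
    refine hf0 _ le_rfl (Or.inr ?_)
    by_contra hcon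
    push Not at hcon
    rw [abs_lt] at hcon
    exact hy ⟨hcon.1, hcon.2.le⟩
  simp only [e1, e2, e3, e4]
  ring

/-- The identification of `ℝ × ℝ` with the Euclidean plane. -/
def planeEquiv : (ℝ × ℝ) ≃L[ℝ] EuclideanSpace ℝ (Fin 2) :=
  (ContinuousLinearEquiv.finTwoArrow ℝ ℝ).symm.trans (EuclideanSpace.equiv (Fin 2) ℝ).symm

lemma planeEquiv_fst : planeEquiv (1, 0) = EuclideanSpace.single 0 1 := by
  ext i; fin_cases i <;> simp [planeEquiv]

lemma planeEquiv_snd : planeEquiv (0, 1) = EuclideanSpace.single 1 1 := by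
  ext i; fin_cases i <;> simp [planeEquiv]

lemma measurePreserving_planeEquiv : MeasurePreserving planeEquiv volume volume := by
  have h1 := (EuclideanSpace.volume_preserving_symm_measurableEquiv_toLp (Fin 2)).symm
  have h2 := (volume_preserving_finTwoArrow ℝ).symm
  exact h1.comp h2

/-- Stokes' theorem on the half plane `HP` for compactly supported smooth `1`-forms
`P du₀ + Q du₁`. -/
lemma stokes_halfPlane {P Q : EuclideanSpace ℝ (Fin 2) → ℝ} {K : Set (EuclideanSpace ℝ (Fin 2))}
    (hK : IsCompact K) (hP : ∀ u ∈ HP, ContDiffWithinAt ℝ ∞ P HP u)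
    (hQ : ∀ u ∈ HP, ContDiffWithinAt ℝ ∞ Q HP u) (hP0 : ∀ u ∈ HP, u ∉ K → P u = 0)
    (hQ0 : ∀ u ∈ HP, u ∉ K → Q u = 0) :
    ∫ u in HP, (fderivWithin ℝ Q HP u (EuclideanSpace.single 0 1)
      - fderivWithin ℝ P HP u (EuclideanSpace.single 1 1)) = -∫ s : ℝ, Q (planeEquiv (0, s)) := by
  obtain ⟨R, hR0, hR⟩ := hK.isBounded.exists_pos_norm_le
  have hvan : ∀ q : ℝ × ℝ, (R < q.1 ∨ R < |q.2|) → planeEquiv q ∉ K := by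
    intro q hq hqK
    have h1 := hR _ hqK
    have h2 : |q.1| ≤ R := (PiLp.norm_apply_le (planeEquiv q) 0).trans h1
    have h3 : |q.2| ≤ R := (PiLp.norm_apply_le (planeEquiv q) 1).trans h1
    rcases hq with hq | hq
    · linarith [le_abs_self q.1]
    · linarith
  have hmem : ∀ q : ℝ × ℝ, 0 ≤ q.1 → planeEquiv q ∈ HP := fun q hq => mem_halfPlane_iff.2 hq
  have hcont : ∀ g : EuclideanSpace ℝ (Fin 2) → ℝ, ContinuousOn g HP →
      ContinuousOn (fun q => g (planeEquiv q)) {q | 0 ≤ q.1} := fun g hg =>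
    hg.comp planeEquiv.continuous.continuousOn fun q hq => hmem q hq
  have hder : ∀ g : EuclideanSpace ℝ (Fin 2) → ℝ, (∀ u ∈ HP, ContDiffWithinAt ℝ ∞ g HP u) →
      ∀ q : ℝ × ℝ, 0 < q.1 → HasFDerivAt (fun q => g (planeEquiv q))
        ((fderivWithin ℝ g HP (planeEquiv q)).comp (planeEquiv : ℝ × ℝ →L[ℝ] _)) q := by
    intro g hg q hq
    have hi : planeEquiv q ∈ interior HP := mem_interior_halfPlane_iff.2 hq
    have h1 : HasFDerivAt g (fderivWithin ℝ g HP (planeEquiv q)) (planeEquiv q) := by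
      rw [fderivWithin_of_mem_nhds (mem_interior_iff_mem_nhds.1 hi)]
      exact (((hg _ (interior_subset hi)).contDiffAt
        (mem_interior_iff_mem_nhds.1 hi)).differentiableAt (by simp)).hasFDerivAt
    exact h1.comp q planeEquiv.hasFDerivAt
  have hdc : ∀ g : EuclideanSpace ℝ (Fin 2) → ℝ, (∀ u ∈ HP, ContDiffWithinAt ℝ ∞ g HP u) →
      ∀ i, ContinuousOn (fun u => fderivWithin ℝ g HP u (EuclideanSpace.single i 1)) HP := by
    intro g hg i u hu
    exact (((hg u hu).fderivWithin_right (m := 0) uniqueDiffOn_halfPlane (by simp)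
      hu).clm_apply contDiffWithinAt_const).continuousWithinAt
  have hd0 : ∀ g : EuclideanSpace ℝ (Fin 2) → ℝ, (∀ u ∈ HP, u ∉ K → g u = 0) →
      ∀ u ∈ HP, u ∉ K → fderivWithin ℝ g HP u = 0 := by
    intro g hg u hu huK
    have : g =ᶠ[𝓝[HP] u] fun _ => 0 := by
      filter_upwards [self_mem_nhdsWithin, mem_nhdsWithin_of_mem_nhds
        (hK.isClosed.isOpen_compl.mem_nhds huK)] with w hw hwK using hg w hw hwK
    rw [this.fderivWithin_eq (hg u hu huK)]
    simp
  have hPc : ContinuousOn P HP := fun u hu => (hP u hu).continuousWithinAt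
  have hQc : ContinuousOn Q HP := fun u hu => (hQ u hu).continuousWithinAt
  have hpre : planeEquiv ⁻¹' HP = {q : ℝ × ℝ | 0 ≤ q.1} := by
    ext q; exact mem_halfPlane_iff
  rw [← measurePreserving_planeEquiv.setIntegral_preimage_emb
    planeEquiv.toHomeomorph.measurableEmbedding, hpre]
  -- The divergence of (Q, -P) is the coefficient of d(P du₀ + Q du₁). Points of K may have norm
  -- exactly R, so the larger box of size R + 1 makes both components vanish on its outer sides.
  have := integral_divergence_halfPlane (f := fun q => Q (planeEquiv q))
    (g := fun q => -P (planeEquiv q)) (R := R + 1) (by linarith) (hcont Q hQc) (hcont P hPc).neg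
    (hder Q hQ) (fun q hq => (hder P hP q hq).neg) ?_ ?_ ?_ ?_
  · rw [← this]
    refine setIntegral_congr_fun (measurableSet_le measurable_const measurable_fst) fun q _ => ?_
    simp [planeEquiv_fst, planeEquiv_snd, sub_eq_add_neg]
  · simp only [ContinuousLinearMap.comp_apply, neg_apply,
      ContinuousLinearEquiv.coe_coe, planeEquiv_fst, planeEquiv_snd]
    exact (hcont _ (hdc Q hQ 0)).add (hcont _ (hdc P hP 1)).neg
  · intro q hq h
    exact hQ0 _ (hmem q hq) (hvan q (h.imp (fun h => by linarith) fun h => by linarith))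
  · intro q hq h
    simp [hP0 _ (hmem q hq) (hvan q (h.imp (fun h => by linarith) fun h => by linarith))]
  · intro q hq h
    have h1 := hvan q (h.imp (fun h => by linarith) fun h => by linarith)
    rw [ContinuousLinearMap.comp_apply, neg_apply, ContinuousLinearMap.comp_apply,
      hd0 Q hQ0 _ (hmem q hq) h1, hd0 P hP0 _ (hmem q hq) h1]
    simp

lemma det_eq_jacDet (τ : EuclideanSpace ℝ (Fin 2) → EuclideanSpace ℝ (Fin 2))
    (u : EuclideanSpace ℝ (Fin 2)) : (fderivWithin ℝ τ HP u).det = jacDet τ u := by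
  rw [ContinuousLinearMap.det, ← LinearMap.det_toMatrix (EuclideanSpace.basisFun (Fin 2) ℝ).toBasis,
    Matrix.det_fin_two]
  simp [LinearMap.toMatrix_apply, jacDet, jac]
  ring

local notation "φ" => extChartAt (𝓡∂ 2)

/-! ### The flux form on M and Stokes' theorem with a partition of unity -/

section Charts

variable {M : Type*} [TopologicalSpace M] [ChartedSpace (EuclideanHalfSpace 2) M]

/-- The representation of a map on `M` in the chart at `p`. -/
def rep {V : Type*} (g : M → V) (p : M) : EuclideanSpace ℝ (Fin 2) → V :=
  g ∘ (φ p).symm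

/-- The domain of the change of charts from `p` to `q`. -/
def overlap (p q : M) : Set (EuclideanSpace ℝ (Fin 2)) :=
  ((φ p).symm.trans (φ q)).source

lemma mem_overlap {p q : M} {u : EuclideanSpace ℝ (Fin 2)} :
    u ∈ overlap p q ↔ u ∈ (φ p).target ∧ (φ p).symm u ∈ (φ q).source := by
  rw [overlap, PartialEquiv.trans_source]; rfl

/-- The change of charts from `p` to `q`. -/
def change (p q : M) : EuclideanSpace ℝ (Fin 2) → EuclideanSpace ℝ (Fin 2) :=
  φ q ∘ (φ p).symm

lemma overlap_mem_nhdsWithin {p q : M} {u : EuclideanSpace ℝ (Fin 2)} (hu : u ∈ overlap p q) :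
    overlap p q ∈ 𝓝[HP] u :=
  (𝓡∂ 2).extendCoordChange_source_mem_nhdsWithin hu

lemma measurableSet_target (p : M) : MeasurableSet (φ p).target := by
  rw [extChartAt_target]
  exact (((chartAt _ p).open_target.preimage (𝓡∂ 2).continuous_symm).measurableSet).inter
    (𝓡∂ 2).isClosed_range.measurableSet

lemma measurableSet_overlap (p q : M) : MeasurableSet (overlap p q) := by
  change MeasurableSet ((𝓡∂ 2).extendCoordChange (chartAt _ p) (chartAt _ q)).source
  rw [(𝓡∂ 2).extendCoordChange_source, (𝓡∂ 2).image_eq]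
  exact (((OpenPartialHomeomorph.open_source _).preimage
    (𝓡∂ 2).continuous_symm).measurableSet).inter (𝓡∂ 2).isClosed_range.measurableSet

lemma change_mapsTo (p q : M) : MapsTo (change p q) (overlap p q) (overlap q p) :=
  ((φ p).symm.trans (φ q)).mapsTo

lemma change_injOn (p q : M) : InjOn (change p q) (overlap p q) :=
  ((φ p).symm.trans (φ q)).injOn

lemma change_image (p q : M) : change p q '' overlap p q = overlap q p :=
  ((φ p).symm.trans (φ q)).image_source_eq_target

lemma rep_change {V : Type*} (g : M → V) {p q : M} {u : EuclideanSpace ℝ (Fin 2)}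
    (hu : u ∈ overlap p q) : rep g q (change p q u) = rep g p u := by
  simp only [rep, change, Function.comp]
  rw [(φ q).left_inv (mem_overlap.1 hu).2]

lemma target_subset_halfPlane (p : M) : (φ p).target ⊆ HP := extChartAt_target_subset_range p

lemma rep_eq_zero {g : M → ℝ} {p : M} {u : EuclideanSpace ℝ (Fin 2)}
    (hs : (φ p).symm u ∉ tsupport g) : rep g p u = 0 :=
  image_eq_zero_of_notMem_tsupport (f := g) hs

/-- The density of `dg ∧ Ω`, with `Ω` the flux form, in the chart at `p`. -/
def wedge (a b : ℝ) (f : M → Sol) (g : M → ℝ) (p : M) (u : EuclideanSpace ℝ (Fin 2)) : ℝ :=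
  fderivWithin ℝ (rep g p) HP u (EuclideanSpace.single 0 1) * fluxForm a b (rep f p) 1 u
    - fderivWithin ℝ (rep g p) HP u (EuclideanSpace.single 1 1) * fluxForm a b (rep f p) 0 u

lemma fderivWithin_rep_eq_zero {g : M → ℝ} {p : M} {u : EuclideanSpace ℝ (Fin 2)}
    (hu : u ∈ (φ p).target) (hs : (φ p).symm u ∉ tsupport g) :
    fderivWithin ℝ (rep g p) HP u = 0 := by
  have h1 : ∀ᶠ w in 𝓝[HP] u, (φ p).symm w ∈ (tsupport g)ᶜ := by
    rw [← nhdsWithin_extChartAt_target_eq_of_mem hu]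
    exact (continuousOn_extChartAt_symm p u hu)
      ((isClosed_tsupport g).isOpen_compl.mem_nhds hs)
  have h2 : rep g p =ᶠ[𝓝[HP] u] fun _ => 0 := by
    filter_upwards [h1] with w hw
    exact rep_eq_zero hw
  rw [h2.fderivWithin_eq (rep_eq_zero hs)]
  simp

lemma wedge_eq_zero (a b : ℝ) {g : M → ℝ} {p : M} {u : EuclideanSpace ℝ (Fin 2)}
    (hu : u ∈ (φ p).target) (hs : (φ p).symm u ∉ tsupport g) : wedge a b f g p u = 0 := by
  rw [wedge, fderivWithin_rep_eq_zero hu hs]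
  simp

lemma isCompact_image_tsupport [CompactSpace M] {r : M → ℝ} {p : M}
    (hr : tsupport r ⊆ (φ p).source) : IsCompact (φ p '' tsupport r) :=
  ((isClosed_tsupport r).isCompact).image_of_continuousOn ((continuousOn_extChartAt p).mono hr)

lemma image_tsupport_subset {r : M → ℝ} {p : M} (hr : tsupport r ⊆ (φ p).source) :
    φ p '' tsupport r ⊆ (φ p).target := by
  rintro _ ⟨x, hx, rfl⟩
  exact (φ p).map_source (hr hx)

lemma integrableOn_target [CompactSpace M] {r : M → ℝ} {p : M} (hr : tsupport r ⊆ (φ p).source)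
    {g : EuclideanSpace ℝ (Fin 2) → ℝ} (hg : ContinuousOn g (φ p).target)
    (h0 : ∀ u ∈ (φ p).target, (φ p).symm u ∉ tsupport r → g u = 0) :
    IntegrableOn g (φ p).target := by
  refine IntegrableOn.of_forall_sdiff_eq_zero
    ((hg.mono (image_tsupport_subset hr)).integrableOn_compact (isCompact_image_tsupport hr))
    (measurableSet_target p) ?_
  rintro u ⟨hu, hu'⟩
  refine h0 u hu fun h => hu' ⟨_, h, (φ p).right_inv hu⟩

/-- All points of all charts are nondegenerate for `f`, with mean curvature of absolute value
`|H|`. -/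
structure IsCMC (f : M → Sol) (H : ℝ) : Prop where
  smooth : ContMDiff (𝓡∂ 2) 𝓘(ℝ, Sol) ∞ f
  ne_zero : H ≠ 0
  gram_ne_zero : ∀ p : M, ∀ u ∈ (φ p).target, gram (rep f p) u ≠ 0
  mc_sq : ∀ p : M, ∀ u ∈ (φ p).target, mc (rep f p) u ^ 2 = H ^ 2

lemma HasConstantMeanCurvature.isCMC {f : M → Sol} {H : ℝ} (hf : IsSmoothImmersion f)
    (hH : HasConstantMeanCurvature f H) (h0 : H ≠ 0) : IsCMC f H := by
  refine ⟨hf.1, h0, fun p u hu => ?_, fun p u hu => ?_⟩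
  · obtain ⟨n, -, hn'⟩ := hH p u hu
    exact SolSpace.gram_ne_zero (n := n) (by rw [rep, hn']; exact h0)
  · obtain ⟨n, hn, hn'⟩ := hH p u hu
    rw [rep, SolSpace.mc_sq hn (by rw [hn']; exact h0), hn']

variable [IsManifold (𝓡∂ 2) ∞ M]

lemma contDiffWithinAt_rep {V : Type*} [NormedAddCommGroup V] [NormedSpace ℝ V] {g : M → V}
    (hg : ContMDiff (𝓡∂ 2) 𝓘(ℝ, V) ∞ g) {p : M} {u : EuclideanSpace ℝ (Fin 2)}
    (hu : u ∈ (φ p).target) : ContDiffWithinAt ℝ ∞ (rep g p) HP u := by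
  have h1 : ContMDiffOn 𝓘(ℝ, EuclideanSpace ℝ (Fin 2)) 𝓘(ℝ, V) ∞ (g ∘ (φ p).symm) (φ p).target :=
    hg.comp_contMDiffOn (contMDiffOn_extChartAt_symm p)
  exact ((contMDiffOn_iff_contDiffOn.1 h1) u hu).mono_of_mem_nhdsWithin
    (extChartAt_target_mem_nhdsWithin_of_mem hu)

lemma contDiffWithinAt_change {p q : M} {u : EuclideanSpace ℝ (Fin 2)}
    (hu : u ∈ overlap p q) : ContDiffWithinAt ℝ ∞ (change p q) HP u :=
  contDiffWithinAt_ext_coord_change q p hu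

lemma reparam_change {f : M → Sol} (hf : ContMDiff (𝓡∂ 2) 𝓘(ℝ, Sol) ∞ f) {p q : M}
    {u : EuclideanSpace ℝ (Fin 2)} (hu : u ∈ overlap p q) :
    Reparam (rep f q) (rep f p) (change p q) u := by
  have hm := overlap_mem_nhdsWithin hu
  refine ⟨target_subset_halfPlane p (mem_overlap.1 hu).1, ?_, ?_, ?_, ?_⟩
  · filter_upwards [hm] with w hw using (rep_change f hw).symm
  · filter_upwards [hm] with w hw
    exact target_subset_halfPlane q (mem_overlap.1 (change_mapsTo p q hw)).1
  · filter_upwards [hm] with w hw using contDiffWithinAt_change hw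
  · filter_upwards [hm] with w hw
    exact contDiffWithinAt_rep hf (mem_overlap.1 (change_mapsTo p q hw)).1

lemma jacDet_change_ne_zero {p q : M} {u : EuclideanSpace ℝ (Fin 2)} (hu : u ∈ overlap p q) :
    jacDet (change p q) u ≠ 0 := by
  have h1 : HasFDerivWithinAt (change p q) (fderivWithin ℝ (change p q) HP u) HP u :=
    ((contDiffWithinAt_change hu).differentiableWithinAt (by simp)).hasFDerivWithinAt
  have h2 := (𝓡∂ 2).isInvertible_fderivWithin_extendCoordChange (n := ∞) (by simp)
    (IsManifold.chart_mem_maximalAtlas (I := 𝓡∂ 2) p)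
    (IsManifold.chart_mem_maximalAtlas (I := 𝓡∂ 2) q) hu
  have h3 : fderivWithin ℝ (change p q) (overlap p q) u = fderivWithin ℝ (change p q) HP u :=
    (h1.mono ((fun w hw => target_subset_halfPlane p (mem_overlap.1 hw).1))).fderivWithin
      ((𝓡∂ 2).uniqueDiffOn_extendCoordChange_source u hu)
  change (fderivWithin ℝ (change p q) (overlap p q) u).IsInvertible at h2
  rw [h3] at h2
  obtain ⟨e, he⟩ := h2
  rw [← det_eq_jacDet, ← he]
  exact (e.toLinearEquiv.isUnit_det').ne_zero

variable {f : M → Sol} {H : ℝ}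

lemma IsCMC.wedge_change (hf : IsCMC f H) (a b : ℝ) {g : M → ℝ}
    (hg : ContMDiff (𝓡∂ 2) 𝓘(ℝ) ∞ g) {p q : M} {u : EuclideanSpace ℝ (Fin 2)}
    (hu : u ∈ overlap p q) :
    wedge a b f g p u = |jacDet (change p q) u| * wedge a b f g q (change p q u) := by
  have hq := (mem_overlap.1 (change_mapsTo p q hu)).1
  refine (reparam_change hf.smooth hu).wedge a b (jacDet_change_ne_zero hu)
    (hf.gram_ne_zero q _ hq) ?_ (contDiffWithinAt_rep hg hq)
  filter_upwards [overlap_mem_nhdsWithin hu] with w hw using (rep_change g hw).symm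

lemma IsCMC.integral_overlap (hf : IsCMC f H) (a b : ℝ) {g r : M → ℝ}
    (hg : ContMDiff (𝓡∂ 2) 𝓘(ℝ) ∞ g) (p q : M) :
    ∫ u in overlap q p, rep r q u * wedge a b f g q u
      = ∫ u in overlap p q, rep r p u * wedge a b f g p u := by
  rw [← change_image p q, integral_image_eq_integral_abs_det_fderiv_smul volume
    (measurableSet_overlap p q) (f' := fun u => fderivWithin ℝ (change p q) HP u)
    (fun u hu => ((contDiffWithinAt_change hu).differentiableWithinAt
      (by simp)).hasFDerivWithinAt.mono
      fun w hw => target_subset_halfPlane p (mem_overlap.1 hw).1) (change_injOn p q)]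
  refine setIntegral_congr_fun (measurableSet_overlap p q) fun u hu => ?_
  simp only [smul_eq_mul]
  rw [det_eq_jacDet, hf.wedge_change a b hg hu, rep_change r hu]
  ring

/-- The density r dg ∧ Ω is supported in the intersection of the two chart domains, since g lives in
one and r in the other. On that intersection the change of variables formula applies. -/
lemma IsCMC.integral_wedge_comm (hf : IsCMC f H) (a b : ℝ) {g r : M → ℝ}
    (hg : ContMDiff (𝓡∂ 2) 𝓘(ℝ) ∞ g) {p q : M} (hgs : tsupport g ⊆ (φ p).source)
    (hrs : tsupport r ⊆ (φ q).source) :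
    ∫ u in (φ p).target, rep r p u * wedge a b f g p u
      = ∫ u in (φ q).target, rep r q u * wedge a b f g q u := by
  rw [setIntegral_eq_of_subset_of_forall_sdiff_eq_zero (measurableSet_target p)
    (fun u hu => (mem_overlap.1 hu).1 : overlap p q ⊆ (φ p).target),
    setIntegral_eq_of_subset_of_forall_sdiff_eq_zero (measurableSet_target q)
    (fun u hu => (mem_overlap.1 hu).1 : overlap q p ⊆ (φ q).target), hf.integral_overlap a b hg]
  · rintro u ⟨hu, hu'⟩
    rw [wedge_eq_zero a b hu, mul_zero]
    exact fun h => hu' (mem_overlap.2 ⟨hu, hgs h⟩)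
  · rintro u ⟨hu, hu'⟩
    rw [rep_eq_zero fun h => hu' (mem_overlap.2 ⟨hu, hrs h⟩), zero_mul]

lemma IsCMC.contDiffWithinAt_fluxForm (hf : IsCMC f H) (a b : ℝ) {p : M}
    {u : EuclideanSpace ℝ (Fin 2)} (hu : u ∈ (φ p).target) (i : Fin 2) :
    ContDiffWithinAt ℝ ∞ (fluxForm a b (rep f p) i) HP u :=
  SolSpace.contDiffWithinAt_fluxForm a b (contDiffWithinAt_rep hf.smooth hu)
    (target_subset_halfPlane p hu) (hf.gram_ne_zero p u hu) i

lemma IsCMC.continuousOn_wedge (hf : IsCMC f H) (a b : ℝ) {g : M → ℝ}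
    (hg : ContMDiff (𝓡∂ 2) 𝓘(ℝ) ∞ g) (p : M) : ContinuousOn (wedge a b f g p) (φ p).target := by
  intro u hu
  have hu' := target_subset_halfPlane p hu
  have h1 : ∀ i : Fin 2, ContinuousWithinAt
      (fun u => fderivWithin ℝ (rep g p) HP u (EuclideanSpace.single i 1)) HP u := fun i =>
    (((contDiffWithinAt_rep hg hu).fderivWithin_right (m := 0) uniqueDiffOn_halfPlane (by simp)
      hu').clm_apply contDiffWithinAt_const).continuousWithinAt
  have h2 := fun i => (hf.contDiffWithinAt_fluxForm a b hu i).continuousWithinAt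
  exact (((h1 0).mul (h2 1)).sub ((h1 1).mul (h2 0))).mono (target_subset_halfPlane p)

lemma continuousOn_rep {g : M → ℝ} (hg : ContMDiff (𝓡∂ 2) 𝓘(ℝ) ∞ g) (p : M) :
    ContinuousOn (rep g p) (φ p).target := fun _ hu =>
  (contDiffWithinAt_rep hg hu).continuousWithinAt.mono (target_subset_halfPlane p)

/-- The integrals of `dρᵢ ∧ Ω` over the charts add up to zero, for a partition of unity `ρ`. -/
lemma IsCMC.sum_integral_wedge [CompactSpace M] (hf : IsCMC f H) (a b : ℝ) {ι : Type*} [Fintype ι]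
    {c : ι → M} {ρ : ι → M → ℝ} (hρ : ∀ i, ContMDiff (𝓡∂ 2) 𝓘(ℝ) ∞ (ρ i))
    (hs : ∀ i, tsupport (ρ i) ⊆ (φ (c i)).source) (h1 : ∀ x, ∑ i, ρ i x = 1) :
    ∑ i, ∫ u in (φ (c i)).target, wedge a b f (ρ i) (c i) u = 0 := by
  have hI : ∀ i j, IntegrableOn (fun u => rep (ρ j) (c i) u * wedge a b f (ρ i) (c i) u)
      (φ (c i)).target := fun i j =>
    integrableOn_target (hs i) ((continuousOn_rep (hρ j) _).mul (hf.continuousOn_wedge a b (hρ i) _))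
      fun _ hu h => by rw [wedge_eq_zero a b hu h, mul_zero]
  have hI' : ∀ i j, IntegrableOn (fun u => rep (ρ j) (c j) u * wedge a b f (ρ i) (c j) u)
      (φ (c j)).target := fun i j =>
    integrableOn_target (hs j) ((continuousOn_rep (hρ j) _).mul (hf.continuousOn_wedge a b (hρ i) _))
      fun _ _ h => by rw [rep_eq_zero h, zero_mul]
  -- Insert ∑ⱼ ρⱼ = 1, move the (i, j) term to the chart of j, and sum over i first: ∑ᵢ dρᵢ = d1 =
  -- 0.
  calc ∑ i, ∫ u in (φ (c i)).target, wedge a b f (ρ i) (c i) u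
      = ∑ i, ∑ j, ∫ u in (φ (c i)).target, rep (ρ j) (c i) u * wedge a b f (ρ i) (c i) u := by
        refine Finset.sum_congr rfl fun i _ => ?_
        rw [← integral_finsetSum _ fun j _ => hI i j]
        refine integral_congr_ae (Eventually.of_forall fun u => ?_)
        simp only
        rw [← Finset.sum_mul]
        simp [rep, h1]
    _ = ∑ j, ∑ i, ∫ u in (φ (c j)).target, rep (ρ j) (c j) u * wedge a b f (ρ i) (c j) u := by
        rw [Finset.sum_comm]
        refine Finset.sum_congr rfl fun j _ => Finset.sum_congr rfl fun i _ => ?_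
        exact hf.integral_wedge_comm a b (hρ i) (hs i) (hs j)
    _ = 0 := by
        refine Finset.sum_eq_zero fun j _ => ?_
        rw [← integral_finsetSum _ fun i _ => hI' i j]
        refine setIntegral_eq_zero_of_forall_eq_zero fun u hu => ?_
        rw [← Finset.mul_sum]
        have hu' := target_subset_halfPlane _ hu
        have hz : ∑ i, fderivWithin ℝ (rep (ρ i) (c j)) HP u = 0 := by
          rw [← fderivWithin_fun_sum (uniqueDiffOn_halfPlane u hu') fun i _ =>
            (contDiffWithinAt_rep (hρ i) hu).differentiableWithinAt (by simp)]
          have : (fun w => ∑ i, rep (ρ i) (c j) w) = fun _ => 1 := by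
            funext w; simp [rep, h1]
          rw [this]; simp
        have hz' : ∀ v, ∑ i, fderivWithin ℝ (rep (ρ i) (c j)) HP u v = 0 := fun v => by
          rw [← sum_apply, hz]; rfl
        simp only [wedge, Finset.sum_sub_distrib, ← Finset.sum_mul, hz']
        simp

/-- A continuous function whose square is a fixed nonzero number cannot change sign locally. -/
lemma IsCMC.mc_eventually_eq (hf : IsCMC f H) {p : M} {u : EuclideanSpace ℝ (Fin 2)}
    (hu : u ∈ (φ p).target) : ∀ᶠ w in 𝓝[HP] u, mc (rep f p) w = mc (rep f p) u := by
  have h1 := (contDiffWithinAt_mc (contDiffWithinAt_rep hf.smooth hu)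
    (target_subset_halfPlane p hu) (hf.gram_ne_zero p u hu)).continuousWithinAt
  have h2 : mc (rep f p) u ≠ 0 := by
    intro h
    have := hf.mc_sq p u hu
    rw [h] at this
    exact hf.ne_zero (by simpa using this.symm)
  have h3 : ∀ᶠ w in 𝓝[HP] u, 0 < mc (rep f p) w * mc (rep f p) u :=
    (h1.mul_const _).eventually_const_lt (mul_self_pos.2 h2)
  filter_upwards [h3, extChartAt_target_mem_nhdsWithin_of_mem hu] with w hw hwt
  rcases sq_eq_sq_iff_eq_or_eq_neg.1 ((hf.mc_sq p w hwt).trans (hf.mc_sq p u hu).symm) with h | h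
  · exact h
  · rw [h] at hw
    nlinarith [mul_self_nonneg (mc (rep f p) u)]

/-- Stokes' theorem for `ρ Ω`, with `Ω` the flux form and `ρ` supported in a chart. -/
lemma IsCMC.integral_wedge [CompactSpace M] (hf : IsCMC f H) (a b : ℝ) {r : M → ℝ}
    (hr : ContMDiff (𝓡∂ 2) 𝓘(ℝ) ∞ r) {p : M} (hs : tsupport r ⊆ (φ p).source) :
    ∫ u in (φ p).target, wedge a b f r p u = -∫ s : ℝ,
      (φ p).target.indicator (fun u => rep r p u * fluxForm a b (rep f p) 1 u)
        (planeEquiv (0, s)) := by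
  classical
  -- The coefficients of r Ω extended by zero. They are smooth on the whole half plane because the
  -- support of r is compact inside the chart.
  set A : Fin 2 → EuclideanSpace ℝ (Fin 2) → ℝ := fun i =>
    (φ p).target.indicator (fun u => rep r p u * fluxForm a b (rep f p) i u) with hA
  have hzero : ∀ i u, u ∉ φ p '' tsupport r → A i u = 0 := by
    intro i u hu
    by_cases hut : u ∈ (φ p).target
    · rw [hA]
      simp only
      rw [indicator_of_mem hut, rep_eq_zero fun h => hu ⟨_, h, (φ p).right_inv hut⟩, zero_mul]
    · exact indicator_of_notMem hut _
  have heq : ∀ i, ∀ u ∈ (φ p).target,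
      A i =ᶠ[𝓝[HP] u] fun u => rep r p u * fluxForm a b (rep f p) i u := by
    intro i u hu
    filter_upwards [extChartAt_target_mem_nhdsWithin_of_mem hu] with w hw
    exact indicator_of_mem hw _
  have hcompact := isCompact_image_tsupport hs
  have hsm : ∀ i, ∀ u ∈ HP, ContDiffWithinAt ℝ ∞ (A i) HP u := by
    intro i u hu
    by_cases hut : u ∈ (φ p).target
    · exact ((contDiffWithinAt_rep hr hut).mul
        (hf.contDiffWithinAt_fluxForm a b hut i)).congr_of_eventuallyEq (heq i u hut)
        (indicator_of_mem hut _)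
    · have h2 : A i =ᶠ[𝓝[HP] u] fun _ => 0 := by
        filter_upwards [mem_nhdsWithin_of_mem_nhds (hcompact.isClosed.isOpen_compl.mem_nhds
          fun h => hut (image_tsupport_subset hs h))] with w hw using hzero i w hw
      exact contDiffWithinAt_const.congr_of_eventuallyEq h2 (indicator_of_notMem hut _)
  rw [← stokes_halfPlane hcompact (hsm 0) (hsm 1) (fun u _ h => hzero 0 u h)
    fun u _ h => hzero 1 u h]
  -- Closedness of Ω is available only at interior points, which suffices because the boundary line
  -- is null.
  have hfr : volume (frontier HP) = 0 := (𝓡∂ 2).convex_range.addHaar_frontier _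
  have hint : ∀ᵐ u ∂volume, u ∉ frontier HP := measure_eq_zero_iff_ae_notMem.1 hfr
  rw [← integral_indicator (measurableSet_target p),
    ← integral_indicator (𝓡∂ 2).isClosed_range.measurableSet]
  refine integral_congr_ae ?_
  filter_upwards [hint] with u hu
  by_cases huH : u ∈ HP
  · rw [indicator_of_mem huH]
    have hui : u ∈ interior HP := by
      by_contra h
      exact hu ⟨subset_closure huH, h⟩
    by_cases hut : u ∈ (φ p).target
    · rw [indicator_of_mem hut]
      have hU := uniqueDiffOn_halfPlane u huH
      have d1 := (contDiffWithinAt_rep hr hut).differentiableWithinAt (by simp)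
      have d2 := fun i =>
        (hf.contDiffWithinAt_fluxForm a b hut i).differentiableWithinAt (by simp)
      have hmc := hf.mc_eventually_eq hut
      rw [nhdsWithin_eq_nhds.2 (mem_interior_iff_mem_nhds.1 hui)] at hmc
      have hcl := fluxForm_closed a b hui (contDiffWithinAt_rep hf.smooth hut)
        (hf.gram_ne_zero p u hut) hmc
      rw [(heq 0 u hut).fderivWithin_eq ((heq 0 u hut).self_of_nhdsWithin huH),
        (heq 1 u hut).fderivWithin_eq ((heq 1 u hut).self_of_nhdsWithin huH),
        fderivWithin_fun_mul hU d1 (d2 0), fderivWithin_fun_mul hU d1 (d2 1)]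
      simp only [add_apply, smul_apply, smul_eq_mul, wedge]
      -- In d(rΩ) = dr ∧ Ω + r dΩ the last term vanishes.
      rw [hcl]
      ring
    · rw [indicator_of_notMem hut]
      have hz : ∀ i, fderivWithin ℝ (A i) HP u = 0 := by
        intro i
        have h2 : A i =ᶠ[𝓝[HP] u] fun _ => 0 := by
          filter_upwards [mem_nhdsWithin_of_mem_nhds (hcompact.isClosed.isOpen_compl.mem_nhds
            fun h => hut (image_tsupport_subset hs h))] with w hw using hzero i w hw
        rw [h2.fderivWithin_eq (h2.self_of_nhdsWithin huH)]
        simp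
      rw [hz, hz]
      simp
  · rw [indicator_of_notMem huH, indicator_of_notMem fun h => huH (target_subset_halfPlane p h)]

/-- The flux formula in terms of a partition of unity. -/
theorem IsCMC.sum_boundary_integral [CompactSpace M] (hf : IsCMC f H) (a b : ℝ) {ι : Type*}
    [Fintype ι] {c : ι → M} {ρ : ι → M → ℝ} (hρ : ∀ i, ContMDiff (𝓡∂ 2) 𝓘(ℝ) ∞ (ρ i))
    (hs : ∀ i, tsupport (ρ i) ⊆ (φ (c i)).source) (h1 : ∀ x, ∑ i, ρ i x = 1) :
    ∑ i, ∫ s : ℝ, (φ (c i)).target.indicator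
      (fun u => rep (ρ i) (c i) u * fluxForm a b (rep f (c i)) 1 u) (planeEquiv (0, s)) = 0 := by
  have := hf.sum_integral_wedge a b hρ hs h1
  simp_rw [fun i => hf.integral_wedge a b (hρ i) (hs i)] at this
  rw [Finset.sum_neg_distrib, neg_eq_zero] at this
  exact this

end Charts

/-! ### The boundary of M and its parametrization by γ -/

section Boundary

variable {M : Type*} [TopologicalSpace M] [ChartedSpace (EuclideanHalfSpace 2) M]

/-- A lift `b : ℝ → ∂M` of the parametrized boundary curve `γ`. -/
structure BoundaryLift (f : M → Sol) (γ : ℝ → Sol) (b : ℝ → M) : Prop where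
  continuous : Continuous b
  mem : ∀ t, b t ∈ (𝓡∂ 2).boundary M
  lift : ∀ t, f (b t) = γ t

/-- The boundary coordinate of `b t` in the chart at `p`. -/
def bdryCoord (b : ℝ → M) (p : M) (t : ℝ) : ℝ := φ p (b t) 1

variable {f : M → Sol} {γ : ℝ → Sol} {b : ℝ → M} {H : ℝ}

lemma BoundaryLift.eventually_mem (hb : BoundaryLift f γ b) {p : M} {t : ℝ}
    (ht : b t ∈ (φ p).source) : ∀ᶠ s in 𝓝 t, b s ∈ (φ p).source :=
  hb.continuous.continuousAt ((isOpen_extChartAt_source p).mem_nhds ht)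

lemma BoundaryLift.continuousAt_chart (hb : BoundaryLift f γ b) {p : M} {t : ℝ}
    (ht : b t ∈ (φ p).source) : ContinuousAt (fun s => φ p (b s)) t :=
  (continuousAt_extChartAt' ht).comp hb.continuous.continuousAt

lemma gramDet_zero_right (p v : Sol) : gramDet p v 0 = 0 := by
  simp [gramDet, inner_apply]

lemma IsCMC.pderiv_one_ne_zero (hf : IsCMC f H) {p : M} {u : EuclideanSpace ℝ (Fin 2)}
    (hu : u ∈ (φ p).target) : pderiv 1 (rep f p) u ≠ 0 := by
  intro h
  apply hf.gram_ne_zero p u hu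
  rw [gram, h, gramDet_zero_right]

lemma BoundaryLift.continuousAt_bdryCoord (hb : BoundaryLift f γ b) {p : M} {t : ℝ}
    (ht : b t ∈ (φ p).source) : ContinuousAt (bdryCoord b p) t :=
  (EuclideanSpace.proj (𝕜 := ℝ) (1 : Fin 2)).continuous.continuousAt.comp (hb.continuousAt_chart ht)

variable [IsManifold (𝓡∂ 2) ∞ M]

/-- Being a boundary point is defined in the chart at x itself. Smooth invariance of the interior
transfers it to any other chart around x. -/
lemma extChartAt_zero_of_mem_boundary {p x : M} (hx : x ∈ (𝓡∂ 2).boundary M)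
    (hp : x ∈ (φ p).source) : φ p x 0 = 0 := by
  have h0 : 0 ≤ φ p x 0 :=
    mem_halfPlane_iff.1 (target_subset_halfPlane p ((φ p).map_source hp))
  refine le_antisymm ?_ h0
  by_contra! h
  have hi : φ p x ∈ interior HP := mem_interior_halfPlane_iff.2 h
  have h1 := extChartAt_target_mem_nhdsWithin_of_mem ((φ p).map_source hp)
  rw [nhdsWithin_eq_nhds.2 (mem_interior_iff_mem_nhds.1 hi)] at h1
  have h2 : (𝓡∂ 2).IsInteriorPoint x :=
    ((𝓡∂ 2).isInteriorPoint_iff_of_mem_atlas (n := ∞) (by simp) (chart_mem_atlas _ p)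
      (by simpa using hp)).2 (mem_interior_iff_mem_nhds.2 h1)
  exact ((𝓡∂ 2).isBoundaryPoint_iff_not_isInteriorPoint x).1 hx h2

lemma symm_mem_boundary {p : M} {u : EuclideanSpace ℝ (Fin 2)} (hu : u ∈ (φ p).target)
    (h0 : u 0 = 0) : (φ p).symm u ∈ (𝓡∂ 2).boundary M := by
  refine ((𝓡∂ 2).isBoundaryPoint_iff_not_isInteriorPoint _).2 fun h => ?_
  have h1 := ((𝓡∂ 2).isInteriorPoint_iff_of_mem_atlas (n := ∞) (by simp) (chart_mem_atlas _ p)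
      (by simpa using (φ p).map_target hu)).1 h
  change φ p ((φ p).symm u) ∈ interior (φ p).target at h1
  rw [(φ p).right_inv hu] at h1
  have h2 := mem_interior_halfPlane_iff.1 (interior_mono (target_subset_halfPlane p) h1)
  rw [h0] at h2
  exact lt_irrefl _ h2

/-- The boundary is compact and f is injective on it, so f restricts to a closed embedding. The lift
is its inverse applied to γ, hence continuous. -/
lemma exists_boundaryLift [CompactSpace M] {f : M → Sol} (hf : Continuous f)
    {γ : ℝ → Sol} (hγ : Continuous γ) (h : Spans f (range γ)) : ∃ b, BoundaryLift f γ b := by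
  have hcomp : CompactSpace ((𝓡∂ 2).boundary M) :=
    isCompact_iff_compactSpace.1
      ((𝓡∂ 2).isClosed_boundary (M := M) (n := ∞) (by simp)).isCompact
  have hex : ∀ t, ∃ x : (𝓡∂ 2).boundary M, f x = γ t := fun t => by
    obtain ⟨x, hx, hxt⟩ := h.surjOn (mem_range_self t)
    exact ⟨⟨x, hx⟩, hxt⟩
  choose b hb using hex
  have hemb : Topology.IsClosedEmbedding (fun x : (𝓡∂ 2).boundary M => f x) :=
    (hf.comp continuous_subtype_val).isClosedEmbedding fun x y hxy =>
      Subtype.ext (h.injOn x.2 y.2 hxy)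
  have hbc : Continuous b := by
    rw [hemb.isEmbedding.continuous_iff]
    have : (fun x : (𝓡∂ 2).boundary M => f x) ∘ b = γ := funext hb
    rw [this]
    exact hγ
  exact ⟨fun t => b t, continuous_subtype_val.comp hbc, fun t => (b t).2, hb⟩

lemma BoundaryLift.planeEquiv_bdryCoord (hb : BoundaryLift f γ b) {p : M} {t : ℝ}
    (ht : b t ∈ (φ p).source) : planeEquiv (0, bdryCoord b p t) = φ p (b t) := by
  ext i
  fin_cases i
  · exact (extChartAt_zero_of_mem_boundary (hb.mem t) ht).symm
  · rfl

lemma BoundaryLift.rep_bdryCoord (hb : BoundaryLift f γ b) {p : M} {t : ℝ}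
    (ht : b t ∈ (φ p).source) : rep f p (planeEquiv (0, bdryCoord b p t)) = γ t := by
  rw [hb.planeEquiv_bdryCoord ht, rep, Function.comp, (φ p).left_inv ht, hb.lift]

lemma hasDerivAt_planeEquiv_snd (s : ℝ) :
    HasDerivAt (fun s : ℝ => planeEquiv (0, s)) (EuclideanSpace.single 1 1) s := by
  rw [← planeEquiv_snd]
  exact planeEquiv.hasFDerivAt.comp_hasDerivAt s ((hasDerivAt_const s (0 : ℝ)).prodMk (hasDerivAt_id s))

lemma planeEquiv_zero_mem (s : ℝ) : planeEquiv (0, s) ∈ HP := mem_halfPlane_iff.2 le_rfl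

lemma hasDerivAt_boundary_line {F : EuclideanSpace ℝ (Fin 2) → Sol} {s : ℝ}
    (hF : ContDiffWithinAt ℝ ∞ F HP (planeEquiv (0, s))) :
    HasDerivAt (fun s => F (planeEquiv (0, s))) (pderiv 1 F (planeEquiv (0, s))) s :=
  (hF.differentiableWithinAt (by simp)).hasFDerivWithinAt.comp_hasDerivAt s
    (hasDerivAt_planeEquiv_snd s) (Eventually.of_forall planeEquiv_zero_mem)

lemma contDiffAt_boundary_line {F : EuclideanSpace ℝ (Fin 2) → Sol} {s : ℝ}
    (hF : ContDiffWithinAt ℝ ∞ F HP (planeEquiv (0, s))) :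
    ContDiffAt ℝ ∞ (fun s => F (planeEquiv (0, s))) s := by
  have h1 : ContDiffAt ℝ ∞ (fun s : ℝ => planeEquiv (0, s)) s :=
    planeEquiv.contDiff.contDiffAt.comp s (contDiffAt_const.prodMk contDiffAt_id)
  have := hF.comp (s := univ) s h1.contDiffWithinAt fun s _ => planeEquiv_zero_mem s
  rwa [contDiffWithinAt_univ] at this

/-- The lift is only known to be continuous. Differentiability comes from the inverse function
theorem: some component of f has nonzero derivative along the boundary line, and the boundary
coordinate is the local inverse of that component applied to the same component of γ. -/
lemma BoundaryLift.hasDerivAt_bdryCoord (hb : BoundaryLift f γ b) (hf : IsCMC f H)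
    (hγ : Differentiable ℝ γ) {p : M} {t : ℝ} (ht : b t ∈ (φ p).source) :
    HasDerivAt (bdryCoord b p) (deriv (bdryCoord b p) t) t ∧
      deriv (bdryCoord b p) t • pderiv 1 (rep f p) (φ p (b t)) = deriv γ t := by
  have hu := (φ p).map_source ht
  have hP := hb.planeEquiv_bdryCoord ht
  have hF : ContDiffWithinAt ℝ ∞ (rep f p) HP (planeEquiv (0, bdryCoord b p t)) := by
    rw [hP]; exact contDiffWithinAt_rep hf.smooth hu
  have hc := hasDerivAt_boundary_line hF
  obtain ⟨k, hk⟩ := Function.ne_iff.1 (hf.pderiv_one_ne_zero hu)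
  rw [Pi.zero_apply] at hk
  set g : ℝ → ℝ := fun s => rep f p (planeEquiv (0, s)) k with hg
  have hgd : HasDerivAt g (pderiv 1 (rep f p) (φ p (b t)) k) (bdryCoord b p t) := by
    have := (hasDerivAt_pi.1 hc) k
    rwa [hP] at this
  have hgs : HasStrictDerivAt g (pderiv 1 (rep f p) (φ p (b t)) k) (bdryCoord b p t) :=
    ((contDiffAt_pi.1 (contDiffAt_boundary_line hF)) k).hasStrictDerivAt' hgd (by simp)
  have hinv := hgs.to_localInverse hk
  have hleft := (hgs.hasStrictFDerivAt_equiv hk).eventually_left_inverse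
  have hγd : HasDerivAt γ (deriv γ t) t := (hγ t).hasDerivAt
  have hgt : g (bdryCoord b p t) = γ t k := congrFun (hb.rep_bdryCoord ht) k
  rw [hgt] at hinv
  have h1 := hinv.hasDerivAt.comp t (hasDerivAt_pi.1 hγd k)
  have h2 : bdryCoord b p =ᶠ[𝓝 t] (hgs.localInverse g _ _ hk) ∘ fun s => γ s k := by
    filter_upwards [(hb.continuousAt_bdryCoord ht).eventually hleft, hb.eventually_mem ht]
      with s hs hs'
    have hs2 : g (bdryCoord b p s) = γ s k := congrFun (hb.rep_bdryCoord hs') k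
    rw [Function.comp, ← hs2]
    exact hs.symm
  have h3 : HasDerivAt (bdryCoord b p) (deriv (bdryCoord b p) t) t :=
    (h1.congr_of_eventuallyEq h2).differentiableAt.hasDerivAt
  refine ⟨h3, ?_⟩
  have h4 := hc.scomp t h3
  rw [hP] at h4
  refine (h4.congr_of_eventuallyEq ?_).unique hγd
  filter_upwards [hb.eventually_mem ht] with s hs using (hb.rep_bdryCoord hs).symm

/-- Change of variables from the boundary line of a chart to the parameter of `γ`. -/
lemma BoundaryLift.integral_chart (hb : BoundaryLift f γ b) (hf : IsCMC f H) {T : ℝ}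
    (hγ : IsClosedEmbeddedCurve γ T) (hM : Spans f (range γ)) {p : M} {r : M → ℝ}
    (hr : tsupport r ⊆ (φ p).source) {G : EuclideanSpace ℝ (Fin 2) → ℝ} {k : ℝ → ℝ}
    (hk : ∀ t, b t ∈ (φ p).source → |deriv (bdryCoord b p) t| * G (φ p (b t)) = k t) :
    ∫ s : ℝ, (φ p).target.indicator (fun u => rep r p u * G u) (planeEquiv (0, s))
      = ∫ t in (0 : ℝ)..T, r (b t) * k t := by
  have hγd : Differentiable ℝ γ := hγ.smooth.differentiable (by simp)
  set S : Set ℝ := Ico 0 T ∩ {t | b t ∈ (φ p).source} with hS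
  have hSm : MeasurableSet S := measurableSet_Ico.inter
    ((isOpen_extChartAt_source p).preimage hb.continuous).measurableSet
  have hinj : InjOn (bdryCoord b p) S := by
    rintro s ⟨hs, hs'⟩ t ⟨ht, ht'⟩ hst
    refine hγ.injOn hs ht ?_
    rw [← hb.rep_bdryCoord hs', ← hb.rep_bdryCoord ht', hst]
  -- One period reaches every boundary point of the chart exactly once. For surjectivity, such a
  -- point maps into Γ, its parameter is shifted into [0, T), and injectivity of f on the boundary
  -- identifies it with the lift.
  have himg : bdryCoord b p '' S = {s | planeEquiv (0, s) ∈ (φ p).target} := by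
    ext s
    constructor
    · rintro ⟨t, ⟨-, ht⟩, rfl⟩
      change planeEquiv (0, bdryCoord b p t) ∈ (φ p).target
      rw [hb.planeEquiv_bdryCoord ht]
      exact (φ p).map_source ht
    · intro hs
      have hx := symm_mem_boundary hs rfl
      obtain ⟨t', ht'⟩ := hM.mapsTo hx
      obtain ⟨t, ht, htt⟩ := hγ.periodic.exists_mem_Ico₀ hγ.period_pos t'
      have hbt : b t = (φ p).symm (planeEquiv (0, s)) := by
        refine hM.injOn (hb.mem t) hx ?_
        rw [hb.lift, ← htt, ht']
      have hsrc : b t ∈ (φ p).source := by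
        rw [hbt]; exact (φ p).map_target hs
      refine ⟨t, ⟨ht, hsrc⟩, ?_⟩
      rw [bdryCoord, hbt, (φ p).right_inv hs]
      rfl
  have hBm : MeasurableSet {s : ℝ | planeEquiv (0, s) ∈ (φ p).target} := by
    have : Measurable fun s : ℝ => planeEquiv (0, s) := by fun_prop
    exact this (measurableSet_target p)
  have h1 : ∀ s : ℝ, (φ p).target.indicator (fun u => rep r p u * G u) (planeEquiv (0, s))
      = {s : ℝ | planeEquiv (0, s) ∈ (φ p).target}.indicator
        (fun s => rep r p (planeEquiv (0, s)) * G (planeEquiv (0, s))) s := fun s => by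
    simp only [indicator]
    rfl
  simp_rw [h1]
  rw [integral_indicator hBm, ← himg, integral_image_eq_integral_abs_deriv_smul hSm
    (fun t ht => (hb.hasDerivAt_bdryCoord hf hγd ht.2).1.hasDerivWithinAt) hinj,
    intervalIntegral.integral_of_le hγ.period_pos.le, ← integral_Ico_eq_integral_Ioc,
    setIntegral_eq_of_subset_of_forall_sdiff_eq_zero measurableSet_Ico
    (inter_subset_left : S ⊆ Ico 0 T)]
  · refine setIntegral_congr_fun hSm fun t ht => ?_
    simp only [smul_eq_mul]
    rw [hb.planeEquiv_bdryCoord ht.2, ← hk t ht.2, rep, Function.comp, (φ p).left_inv ht.2]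
    ring
  · rintro t ⟨ht, ht'⟩
    rw [image_eq_zero_of_notMem_tsupport (f := r), zero_mul]
    exact fun h => ht' ⟨ht, hr h⟩

/-- The first component of τ attains a local minimum at u on the half plane, and the first
coordinate vector points inwards. -/
lemma jac_zero_zero_nonneg {τ : EuclideanSpace ℝ (Fin 2) → EuclideanSpace ℝ (Fin 2)}
    {u : EuclideanSpace ℝ (Fin 2)} (hu : u ∈ HP) (hτ : ContDiffWithinAt ℝ ∞ τ HP u)
    (hm : ∀ᶠ w in 𝓝[HP] u, τ w ∈ HP) (h0 : τ u 0 = 0) : 0 ≤ jac τ 0 0 u := by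
  have h1 : HasFDerivWithinAt (fun w => τ w 0)
      ((EuclideanSpace.proj (𝕜 := ℝ) (0 : Fin 2)).comp (fderivWithin ℝ τ HP u)) HP u :=
    (EuclideanSpace.proj (𝕜 := ℝ) (0 : Fin 2)).hasFDerivAt.comp_hasFDerivWithinAt u
      (hτ.differentiableWithinAt (by simp)).hasFDerivWithinAt
  have h2 : IsLocalMinOn (fun w => τ w 0) HP u := by
    filter_upwards [hm] with w hw
    rw [h0]
    exact mem_halfPlane_iff.1 hw
  refine h2.hasFDerivWithinAt_nonneg h1 (y := EuclideanSpace.single 0 1) ?_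
  refine mem_posTangentConeAt_of_segment_subset ?_
  refine (𝓡∂ 2).convex_range.segment_subset hu ?_
  rw [mem_halfPlane_iff] at hu ⊢
  have : (u + EuclideanSpace.single (0 : Fin 2) (1 : ℝ)) 0 = u 0 + 1 := by simp
  linarith

lemma eq_zero_of_comb {p v w : Sol} (h : gramDet p v w ≠ 0) {x y : ℝ}
    (h0 : x • v + y • w = 0) : x = 0 ∧ y = 0 := by
  have hx := gramDet_comb p v w x y 0 1
  have hy := gramDet_comb p v w 1 0 x y
  rw [h0, gramDet_zero_right] at hy
  have hx' : gramDet p (x • v + y • w) ((0 : ℝ) • v + (1 : ℝ) • w) = 0 := by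
    rw [h0]; simp [gramDet, inner_apply]
  rw [hx'] at hx
  constructor
  · simpa [h] using hx.symm
  · simpa [h] using hy.symm

/-- The sign of `mc * (derivative of the boundary coordinate)` does not depend on the chart. -/
lemma BoundaryLift.sign_chart (hb : BoundaryLift f γ b) (hf : IsCMC f H)
    (hγ : Differentiable ℝ γ) (hreg : ∀ t, deriv γ t ≠ 0) {p q : M} {t : ℝ}
    (hp : b t ∈ (φ p).source) (hq : b t ∈ (φ q).source) :
    SignType.sign (mc (rep f p) (φ p (b t)) * deriv (bdryCoord b p) t) =
      SignType.sign (mc (rep f q) (φ q (b t)) * deriv (bdryCoord b q) t) := by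
  set u := φ p (b t) with hu
  have huo : u ∈ overlap p q :=
    mem_overlap.2 ⟨(φ p).map_source hp, by rwa [hu, (φ p).left_inv hp]⟩
  have hτu : change p q u = φ q (b t) := by
    rw [change, Function.comp, hu, (φ p).left_inv hp]
  have hR := reparam_change hf.smooth huo
  have hJ := jacDet_change_ne_zero huo
  have hqt := (φ q).map_source hq
  have hg := hf.gram_ne_zero q _ hqt
  have hmc := hR.mc hJ (by rw [hτu]; exact hg)
  have hpd := hR.pderiv 1
  rw [hτu] at hmc hpd
  obtain ⟨-, ep⟩ := hb.hasDerivAt_bdryCoord hf hγ hp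
  obtain ⟨-, eq⟩ := hb.hasDerivAt_bdryCoord hf hγ hq
  rw [← hu, hpd] at ep
  set dp := deriv (bdryCoord b p) t
  set dq := deriv (bdryCoord b q) t
  -- Both charts express γ' by their boundary direction. Independence of the partial derivatives
  -- makes the Jacobian triangular, and its normal entry is positive, so the sign of the determinant
  -- is that of the tangential entry.
  have hlin : (dp * jac (change p q) 1 0 u) • pderiv 0 (rep f q) (φ q (b t))
      + (dp * jac (change p q) 1 1 u - dq) • pderiv 1 (rep f q) (φ q (b t)) = 0 := by
    have := ep.trans eq.symm
    rw [smul_add, smul_smul, smul_smul, ← sub_eq_zero] at this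
    rw [sub_smul, ← this]
    abel
  obtain ⟨h10, h11⟩ := eq_zero_of_comb hg hlin
  have hdp : dp ≠ 0 := by
    intro h
    rw [h, zero_smul] at ep
    exact hreg t ep.symm
  have h10' : jac (change p q) 1 0 u = 0 := by simpa [hdp] using h10
  have h00 : 0 ≤ jac (change p q) 0 0 u := by
    refine jac_zero_zero_nonneg hR.mem (hR.smooth.self_of_nhdsWithin hR.mem) hR.mapsTo ?_
    rw [hτu]
    exact extChartAt_zero_of_mem_boundary (hb.mem t) hq
  have hJ' : jacDet (change p q) u = jac (change p q) 0 0 u * jac (change p q) 1 1 u := by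
    rw [jacDet, h10', mul_zero, sub_zero]
  have h00' : 0 < jac (change p q) 0 0 u := by
    refine lt_of_le_of_ne h00 fun h => hJ ?_
    rw [hJ', ← h, zero_mul]
  have hsgn : SignType.sign (jacDet (change p q) u) = SignType.sign (jac (change p q) 1 1 u) := by
    rw [hJ', sign_mul, sign_pos h00', one_mul]
  rw [hmc, hsgn, show dq = dp * jac (change p q) 1 1 u by linarith]
  simp only [sign_mul]
  have : SignType.sign ((SignType.sign (jac (change p q) 1 1 u) : SignType) : ℝ) =
    SignType.sign (jac (change p q) 1 1 u) := by
      rcases lt_trichotomy (jac (change p q) 1 1 u) 0 with h | h | h <;> simp [h]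
  rw [this, mul_comm (SignType.sign (jac (change p q) 1 1 u)), mul_assoc,
    mul_comm (SignType.sign (jac (change p q) 1 1 u))]

end Boundary

/-! ### Pointwise bounds and the flux inequality -/

lemma abs_inner_le (p v w : Sol) : |inner p v w| ≤ norm p v * norm p w := by
  rw [norm, norm, ← Real.sqrt_mul (inner_self_nonneg _ _)]
  apply Real.abs_le_sqrt
  have := gramDet_nonneg p v w
  rw [gramDet] at this
  linarith

/-- Cauchy–Schwarz for ⟨y, n × v⟩, with |n × v|² = |v|² - ⟨n, v⟩² ≤ |v|². -/
lemma abs_det3_le {p n : Sol} (y v : Sol) (hn : inner p n n = 1) :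
    |det3 y n v| ≤ norm p y * norm p v := by
  have h1 : det3 y n v = inner p y (cross (p 2) n v) := by
    rw [inner_comm, inner_cross]; simp [det3]; ring
  rw [h1]
  refine (abs_inner_le _ _ _).trans (mul_le_mul_of_nonneg_left ?_ (Real.sqrt_nonneg _))
  rw [norm, norm, ← gramDet_eq]
  apply Real.sqrt_le_sqrt
  rw [gramDet, hn]
  nlinarith [sq_nonneg (inner p n v)]

lemma norm_smul_eq (p v : Sol) (c : ℝ) : norm p (c • v) = |c| * norm p v := by
  rw [norm, inner_smul_left, inner_comm, inner_smul_left, ← mul_assoc, ← sq,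
    Real.sqrt_mul (sq_nonneg _), Real.sqrt_sq_eq_abs, norm]

lemma beta_smul (a b : ℝ) (p v : Sol) (c : ℝ) : beta a b p (c • v) = c * beta a b p v := by
  simp [beta]; ring

/-- The change of variables on the boundary produces |d|. This trades the unsigned derivative and
the local mean curvature for the signed derivative and one sign. -/
lemma abs_mul_eq_sign {m d H : ℝ} (h : |m| = |H|) :
    |d| * m = |H| * ((SignType.sign (m * d) : SignType) : ℝ) * d := by
  rw [← h]
  rcases lt_trichotomy m 0 with hm | hm | hm <;> rcases lt_trichotomy d 0 with hd | hd | hd <;>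
    simp [sign_mul, hm, hd, abs_of_neg, abs_of_pos] <;> ring

section Flux

variable {M : Type*} [TopologicalSpace M] [ChartedSpace (EuclideanHalfSpace 2) M]
  {f : M → Sol} {γ : ℝ → Sol} {b : ℝ → M} {H : ℝ}

lemma BoundaryLift.tendsto_chart (hb : BoundaryLift f γ b) {p : M} {t : ℝ}
    (ht : b t ∈ (φ p).source) : Tendsto (fun s => φ p (b s)) (𝓝 t) (𝓝[HP] (φ p (b t))) := by
  refine tendsto_nhdsWithin_iff.2 ⟨hb.continuousAt_chart ht, ?_⟩
  filter_upwards [hb.eventually_mem ht] with s hs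
  exact target_subset_halfPlane p ((φ p).map_source hs)

variable [IsManifold (𝓡∂ 2) ∞ M]

/-- The orientation of the boundary induced by the mean curvature vector is constant. -/
lemma BoundaryLift.exists_sign (hb : BoundaryLift f γ b) (hf : IsCMC f H)
    (hγ : ContDiff ℝ ∞ γ) (hreg : ∀ t, deriv γ t ≠ 0) :
    ∃ κ : SignType, κ ≠ 0 ∧ ∀ p t, b t ∈ (φ p).source →
      SignType.sign (mc (rep f p) (φ p (b t)) * deriv (bdryCoord b p) t) = κ := by
  have hγd : Differentiable ℝ γ := hγ.differentiable (by simp)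
  have hd : ∀ {p t}, b t ∈ (φ p).source → deriv (bdryCoord b p) t ≠ 0 := by
    intro p t ht h
    have := (hb.hasDerivAt_bdryCoord hf hγd ht).2
    rw [h, zero_smul] at this
    exact hreg t this.symm
  have hm : ∀ {p t}, b t ∈ (φ p).source → mc (rep f p) (φ p (b t)) ≠ 0 := by
    intro p t ht h
    have := hf.mc_sq p _ ((φ p).map_source ht)
    rw [h] at this
    exact hf.ne_zero (by simpa using this.symm)
  set s : ℝ → SignType := fun t =>
    SignType.sign (mc (rep f (b t)) (φ (b t) (b t)) * deriv (bdryCoord b (b t)) t) with hs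
  have hchart : ∀ p t, b t ∈ (φ p).source →
      SignType.sign (mc (rep f p) (φ p (b t)) * deriv (bdryCoord b p) t) = s t := fun p t ht =>
    hb.sign_chart hf hγd hreg ht (mem_extChartAt_source _)
  -- The sign is a function on the connected parameter line, so local constancy is enough.
  have hloc : IsLocallyConstant s := by
    rw [IsLocallyConstant.iff_eventually_eq]
    intro t₀
    set p := b t₀
    have hp : b t₀ ∈ (φ p).source := mem_extChartAt_source _
    have hu := (φ p).map_source hp
    have hT := hb.tendsto_chart hp
    have h1 := hT.eventually (hf.mc_eventually_eq hu)
    -- Continuity of the derivative of the boundary coordinate has not been established. This dot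
    -- product is continuous at t₀ and has the same sign.
    set dot : ℝ → ℝ := fun t => ∑ k, deriv γ t k * pderiv 1 (rep f p) (φ p (b t)) k with hdot
    have hdots : ∀ t, b t ∈ (φ p).source →
        SignType.sign (dot t) = SignType.sign (deriv (bdryCoord b p) t) := by
      intro t ht
      have h2 := (hb.hasDerivAt_bdryCoord hf hγd ht).2
      have h3 := hf.pderiv_one_ne_zero ((φ p).map_source ht)
      have h4 : dot t = deriv (bdryCoord b p) t
          * ∑ k, pderiv 1 (rep f p) (φ p (b t)) k * pderiv 1 (rep f p) (φ p (b t)) k := by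
        rw [hdot, Finset.mul_sum]
        simp only
        rw [← h2]
        simp [mul_assoc]
      have h5 : 0 < ∑ k, pderiv 1 (rep f p) (φ p (b t)) k * pderiv 1 (rep f p) (φ p (b t)) k := by
        obtain ⟨k, hk⟩ := Function.ne_iff.1 h3
        exact Finset.sum_pos' (fun i _ => mul_self_nonneg _)
          ⟨k, Finset.mem_univ _, mul_self_pos.2 hk⟩
      rw [h4, sign_mul, sign_pos h5, mul_one]
    have hcont : ContinuousAt dot t₀ := by
      have c1 : ContinuousAt (fun t => pderiv 1 (rep f p) (φ p (b t))) t₀ :=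
        (contDiffWithinAt_pderiv (contDiffWithinAt_rep hf.smooth hu)
          (target_subset_halfPlane p hu) 1).continuousWithinAt.tendsto.comp hT
      have c2 : Continuous (deriv γ) := hγ.continuous_deriv (by simp)
      rw [continuousAt_pi] at c1
      refine tendsto_finsetSum _ fun k _ => ?_
      exact ((continuous_apply k).comp c2).continuousAt.mul (c1 k)
    have hne : dot t₀ ≠ 0 := by
      intro h
      have := hdots t₀ hp
      rw [h, sign_zero, eq_comm, sign_eq_zero_iff] at this
      exact hd hp this
    have h6 : ∀ᶠ t in 𝓝 t₀, SignType.sign (dot t) = SignType.sign (dot t₀) := by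
      have : Tendsto (fun t => SignType.sign (dot t)) (𝓝 t₀) (𝓝 (SignType.sign (dot t₀))) :=
        (continuousAt_sign_of_ne_zero hne).tendsto.comp hcont
      rwa [nhds_discrete SignType, tendsto_pure] at this
    filter_upwards [h1, h6, hb.eventually_mem hp] with t h7 h8 h9
    rw [← hchart p t h9, ← hchart p t₀ hp, sign_mul, sign_mul, h7, ← hdots t h9, ← hdots t₀ hp, h8]
  refine ⟨s 0, ?_, fun p t ht => ?_⟩
  · rw [hs]
    simp only [ne_eq, sign_eq_zero_iff, mul_eq_zero, not_or]
    exact ⟨hm (mem_extChartAt_source _), hd (mem_extChartAt_source _)⟩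
  · rw [hchart p t ht, hloc.apply_eq_of_preconnectedSpace t 0]

lemma integrable_boundary [CompactSpace M] {r : M → ℝ} (hr : ContMDiff (𝓡∂ 2) 𝓘(ℝ) ∞ r) {p : M}
    (hs : tsupport r ⊆ (φ p).source) {G : EuclideanSpace ℝ (Fin 2) → ℝ}
    (hG : ContinuousOn G (φ p).target) :
    Integrable fun s : ℝ => (φ p).target.indicator (fun u => rep r p u * G u)
      (planeEquiv (0, s)) := by
  set ℓ : ℝ → EuclideanSpace ℝ (Fin 2) := fun s => planeEquiv (0, s) with hℓ
  have hemb : Topology.IsClosedEmbedding ℓ :=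
    planeEquiv.toHomeomorph.isClosedEmbedding.comp
      (Topology.IsClosedEmbedding.of_continuous_injective_isClosedMap (by fun_prop)
        (fun x y h => (Prod.mk.inj h).2) (isClosedMap_prodMk_left 0))
  have hK : IsCompact (ℓ ⁻¹' (φ p '' tsupport r)) :=
    hemb.isCompact_preimage (isCompact_image_tsupport hs)
  have hsub := image_tsupport_subset hs
  have hc : ContinuousOn (fun s => rep r p (ℓ s) * G (ℓ s)) (ℓ ⁻¹' (φ p '' tsupport r)) :=
    (((continuousOn_rep hr p).mul hG).mono hsub).comp hemb.continuous.continuousOn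
      (mapsTo_preimage _ _)
  have hi : IntegrableOn (fun s => (φ p).target.indicator (fun u => rep r p u * G u) (ℓ s))
      (ℓ ⁻¹' (φ p '' tsupport r)) := by
    refine (hc.integrableOn_compact hK).congr_fun (fun s hs' => ?_) hK.measurableSet
    simp only
    rw [indicator_of_mem (hsub hs')]
  rw [← integrableOn_univ]
  refine hi.of_forall_sdiff_eq_zero MeasurableSet.univ fun s hs' => ?_
  by_cases hut : ℓ s ∈ (φ p).target
  · rw [indicator_of_mem hut, rep_eq_zero, zero_mul]
    exact fun h => hs'.2 ⟨_, h, (φ p).right_inv hut⟩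
  · exact indicator_of_notMem hut _

lemma exists_partition [T2Space M] [CompactSpace M] :
    ∃ (t : Finset M) (ρ : t → M → ℝ), (∀ i, ContMDiff (𝓡∂ 2) 𝓘(ℝ) ∞ (ρ i)) ∧
      (∀ i, tsupport (ρ i) ⊆ (φ (i : M)).source) ∧ (∀ x, ∑ i, ρ i x = 1) ∧
      ∀ i x, 0 ≤ ρ i x := by
  obtain ⟨t, -, ht⟩ := isCompact_univ.elim_nhds_subcover (fun x : M => (φ x).source)
    fun x _ => extChartAt_source_mem_nhds x
  obtain ⟨ρ, hρ⟩ := SmoothPartitionOfUnity.exists_isSubordinate (𝓡∂ 2) isClosed_univ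
    (fun i : t => (φ (i : M)).source) (fun i => isOpen_extChartAt_source _)
    (fun x hx => by
      obtain ⟨i, hi, hix⟩ := mem_iUnion₂.1 (ht hx)
      exact mem_iUnion.2 ⟨⟨i, hi⟩, hix⟩)
  refine ⟨t, fun i => ρ i, fun i => (ρ i).contMDiff, hρ, fun x => ?_, fun i x => ρ.nonneg i x⟩
  rw [← finsum_eq_sum_of_fintype]
  exact ρ.sum_eq_one (mem_univ x)

/-- The flux inequality. -/
theorem flux_inequality [T2Space M] [CompactSpace M] (hf : IsCMC f H) {T : ℝ}
    (hγ : IsClosedEmbeddedCurve γ T) (hM : Spans f (range γ)) (a₀ b₀ : ℝ) :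
    2 * |H| * |∫ t in (0 : ℝ)..T, beta a₀ b₀ (γ t) (deriv γ t)| ≤
      ∫ t in (0 : ℝ)..T, norm (γ t) (killing a₀ b₀ (γ t)) * norm (γ t) (deriv γ t) := by
  obtain ⟨b, hb⟩ := exists_boundaryLift hf.smooth.continuous hγ.smooth.continuous hM
  obtain ⟨κ, hκ, hsgn⟩ := hb.exists_sign hf hγ.smooth hγ.regular
  obtain ⟨c, ρ, hρ, hs, h1, hpos⟩ := exists_partition (M := M)
  have hγd : Differentiable ℝ γ := hγ.smooth.differentiable (by simp)
  have hγ' : Continuous (deriv γ) := hγ.smooth.continuous_deriv (by simp)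
  have hflux := hf.sum_boundary_integral a₀ b₀ hρ hs h1
  -- the three densities
  set A : M → EuclideanSpace ℝ (Fin 2) → ℝ := fun p u =>
    det3 (killing a₀ b₀ (rep f p u)) (normal (rep f p) u) (pderiv 1 (rep f p) u)
  set B : M → EuclideanSpace ℝ (Fin 2) → ℝ := fun p u =>
    2 * mc (rep f p) u * beta a₀ b₀ (rep f p u) (pderiv 1 (rep f p) u)
  set C : M → EuclideanSpace ℝ (Fin 2) → ℝ := fun p u =>
    norm (rep f p u) (killing a₀ b₀ (rep f p u)) * norm (rep f p u) (pderiv 1 (rep f p) u)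
  have hA : ∀ p, ContinuousOn (A p) (φ p).target := fun p u hu => by
    have hF := contDiffWithinAt_rep hf.smooth hu
    have hu' := target_subset_halfPlane p hu
    exact (contDiffWithinAt_det3 (contDiffWithinAt_killing a₀ b₀ hF)
      (contDiffWithinAt_normal hF hu' (hf.gram_ne_zero p u hu))
      (contDiffWithinAt_pderiv hF hu' 1)).continuousWithinAt.mono (target_subset_halfPlane p)
  have hB : ∀ p, ContinuousOn (B p) (φ p).target := fun p u hu => by
    have hF := contDiffWithinAt_rep hf.smooth hu
    have hu' := target_subset_halfPlane p hu
    exact ((contDiffWithinAt_const.mul (contDiffWithinAt_mc hF hu' (hf.gram_ne_zero p u hu))).mul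
      (contDiffWithinAt_beta a₀ b₀ hF
        (contDiffWithinAt_pderiv hF hu' 1))).continuousWithinAt.mono (target_subset_halfPlane p)
  have hC : ∀ p, ContinuousOn (C p) (φ p).target := fun p u hu => by
    have hF := contDiffWithinAt_rep hf.smooth hu
    have hu' := target_subset_halfPlane p hu
    have hk := contDiffWithinAt_killing a₀ b₀ hF
    have hv := contDiffWithinAt_pderiv hF hu' 1
    exact ((contDiffWithinAt_inner hF hk hk).continuousWithinAt.sqrt.mul
      (contDiffWithinAt_inner hF hv hv).continuousWithinAt.sqrt).mono (target_subset_halfPlane p)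
  have hrep : ∀ p t, b t ∈ (φ p).source → rep f p (φ p (b t)) = γ t := fun p t ht => by
    rw [rep, Function.comp, (φ p).left_inv ht, hb.lift]
  -- change of variables
  have eB : ∀ i : c, ∫ s : ℝ, (φ (i : M)).target.indicator (fun u => rep (ρ i) i u * B i u)
      (planeEquiv (0, s)) = ∫ t in (0 : ℝ)..T,
        ρ i (b t) * (2 * |H| * (κ : ℝ) * beta a₀ b₀ (γ t) (deriv γ t)) := fun i => by
    refine hb.integral_chart hf hγ hM (hs i) fun t ht => ?_
    have hd := (hb.hasDerivAt_bdryCoord hf hγd ht).2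
    have hk := hsgn i t ht
    have hmc := hf.mc_sq i _ ((φ (i : M)).map_source ht)
    rw [← hd, beta_smul]
    simp only [B, hrep _ _ ht]
    have := abs_mul_eq_sign (d := deriv (bdryCoord b (i : M)) t) (sq_eq_sq_iff_abs_eq_abs _ _ |>.1 hmc)
    rw [hk] at this
    linear_combination
      2 * beta a₀ b₀ (γ t) (pderiv 1 (rep f (i : M)) (φ (i : M) (b t))) * this
  have eC : ∀ i : c, ∫ s : ℝ, (φ (i : M)).target.indicator (fun u => rep (ρ i) i u * C i u)
      (planeEquiv (0, s)) = ∫ t in (0 : ℝ)..T,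
        ρ i (b t) * (norm (γ t) (killing a₀ b₀ (γ t)) * norm (γ t) (deriv γ t)) := fun i => by
    refine hb.integral_chart hf hγ hM (hs i) fun t ht => ?_
    have hd := (hb.hasDerivAt_bdryCoord hf hγd ht).2
    rw [← hd, norm_smul_eq]
    simp only [C, hrep _ _ ht]
    ring
  have hsum : ∀ k : ℝ → ℝ, Continuous k →
      ∑ i, ∫ t in (0 : ℝ)..T, ρ i (b t) * k t = ∫ t in (0 : ℝ)..T, k t := by
    intro k hk
    have hi : ∀ i ∈ Finset.univ, IntervalIntegrable (fun t => ρ i (b t) * k t) volume 0 T :=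
      fun i _ => (((hρ i).continuous.comp hb.continuous).mul hk).intervalIntegrable _ _
    rw [← intervalIntegral.integral_finsetSum hi]
    refine intervalIntegral.integral_congr fun t _ => ?_
    rw [← Finset.sum_mul, h1, one_mul]
  have hβ : Continuous fun t => beta a₀ b₀ (γ t) (deriv γ t) := by
    have := hγ.smooth.continuous
    simp only [beta]
    fun_prop
  have hN : Continuous fun t => norm (γ t) (killing a₀ b₀ (γ t)) * norm (γ t) (deriv γ t) := by
    have := hγ.smooth.continuous
    simp only [norm, inner_apply, killing, Matrix.cons_val_zero, Matrix.cons_val_one,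
      Matrix.cons_val]
    fun_prop
  have sB : ∑ i : c, ∫ s : ℝ, (φ (i : M)).target.indicator (fun u => rep (ρ i) i u * B i u)
      (planeEquiv (0, s)) = 2 * |H| * κ * ∫ t in (0 : ℝ)..T, beta a₀ b₀ (γ t) (deriv γ t) := by
    simp_rw [eB]
    rw [hsum (fun t => 2 * |H| * κ * beta a₀ b₀ (γ t) (deriv γ t)) (continuous_const.mul hβ),
      intervalIntegral.integral_const_mul]
  have sC := hsum _ hN
  simp_rw [← eC] at sC
  have iA := fun i : c => integrable_boundary (hρ i) (hs i) (hA i)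
  have iB := fun i : c => integrable_boundary (hρ i) (hs i) (hB i)
  have iC := fun i : c => integrable_boundary (hρ i) (hs i) (hC i)
  have hAB : (∑ i : c, ∫ s : ℝ, (φ (i : M)).target.indicator (fun u => rep (ρ i) i u * A i u)
      (planeEquiv (0, s))) + (∑ i : c, ∫ s : ℝ,
      (φ (i : M)).target.indicator (fun u => rep (ρ i) i u * B i u) (planeEquiv (0, s))) = 0 := by
    refine Eq.trans ?_ hflux
    rw [← Finset.sum_add_distrib]
    refine Finset.sum_congr rfl fun i _ => ?_
    rw [← integral_add (iA i) (iB i)]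
    refine integral_congr_ae (Eventually.of_forall fun s => ?_)
    simp only [indicator, A, B, fluxForm]
    split_ifs <;> ring
  -- The normal is defined only chart by chart, so the flux of K is bounded there. Only the bound is
  -- transported to the parameter of γ.
  have hAC : |∑ i : c, ∫ s : ℝ, (φ (i : M)).target.indicator (fun u => rep (ρ i) i u * A i u)
      (planeEquiv (0, s))| ≤ ∑ i : c, ∫ s : ℝ,
      (φ (i : M)).target.indicator (fun u => rep (ρ i) i u * C i u) (planeEquiv (0, s)) := by
    refine (Finset.abs_sum_le_sum_abs _ _).trans (Finset.sum_le_sum fun i _ => ?_)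
    refine (Real.norm_eq_abs _).symm.trans_le (norm_integral_le_of_norm_le (iC i) (Eventually.of_forall fun s => ?_))
    by_cases hu : planeEquiv (0, s) ∈ (φ (i : M)).target
    · have hr : 0 ≤ rep (ρ i) (i : M) (planeEquiv (0, s)) := hpos i _
      rw [indicator_of_mem hu, indicator_of_mem hu, Real.norm_eq_abs, abs_mul, abs_of_nonneg hr]
      exact mul_le_mul_of_nonneg_left (abs_det3_le _ _
        (isUnitNormal_normal (hf.gram_ne_zero _ _ hu)).1) hr
    · rw [indicator_of_notMem hu, indicator_of_notMem hu, norm_zero]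
  rw [sC, eq_neg_of_add_eq_zero_left hAB, abs_neg, sB, abs_mul, abs_mul, abs_mul, abs_abs,
    abs_of_pos (two_pos : (0 : ℝ) < 2)] at hAC
  have hκ1 : |(κ : ℝ)| = 1 := by
    rcases κ.trichotomy with h | h | h
    · rw [h]; simp
    · exact absurd h hκ
    · rw [h]; simp
  rwa [hκ1, mul_one] at hAC

end Flux

/-! ### Green's theorem: the local computation -/

/-- The Jacobian determinant of a plane map. -/
def planeJac (ψ : ℝ × ℝ → ℝ × ℝ) (q : ℝ × ℝ) : ℝ :=
  (fderiv ℝ ψ q (1, 0)).1 * (fderiv ℝ ψ q (0, 1)).2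
    - (fderiv ℝ ψ q (0, 1)).1 * (fderiv ℝ ψ q (1, 0)).2

lemma det_clm_prod (L : ℝ × ℝ →L[ℝ] ℝ × ℝ) :
    L.det = (L (1, 0)).1 * (L (0, 1)).2 - (L (0, 1)).1 * (L (1, 0)).2 := by
  rw [ContinuousLinearMap.det, ← LinearMap.det_toMatrix (Module.Basis.finTwoProd ℝ),
    Matrix.det_fin_two]
  simp [LinearMap.toMatrix_apply]

lemma det_fderiv_eq_planeJac (ψ : ℝ × ℝ → ℝ × ℝ) (q : ℝ × ℝ) : (fderiv ℝ ψ q).det = planeJac ψ q :=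
  det_clm_prod _

lemma clm_apply_prod (L : ℝ × ℝ →L[ℝ] ℝ) (v : ℝ × ℝ) : L v = v.1 * L (1, 0) + v.2 * L (0, 1) := by
  conv_lhs => rw [show v = v.1 • ((1 : ℝ), (0 : ℝ)) + v.2 • ((0 : ℝ), (1 : ℝ)) by simp]
  rw [map_add, map_smul, map_smul, smul_eq_mul, smul_eq_mul]

/-- Stokes' theorem for the image of a half disc under an orientation reversing chart. -/
lemma integral_fderiv_image {ψ : ℝ × ℝ → ℝ × ℝ} (hψ : ContDiff ℝ ∞ ψ) {U K : Set (ℝ × ℝ)}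
    (hU : IsOpen U) (hinj : InjOn ψ U) (hdet : ∀ q ∈ U, planeJac ψ q < 0) {h : ℝ × ℝ → ℝ}
    (hh : ContDiff ℝ ∞ h) (hK : IsCompact K) (hKU : K ⊆ U) (h0 : ∀ q ∈ U \ K, h (ψ q) = 0) :
    ∫ p in ψ '' (U ∩ {q | 0 < q.1}), fderiv ℝ h p (1, 0)
      = ∫ t, U.indicator (fun q => h (ψ q) * (fderiv ℝ ψ q (0, 1)).2) (0, t) := by
  set F : ℝ × ℝ → ℝ := U.indicator (h ∘ ψ) with hF
  have hFU : ∀ q ∈ U, F =ᶠ[𝓝 q] h ∘ ψ := fun q hq => by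
    filter_upwards [hU.mem_nhds hq] with p hp using indicator_of_mem hp _
  have hF0 : ∀ q ∉ K, F =ᶠ[𝓝 q] 0 := fun q hq => by
    filter_upwards [hK.isClosed.isOpen_compl.mem_nhds hq] with p hp
    by_cases hpU : p ∈ U
    · rw [hF, indicator_of_mem hpU]; exact h0 p ⟨hpU, hp⟩
    · exact indicator_of_notMem hpU _
  have hFs : ContDiff ℝ ∞ F := by
    rw [contDiff_iff_contDiffAt]
    intro q
    by_cases hq : q ∈ U
    · exact ((hh.comp hψ).contDiffAt).congr_of_eventuallyEq (hFU q hq)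
    · exact contDiffAt_const.congr_of_eventuallyEq (hF0 q (fun hk => hq (hKU hk)))
  have hFd := hFs.differentiable (by simp)
  have hψd := hψ.differentiable (by simp)
  have hhd := hh.differentiable (by simp)
  have hdψ : ∀ v, ContDiff ℝ ∞ (fun q => (fderiv ℝ ψ q v).2) := fun v =>
    contDiff_snd.comp ((hψ.fderiv_right (m := ∞) (by simp)).clm_apply contDiff_const)
  have hdψd : ∀ v, Differentiable ℝ (fun q => (fderiv ℝ ψ q v).2) := fun v =>
    (hdψ v).differentiable (by simp)
  have hsymm : ∀ q, fderiv ℝ (fun q => (fderiv ℝ ψ q (0, 1)).2) q (1, 0)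
      = fderiv ℝ (fun q => (fderiv ℝ ψ q (1, 0)).2) q (0, 1) := by
    intro q
    have hs : IsSymmSndFDerivAt ℝ ψ q := (hψ.contDiffAt).isSymmSndFDerivAt (by
      simpa using (ENat.LEInfty.out : (2 : WithTop ℕ∞) ≤ ∞))
    have hdd : DifferentiableAt ℝ (fderiv ℝ ψ) q :=
      ((hψ.fderiv_right (m := ∞) (by simp)).differentiable (by simp)) q
    have key : ∀ v w, fderiv ℝ (fun q => (fderiv ℝ ψ q v).2) q w
        = (fderiv ℝ (fderiv ℝ ψ) q w v).2 := by
      intro v w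
      have h1 : HasFDerivAt (fun q => fderiv ℝ ψ q v)
          ((fderiv ℝ (fderiv ℝ ψ) q).flip v) q := by
        simpa using hdd.hasFDerivAt.clm_apply (hasFDerivAt_const v q)
      rw [(h1.snd).fderiv]
      rfl
    rw [key, key, hs.eq]
  -- The pullback of h dy under ψ, written as a vector field. By symmetry of the second derivatives
  -- its divergence is the Jacobian times ∂h/∂x.
  set a : ℝ × ℝ → ℝ := fun q => F q * (fderiv ℝ ψ q (0, 1)).2 with ha
  set b : ℝ × ℝ → ℝ := fun q => -(F q * (fderiv ℝ ψ q (1, 0)).2) with hb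
  have has : ContDiff ℝ ∞ a := hFs.mul (hdψ _)
  have hbs : ContDiff ℝ ∞ b := (hFs.mul (hdψ _)).neg
  have hdiv : ∀ q, fderiv ℝ a q (1, 0) + fderiv ℝ b q (0, 1)
      = fderiv ℝ F q (1, 0) * (fderiv ℝ ψ q (0, 1)).2
        - fderiv ℝ F q (0, 1) * (fderiv ℝ ψ q (1, 0)).2 := by
    intro q
    have e1 := ((hFd q).hasFDerivAt.mul (hdψd (0, 1) q).hasFDerivAt).fderiv
    have e2 := ((hFd q).hasFDerivAt.mul (hdψd (1, 0) q).hasFDerivAt).neg.fderiv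
    have e1' : fderiv ℝ a q = _ := e1
    have e2' : fderiv ℝ b q = _ := e2
    rw [e1', e2']
    simp only [add_apply, neg_apply,
      smul_apply, smul_eq_mul]
    rw [hsymm q]
    ring
  have hdivU : ∀ q ∈ U, fderiv ℝ a q (1, 0) + fderiv ℝ b q (0, 1)
      = planeJac ψ q * fderiv ℝ h (ψ q) (1, 0) := by
    intro q hq
    rw [hdiv, (hFU q hq).fderiv_eq, fderiv_comp q (hhd _) (hψd q)]
    simp only [ContinuousLinearMap.comp_apply]
    rw [clm_apply_prod _ (fderiv ℝ ψ q (1, 0)), clm_apply_prod _ (fderiv ℝ ψ q (0, 1)), planeJac]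
    ring
  have hdiv0 : ∀ q ∉ K, fderiv ℝ a q (1, 0) + fderiv ℝ b q (0, 1) = 0 := by
    intro q hq
    rw [hdiv, (hF0 q hq).fderiv_eq]
    simp
  have hFK : ∀ q ∉ K, F q = 0 := fun q hq => (hF0 q hq).eq_of_nhds
  obtain ⟨R, hR0, hR⟩ : ∃ R > 0, ∀ q ∈ K, ‖q‖ < R := by
    obtain ⟨R, hR⟩ := hK.isBounded.exists_norm_le
    exact ⟨|R| + 1, by positivity, fun q hq => by linarith [hR q hq, le_abs_self R]⟩
  have hRK : ∀ q : ℝ × ℝ, (R ≤ q.1 ∨ R ≤ |q.2|) → q ∉ K := by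
    intro q hq hk
    have h1 : |q.1| ≤ ‖q‖ := norm_fst_le q
    have h2 : |q.2| ≤ ‖q‖ := norm_snd_le q
    have := hR q hk
    rcases hq with hq | hq
    · linarith [le_abs_self q.1]
    · linarith
  have hst := integral_divergence_halfPlane (f := a) (g := b) (f' := fderiv ℝ a)
    (g' := fderiv ℝ b) hR0.le has.continuous.continuousOn hbs.continuous.continuousOn
    (fun q _ => (has.differentiable (by simp) q).hasFDerivAt)
    (fun q _ => (hbs.differentiable (by simp) q).hasFDerivAt)
    (((has.continuous_fderiv (by simp)).clm_apply continuous_const).add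
      ((hbs.continuous_fderiv (by simp)).clm_apply continuous_const)).continuousOn
    (fun q _ hq => by simp [ha, hFK q (hRK q hq)])
    (fun q _ hq => by simp [hb, hFK q (hRK q hq)])
    (fun q _ hq => hdiv0 q (hRK q (hq.imp le_of_lt le_of_lt)))
  have hP : MeasurableSet {q : ℝ × ℝ | 0 < q.1} := measurableSet_lt measurable_const measurable_fst
  have hUP : MeasurableSet (U ∩ {q : ℝ × ℝ | 0 < q.1}) := hU.measurableSet.inter hP
  rw [integral_image_eq_integral_abs_det_fderiv_smul volume hUP
    (fun q _ => (hψd q).hasFDerivAt.hasFDerivWithinAt) (hinj.mono inter_subset_left)]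
  -- The Jacobian is negative, and this sign cancels the one in Stokes' theorem on the half plane.
  have e1 : ∫ q in U ∩ {q | 0 < q.1}, |(fderiv ℝ ψ q).det| • fderiv ℝ h (ψ q) (1, 0)
      = ∫ q in U ∩ {q | 0 < q.1}, -(fderiv ℝ a q (1, 0) + fderiv ℝ b q (0, 1)) := by
    refine setIntegral_congr_fun hUP ?_
    intro q hq
    simp only
    rw [hdivU q hq.1, det_fderiv_eq_planeJac, abs_of_neg (hdet q hq.1), smul_eq_mul]
    ring
  have hnull : volume {q : ℝ × ℝ | q.1 = 0} = 0 := by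
    have : {q : ℝ × ℝ | q.1 = 0} = {(0 : ℝ)} ×ˢ univ := by ext; simp
    rw [this, Measure.volume_eq_prod, Measure.prod_prod]
    simp
  have e2 : ∫ q in U ∩ {q | 0 < q.1}, -(fderiv ℝ a q (1, 0) + fderiv ℝ b q (0, 1))
      = -∫ q in {q : ℝ × ℝ | 0 ≤ q.1}, (fderiv ℝ a q (1, 0) + fderiv ℝ b q (0, 1)) := by
    rw [integral_neg]
    congr 1
    rw [inter_comm]
    have e3 : {q : ℝ × ℝ | 0 < q.1} =ᵐ[volume] {q : ℝ × ℝ | 0 ≤ q.1} := by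
      have : ∀ᵐ q : ℝ × ℝ, q.1 ≠ 0 := by
        rw [ae_iff]; simpa using hnull
      filter_upwards [this] with q hq
      exact propext ⟨fun h : 0 < q.1 => h.le, fun h : 0 ≤ q.1 => lt_of_le_of_ne h (Ne.symm hq)⟩
    rw [← setIntegral_congr_set e3]
    refine (setIntegral_eq_of_subset_of_forall_sdiff_eq_zero hP inter_subset_left ?_).symm
    intro q hq
    exact hdiv0 q (fun hk => hq.2 ⟨hq.1, hKU hk⟩)
  rw [e1, e2, hst, neg_neg]
  congr 1
  ext t
  by_cases ht : ((0 : ℝ), t) ∈ U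
  · simp [ha, hF, indicator_of_mem ht]
  · simp [ha, hF, indicator_of_notMem ht]

/-! ### Normal coordinates along an embedded plane curve -/

/-- A smooth closed embedded curve in the plane, parametrized regularly and `T`-periodically. -/
structure IsPlaneLoop (x y : ℝ → ℝ) (T : ℝ) : Prop where
  period_pos : 0 < T
  smooth_fst : ContDiff ℝ ∞ x
  smooth_snd : ContDiff ℝ ∞ y
  periodic_fst : Function.Periodic x T
  periodic_snd : Function.Periodic y T
  regular : ∀ t, 0 < deriv x t ^ 2 + deriv y t ^ 2
  injOn : InjOn (fun t => (x t, y t)) (Ico 0 T)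

/-- The normal coordinates `(s, t) ↦ c(t) + s J c'(t)` along the plane curve `c = (x, y)`. -/
def tube (x y : ℝ → ℝ) (q : ℝ × ℝ) : ℝ × ℝ :=
  (x q.2 - q.1 * deriv y q.2, y q.2 + q.1 * deriv x q.2)

namespace IsPlaneLoop

variable {x y : ℝ → ℝ} {T : ℝ}

lemma contDiff_deriv {x : ℝ → ℝ} (hx : ContDiff ℝ ∞ x) : ContDiff ℝ ∞ (deriv x) :=
  (contDiff_infty_iff_deriv.1 hx).2

lemma contDiff_tube (hc : IsPlaneLoop x y T) : ContDiff ℝ ∞ (tube x y) :=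
  ((hc.smooth_fst.comp contDiff_snd).sub
    (contDiff_fst.mul ((contDiff_deriv hc.smooth_snd).comp contDiff_snd))).prodMk
  ((hc.smooth_snd.comp contDiff_snd).add
    (contDiff_fst.mul ((contDiff_deriv hc.smooth_fst).comp contDiff_snd)))

lemma continuous (hc : IsPlaneLoop x y T) : Continuous (fun t => (x t, y t)) :=
  hc.smooth_fst.continuous.prodMk hc.smooth_snd.continuous

lemma tube_zero (x y : ℝ → ℝ) (t : ℝ) : tube x y (0, t) = (x t, y t) := by simp [tube]

lemma fderiv_tube_fst (hc : IsPlaneLoop x y T) (t : ℝ) :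
    fderiv ℝ (tube x y) (0, t) (1, 0) = (-deriv y t, deriv x t) := by
  have h1 : HasDerivAt (fun s : ℝ => ((s, t) : ℝ × ℝ)) (1, 0) 0 :=
    (hasDerivAt_id 0).prodMk (hasDerivAt_const 0 t)
  have h2 := ((hc.contDiff_tube.differentiable (by simp)) (0, t)).hasFDerivAt.comp_hasDerivAt 0 h1
  have h3 : HasDerivAt (fun s : ℝ => tube x y (s, t)) (-deriv y t, deriv x t) 0 := by
    have e1 : HasDerivAt (fun s : ℝ => x t - s * deriv y t) (-deriv y t) 0 := by
      simpa using ((hasDerivAt_id (0 : ℝ)).mul_const (deriv y t)).const_sub (x t)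
    have e2 : HasDerivAt (fun s : ℝ => y t + s * deriv x t) (deriv x t) 0 := by
      simpa using ((hasDerivAt_id (0 : ℝ)).mul_const (deriv x t)).const_add (y t)
    exact e1.prodMk e2
  exact h2.unique h3

lemma fderiv_tube_snd (hc : IsPlaneLoop x y T) (t : ℝ) :
    fderiv ℝ (tube x y) (0, t) (0, 1) = (deriv x t, deriv y t) := by
  have h1 : HasDerivAt (fun s : ℝ => (((0 : ℝ), s) : ℝ × ℝ)) (0, 1) t :=
    (hasDerivAt_const t 0).prodMk (hasDerivAt_id t)
  have h2 := ((hc.contDiff_tube.differentiable (by simp)) (0, t)).hasFDerivAt.comp_hasDerivAt t h1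
  have h3 : HasDerivAt (fun s : ℝ => tube x y (0, s)) (deriv x t, deriv y t) t := by
    simp only [tube_zero]
    exact ((hc.smooth_fst.differentiable (by simp)) t).hasDerivAt.prodMk
      ((hc.smooth_snd.differentiable (by simp)) t).hasDerivAt
  exact h2.unique h3

lemma planeJac_tube (hc : IsPlaneLoop x y T) (t : ℝ) : planeJac (tube x y) (0, t) < 0 := by
  rw [planeJac, hc.fderiv_tube_fst, hc.fderiv_tube_snd]
  have := hc.regular t
  simp only
  nlinarith

/-- Injectivity on any window shorter than a period: after reduction to [0, T) the parameters differ
by nT with |n| < 1. -/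
lemma eq_of_eq (hc : IsPlaneLoop x y T) {t t' : ℝ} (h : (x t, y t) = (x t', y t'))
    (hlt : |t - t'| < T) : t = t' := by
  have hp : Function.Periodic (fun t => (x t, y t)) T := fun s => by
    simp only [hc.periodic_fst s, hc.periodic_snd s]
  have key : toIcoMod hc.period_pos 0 t = toIcoMod hc.period_pos 0 t' := by
    have hm := fun s => toIcoMod_mem_Ico' hc.period_pos s
    refine hc.injOn (hm t) (hm t') ?_
    have hv : ∀ s, (fun t => (x t, y t)) (toIcoMod hc.period_pos 0 s) = (x s, y s) := by
      intro s
      exact hp.sub_zsmul_eq _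
    rw [hv, hv, h]
  obtain ⟨n, hn⟩ := (toIcoMod_eq_toIcoMod hc.period_pos).1 key
  rw [zsmul_eq_mul] at hn
  have hT := hc.period_pos
  have h2 : |(n : ℝ)| * T < T := by
    rw [abs_sub_comm, hn, abs_mul, abs_of_pos hT] at hlt; exact hlt
  have h3 : |(n : ℝ)| < 1 := by nlinarith
  have h4 : n = 0 := by
    have : |n| < 1 := by exact_mod_cast h3
    exact Int.abs_lt_one_iff.1 this
  rw [h4] at hn
  simp at hn
  linarith

end IsPlaneLoop

/-- A coordinate patch of normal coordinates, in which `D` is the side `σ s > 0` of the curve. -/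
structure IsSidePatch (x y : ℝ → ℝ) (T : ℝ) (D : Set (ℝ × ℝ)) (σ : ℝ)
    (e : OpenPartialHomeomorph (ℝ × ℝ) (ℝ × ℝ)) : Prop where
  coe_eq : ⇑e = tube x y
  planeJac_neg : ∀ q ∈ e.source, planeJac (tube x y) q < 0
  exists_center : ∃ m, ∀ q ∈ e.source, |q.2 - m| < T / 2
  mem_iff : ∀ q ∈ e.source, tube x y q ∈ D ↔ 0 < σ * q.1

/-- In the patch D is the half plane s > 0, so `integral_fderiv_image` applies. What remains is to
read the integral over the axis as an integral over one period. -/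
lemma setIntegral_fderiv_of_isSidePatch {x y : ℝ → ℝ} {T : ℝ} {D : Set (ℝ × ℝ)}
    {e : OpenPartialHomeomorph (ℝ × ℝ) (ℝ × ℝ)} (hc : IsPlaneLoop x y T)
    (hDo : IsOpen D) (hDf : frontier D = range fun t => (x t, y t))
    (he : IsSidePatch x y T D 1 e) {h : ℝ × ℝ → ℝ} (hh : ContDiff ℝ ∞ h)
    (hcs : HasCompactSupport h) (hsub : tsupport h ⊆ e.target) :
    ∫ p in D, fderiv ℝ h p (1, 0) = ∫ t in (0 : ℝ)..T, h (x t, y t) * deriv y t := by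
  obtain ⟨m, hm⟩ := he.exists_center
  have hT := hc.period_pos
  have hKc : IsCompact (e.symm '' tsupport h) :=
    hcs.isCompact.image_of_continuousOn (e.continuousOn_symm.mono hsub)
  have hKs : e.symm '' tsupport h ⊆ e.source := by
    rintro _ ⟨p, hp, rfl⟩
    exact e.map_target (hsub hp)
  have hinj : InjOn (tube x y) e.source := he.coe_eq ▸ e.injOn
  have h0 : ∀ q ∈ e.source \ e.symm '' tsupport h, h (tube x y q) = 0 := by
    rintro q ⟨hq, hq'⟩
    refine image_eq_zero_of_notMem_tsupport fun hcon => hq' ⟨_, hcon, ?_⟩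
    rw [← he.coe_eq, e.left_inv hq]
  have hst := integral_fderiv_image hc.contDiff_tube e.open_source hinj he.planeJac_neg hh hKc
    hKs h0
  have himg : tube x y '' (e.source ∩ {q | 0 < q.1}) = D ∩ e.target := by
    ext p
    constructor
    · rintro ⟨q, ⟨hq, hq1⟩, rfl⟩
      refine ⟨(he.mem_iff q hq).2 (by simpa using hq1), ?_⟩
      rw [← he.coe_eq]; exact e.map_source hq
    · rintro ⟨hpD, hp⟩
      have hs := e.map_target hp
      have hv : tube x y (e.symm p) = p := by rw [← he.coe_eq, e.right_inv hp]
      refine ⟨e.symm p, ⟨hs, ?_⟩, hv⟩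
      simpa using (he.mem_iff _ hs).1 (by rwa [hv])
  have hleft : ∫ p in D, fderiv ℝ h p (1, 0)
      = ∫ p in tube x y '' (e.source ∩ {q | 0 < q.1}), fderiv ℝ h p (1, 0) := by
    rw [himg]
    refine setIntegral_eq_of_subset_of_forall_sdiff_eq_zero hDo.measurableSet inter_subset_left ?_
    rintro p ⟨hpD, hp⟩
    have hpt : p ∉ tsupport h := fun hcon => hp ⟨hpD, hsub hcon⟩
    rw [image_eq_zero_of_notMem_tsupport (fun hcon => hpt (tsupport_fderiv_subset ℝ hcon))]
    rfl
  rw [hleft, hst]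
  have hper : Function.Periodic (fun t => h (x t, y t) * deriv y t) T := by
    intro t
    have : deriv y (t + T) = deriv y t := by
      rw [← deriv_comp_add_const]
      congr 1
      ext s; exact hc.periodic_snd s
    simp only [hc.periodic_fst t, hc.periodic_snd t, this]
  -- The period is centred at m, so that its window contains every parameter in the patch.
  have hshift := hper.intervalIntegral_add_eq (m - T / 2) 0
  rw [zero_add] at hshift
  rw [← hshift, intervalIntegral.integral_of_le (by linarith)]
  rw [← setIntegral_eq_integral_of_forall_compl_eq_zero (s := Ioc (m - T / 2) (m - T / 2 + T))]
  · refine setIntegral_congr_fun measurableSet_Ioc ?_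
    intro t ht
    by_cases hs : ((0 : ℝ), t) ∈ e.source
    · simp only [indicator_of_mem hs, hc.fderiv_tube_snd, IsPlaneLoop.tube_zero]
    · simp only [indicator_of_notMem hs]
      -- Otherwise the curve point lies in the target. Its preimage has s = 0, since a frontier
      -- point is neither in D nor exterior to it. The t-coordinate of the preimage gives the same
      -- curve point within less than a period, so it equals t.
      suffices h (x t, y t) = 0 by rw [this, zero_mul]
      by_contra hne
      have hmt : (x t, y t) ∈ e.target := hsub (subset_tsupport _ hne)
      have hqs := e.map_target hmt
      have hq : tube x y (e.symm (x t, y t)) = (x t, y t) := by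
        rw [← he.coe_eq, e.right_inv hmt]
      have hfr : (x t, y t) ∈ frontier D := hDf ▸ mem_range_self t
      have hnD : (x t, y t) ∉ D := fun hcon => by
        rw [hDo.frontier_eq] at hfr; exact hfr.2 hcon
      have hle : (e.symm (x t, y t)).1 ≤ 0 := by
        by_contra hpos
        push Not at hpos
        exact hnD (hq ▸ (he.mem_iff _ hqs).2 (by simpa using hpos))
      have hge : 0 ≤ (e.symm (x t, y t)).1 := by
        by_contra hneg
        push Not at hneg
        have ho : IsOpen (e.source ∩ {q | q.1 < 0}) :=
          e.open_source.inter (isOpen_lt continuous_fst continuous_const)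
        have ho' := e.isOpen_image_of_subset_source ho inter_subset_left
        have hmem : (x t, y t) ∈ e '' (e.source ∩ {q | q.1 < 0}) :=
          ⟨_, ⟨hqs, hneg⟩, e.right_inv hmt⟩
        obtain ⟨p, ⟨q, ⟨hq1, hq2⟩, rfl⟩, hpD⟩ :=
          mem_closure_iff.1 (frontier_subset_closure hfr) _ ho' hmem
        rw [he.coe_eq] at hpD
        have := (he.mem_iff q hq1).1 hpD
        have hq2' : q.1 < 0 := hq2
        linarith
      have hz : (e.symm (x t, y t)).1 = 0 := le_antisymm hle hge
      have hpair : e.symm (x t, y t) = (0, (e.symm (x t, y t)).2) := Prod.ext hz rfl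
      have hct := hq
      rw [hpair, IsPlaneLoop.tube_zero] at hct
      have hm2 := abs_lt.1 (hm _ hqs)
      have hteq : (e.symm (x t, y t)).2 = t := by
        refine hc.eq_of_eq hct ?_
        rw [abs_lt]
        constructor <;> linarith [ht.1, ht.2, hm2.1, hm2.2]
      rw [hteq] at hpair
      exact hs (hpair ▸ hqs)
  · intro t ht
    refine indicator_of_notMem (fun hs => ht ?_) _
    have := abs_lt.1 (hm _ hs)
    simp only at this
    exact ⟨by linarith, by linarith⟩

/-- A preconnected set disjoint from the frontier of an open set `D` lies in `D` or in the exterior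
of `D`. -/
lemma subset_or_disjoint_of_disjoint_frontier {D B : Set (ℝ × ℝ)} (hD : IsOpen D)
    (hB : IsPreconnected B) (h : Disjoint B (frontier D)) : B ⊆ D ∨ B ⊆ (closure D)ᶜ := by
  refine hB.subset_or_subset hD isClosed_closure.isOpen_compl
    (disjoint_compl_right.mono_left subset_closure) ?_
  intro p hp
  by_cases hpD : p ∈ D
  · exact Or.inl hpD
  · refine Or.inr fun hcl => disjoint_left.1 h hp ?_
    rw [hD.frontier_eq]
    exact ⟨hcl, hpD⟩

/-- Around each point of an embedded curve, the normal coordinates are a chart in which the only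
points of the curve lie on the axis. -/
lemma IsPlaneLoop.exists_tube_chart {x y : ℝ → ℝ} {T : ℝ} (hc : IsPlaneLoop x y T) (t₀ : ℝ) :
    ∃ e : OpenPartialHomeomorph (ℝ × ℝ) (ℝ × ℝ), ∃ δ > 0, ⇑e = tube x y ∧
      e.source = Metric.ball (0, t₀) δ ∧ δ ≤ T / 2 ∧
      (∀ q ∈ e.source, planeJac (tube x y) q < 0) ∧
      ∀ q ∈ e.source, tube x y q ∈ range (fun t => (x t, y t)) → q.1 = 0 := by
  have hT := hc.period_pos
  have hψ := hc.contDiff_tube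
  have hdet : (fderiv ℝ (tube x y) (0, t₀)).det ≠ 0 := by
    rw [det_fderiv_eq_planeJac]; exact (hc.planeJac_tube t₀).ne
  set L := (fderiv ℝ (tube x y) (0, t₀)).toContinuousLinearEquivOfDetNeZero hdet with hL
  have hd : HasFDerivAt (tube x y) (L : ℝ × ℝ →L[ℝ] ℝ × ℝ) (0, t₀) := by
    rw [hL, ContinuousLinearMap.coe_toContinuousLinearEquivOfDetNeZero]
    exact (hψ.differentiable (by simp) _).hasFDerivAt
  set e₀ := (hψ.contDiffAt (x := (0, t₀))).toOpenPartialHomeomorph (tube x y) hd (by simp) with he₀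
  have he₀c : ⇑e₀ = tube x y := rfl
  have hmem : ((0 : ℝ), t₀) ∈ e₀.source :=
    (hψ.contDiffAt (x := (0, t₀))).mem_toOpenPartialHomeomorph_source hd (by simp)
  have hjc : Continuous (planeJac (tube x y)) := by
    have h1 : ∀ v, Continuous (fun q => fderiv ℝ (tube x y) q v) := fun v =>
      (hψ.continuous_fderiv (by simp)).clm_apply continuous_const
    exact ((h1 _).fst.mul (h1 _).snd).sub ((h1 _).fst.mul (h1 _).snd)
  have hV : e₀.source ∩ {q | planeJac (tube x y) q < 0} ∈ 𝓝 ((0 : ℝ), t₀) :=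
    inter_mem (e₀.open_source.mem_nhds hmem)
      ((isOpen_lt hjc continuous_const).mem_nhds (hc.planeJac_tube t₀))
  obtain ⟨δ₁, hδ₁, hball₁⟩ := Metric.mem_nhds_iff.1 hV
  set δ₂ := min δ₁ (T / 2) with hδ₂
  have hδ₂pos : 0 < δ₂ := lt_min hδ₁ (by linarith)
  have hδ₂T : δ₂ ≤ T / 2 := min_le_right _ _
  -- The part of the curve away from t₀ is compact and misses the point at t₀, so a smaller ball of
  -- normal coordinates avoids it.
  set C := (fun t => (x t, y t)) '' Icc (t₀ + δ₂) (t₀ - δ₂ + T) with hC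
  have hCc : IsClosed C := (isCompact_Icc.image hc.continuous).isClosed
  have ht₀C : (x t₀, y t₀) ∉ C := by
    rintro ⟨t, ht, h⟩
    have := hc.eq_of_eq h (by rw [abs_lt]; constructor <;> linarith [ht.1, ht.2])
    linarith [ht.1]
  have hW : Metric.ball ((0 : ℝ), t₀) δ₂ ∩ tube x y ⁻¹' Cᶜ ∈ 𝓝 ((0 : ℝ), t₀) := by
    refine inter_mem (Metric.ball_mem_nhds _ hδ₂pos)
      (hψ.continuous.continuousAt.preimage_mem_nhds (hCc.isOpen_compl.mem_nhds ?_))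
    rw [IsPlaneLoop.tube_zero]; exact ht₀C
  obtain ⟨δ₃, hδ₃, hball₃⟩ := Metric.mem_nhds_iff.1 hW
  set δ := min δ₃ δ₂ with hδ
  have hδpos : 0 < δ := lt_min hδ₃ hδ₂pos
  have hsub : Metric.ball ((0 : ℝ), t₀) δ ⊆ Metric.ball (0, t₀) δ₁ :=
    Metric.ball_subset_ball ((min_le_right _ _).trans (min_le_left _ _))
  refine ⟨e₀.restrOpen (Metric.ball (0, t₀) δ) Metric.isOpen_ball, δ, hδpos, he₀c, ?_,
    (min_le_right _ _).trans hδ₂T, ?_, ?_⟩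
  · rw [OpenPartialHomeomorph.restrOpen_source]
    exact inter_eq_right.2 (fun q hq => (hball₁ (hsub hq)).1)
  · intro q hq
    rw [OpenPartialHomeomorph.restrOpen_source] at hq
    exact (hball₁ (hsub hq.2)).2
  · intro q hq
    rw [OpenPartialHomeomorph.restrOpen_source] at hq
    rintro ⟨t₁, ht₁⟩
    have hqC : tube x y q ∉ C :=
      (hball₃ (Metric.ball_subset_ball (min_le_left _ _) hq.2)).2
    set t := toIcoMod hT (t₀ - δ₂) t₁ with ht
    have htm : t ∈ Ico (t₀ - δ₂) (t₀ - δ₂ + T) := toIcoMod_mem_Ico hT _ _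
    have hp : Function.Periodic (fun t => (x t, y t)) T := fun s => by
      simp only [hc.periodic_fst s, hc.periodic_snd s]
    have hct : (x t, y t) = tube x y q := by
      rw [← ht₁]; exact hp.sub_zsmul_eq _
    have htlt : t < t₀ + δ₂ := by
      by_contra hcon
      push Not at hcon
      exact hqC (hct ▸ ⟨t, ⟨hcon, htm.2.le⟩, rfl⟩)
    have htgt : t₀ - δ₂ < t := by
      rcases lt_or_eq_of_le htm.1 with h | h
      · exact h
      -- The window is half-open: its left endpoint is excluded because the translate by T is the
      -- right end of the arc C.
      · exfalso
        refine hqC (hct ▸ ⟨t + T, ⟨by linarith, by linarith⟩, ?_⟩)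
        exact hp t
    have hts : ((0 : ℝ), t) ∈ Metric.ball ((0 : ℝ), t₀) δ₁ := by
      rw [Metric.mem_ball, dist_prod_same_left, Real.dist_eq, abs_lt]
      have : δ₂ ≤ δ₁ := min_le_left _ _
      constructor <;> linarith
    have hqt : q = (0, t) := by
      refine e₀.injOn hq.1 (hball₁ hts).1 ?_
      rw [he₀c, IsPlaneLoop.tube_zero, hct]
    rw [hqt]

/-! ### A bounded domain lies on one side of its boundary curve -/

section Sides

variable {x y : ℝ → ℝ} {T : ℝ} {D : Set (ℝ × ℝ)}

lemma exists_mem_half_ball {t δ σ : ℝ} (hσ : |σ| = 1) (hδ : 0 < δ) :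
    ∃ q ∈ Metric.ball ((0 : ℝ), t) δ, 0 < σ * q.1 := by
  refine ⟨(σ * (δ / 2), t), ?_, ?_⟩
  · rw [Metric.mem_ball, dist_prod_same_right, Real.dist_eq, sub_zero, abs_mul, hσ, one_mul,
      abs_of_pos (by linarith)]
    linarith
  · have : σ * σ = 1 := by rw [← abs_mul_abs_self, hσ, one_mul]
    simp only
    rw [← mul_assoc, this]; linarith

/-- Each point of the curve lies in a side patch, or in a patch contained in `closure D`. -/
lemma IsPlaneLoop.exists_isSidePatch_or (hc : IsPlaneLoop x y T) (hDo : IsOpen D)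
    (hDf : frontier D = range fun t => (x t, y t)) (t₀ : ℝ) :
    (∃ e, ((0 : ℝ), t₀) ∈ e.source ∧ IsSidePatch x y T D 1 e) ∨
    (∃ e, ((0 : ℝ), t₀) ∈ e.source ∧ IsSidePatch x y T D (-1) e) ∨
    ∃ e : OpenPartialHomeomorph (ℝ × ℝ) (ℝ × ℝ), ((0 : ℝ), t₀) ∈ e.source ∧ ⇑e = tube x y ∧
      ∀ q ∈ e.source, tube x y q ∈ closure D := by
  obtain ⟨e, δ, hδ, hec, hes, hδT, hej, hex⟩ := hc.exists_tube_chart t₀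
  have hmem : ((0 : ℝ), t₀) ∈ e.source := hes ▸ Metric.mem_ball_self hδ
  have hconv : ∀ σ : ℝ, Convex ℝ (Metric.ball ((0 : ℝ), t₀) δ ∩ {q : ℝ × ℝ | 0 < σ * q.1}) := by
    intro σ
    refine (convex_ball _ _).inter ?_
    intro p hp q hq a b ha hb hab
    have hp' : 0 < σ * p.1 := hp
    have hq' : 0 < σ * q.1 := hq
    have : σ * (a • p + b • q).1 = a * (σ * p.1) + b * (σ * q.1) := by
      simp only [Prod.fst_add, Prod.smul_fst, smul_eq_mul]; ring
    show 0 < σ * (a • p + b • q).1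
    rw [this]
    rcases ha.lt_or_eq with h | h
    · nlinarith [mul_pos h hp', mul_nonneg hb hq'.le]
    · have hb1 : b = 1 := by linarith
      rw [← h, hb1]; linarith
  -- Each open half of the ball is convex and its image misses the curve, so the image lies in D or
  -- in the exterior.
  have hside : ∀ σ : ℝ, (∀ q ∈ e.source, 0 < σ * q.1 → tube x y q ∈ D) ∨
      (∀ q ∈ e.source, 0 < σ * q.1 → tube x y q ∉ closure D) := by
    intro σ
    have hpre := ((hconv σ).isPreconnected).image _ hc.contDiff_tube.continuous.continuousOn
    have hdis : Disjoint (tube x y '' (Metric.ball ((0 : ℝ), t₀) δ ∩ {q : ℝ × ℝ | 0 < σ * q.1}))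
        (frontier D) := by
      rw [disjoint_left]
      rintro _ ⟨q, ⟨hq, hq1⟩, rfl⟩ hf
      have h0 := hex q (hes ▸ hq) (hDf ▸ hf)
      have hq1' : 0 < σ * q.1 := hq1
      rw [h0, mul_zero] at hq1'
      exact lt_irrefl _ hq1'
    rcases subset_or_disjoint_of_disjoint_frontier hDo hpre hdis with h | h
    · exact Or.inl fun q hq h1 => h ⟨q, ⟨hes ▸ hq, h1⟩, rfl⟩
    · exact Or.inr fun q hq h1 => h ⟨q, ⟨hes ▸ hq, h1⟩, rfl⟩
  have hfr : ∀ q ∈ e.source, q.1 = 0 → tube x y q ∈ frontier D := by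
    intro q _ hq
    rw [hDf]
    refine ⟨q.2, ?_⟩
    rw [show q = (0, q.2) from Prod.ext hq rfl, IsPlaneLoop.tube_zero]
  have hcen : ∃ m, ∀ q ∈ e.source, |q.2 - m| < T / 2 := by
    refine ⟨t₀, fun q hq => ?_⟩
    rw [hes, Metric.mem_ball, Prod.dist_eq] at hq
    exact (lt_of_le_of_lt (le_max_right _ _) hq).trans_le hδT
  have hnot : ∀ p ∈ frontier D, p ∉ D := fun p hp => by
    rw [hDo.frontier_eq] at hp; exact hp.2
  -- Both halves in D puts the patch in the closure of D, and exactly one half gives a side patch.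
  -- Neither is impossible, since the point at t₀ is a limit of points of D.
  rcases hside 1 with h1 | h1 <;> rcases hside (-1) with h2 | h2
  · refine Or.inr (Or.inr ⟨e, hmem, hec, fun q hq => ?_⟩)
    rcases lt_trichotomy q.1 0 with h | h | h
    · exact subset_closure (h2 q hq (by linarith))
    · exact frontier_subset_closure (hfr q hq h)
    · exact subset_closure (h1 q hq (by linarith))
  · refine Or.inl ⟨e, hmem, hec, hej, hcen, fun q hq => ⟨fun hD => ?_, h1 q hq⟩⟩
    rcases lt_trichotomy q.1 0 with h | h | h
    · exact absurd (subset_closure hD) (h2 q hq (by linarith))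
    · exact absurd hD (hnot _ (hfr q hq h))
    · linarith
  · refine Or.inr (Or.inl ⟨e, hmem, hec, hej, hcen, fun q hq => ⟨fun hD => ?_, h2 q hq⟩⟩)
    rcases lt_trichotomy q.1 0 with h | h | h
    · linarith
    · exact absurd hD (hnot _ (hfr q hq h))
    · exact absurd (subset_closure hD) (h1 q hq (by linarith))
  · exfalso
    have hcl : (x t₀, y t₀) ∈ closure D :=
      frontier_subset_closure (hDf ▸ mem_range_self t₀)
    have ht : (x t₀, y t₀) ∈ e.target := by
      rw [← IsPlaneLoop.tube_zero, ← hec]; exact e.map_source hmem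
    obtain ⟨p, hp, hpD⟩ := mem_closure_iff.1 hcl _ e.open_target ht
    have hq := e.map_target hp
    have hv : tube x y (e.symm p) = p := by rw [← hec, e.right_inv hp]
    rcases lt_trichotomy (e.symm p).1 0 with h | h | h
    · exact h2 _ hq (by linarith) (hv.symm ▸ subset_closure hpD)
    · exact hnot _ (hfr _ hq h) (hv.symm ▸ hpD)
    · exact h1 _ hq (by linarith) (hv.symm ▸ subset_closure hpD)

lemma exists_ball_subset_inter {e e' : OpenPartialHomeomorph (ℝ × ℝ) (ℝ × ℝ)} {q : ℝ × ℝ}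
    (h : q ∈ e.source) (h' : q ∈ e'.source) :
    ∃ δ > 0, Metric.ball q δ ⊆ e.source ∩ e'.source :=
  Metric.isOpen_iff.1 (e.open_source.inter e'.open_source) q ⟨h, h'⟩

/-- The half of a side patch on the other side is mapped to an open set disjoint from D, so it
contains no limit points of D. -/
lemma IsSidePatch.not_closure {σ t : ℝ} {e e' : OpenPartialHomeomorph (ℝ × ℝ) (ℝ × ℝ)}
    (hσ : |σ| = 1) (he : IsSidePatch x y T D σ e) (ht : ((0 : ℝ), t) ∈ e.source)
    (ht' : ((0 : ℝ), t) ∈ e'.source) (h : ∀ q ∈ e'.source, tube x y q ∈ closure D) : False := by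
  obtain ⟨δ, hδ, hball⟩ := exists_ball_subset_inter ht ht'
  obtain ⟨q, hq, hq1⟩ := exists_mem_half_ball (t := t) (σ := -σ) (by rwa [abs_neg]) hδ
  have ho : IsOpen (e.source ∩ {q : ℝ × ℝ | 0 < -σ * q.1}) :=
    e.open_source.inter (isOpen_lt continuous_const (continuous_const.mul continuous_fst))
  have ho' := e.isOpen_image_of_subset_source ho inter_subset_left
  have hm : tube x y q ∈ e '' (e.source ∩ {q : ℝ × ℝ | 0 < -σ * q.1}) :=
    ⟨q, ⟨(hball hq).1, hq1⟩, by rw [he.coe_eq]⟩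
  obtain ⟨_, ⟨p, ⟨hp, hp1⟩, rfl⟩, hpD⟩ := mem_closure_iff.1 (h q (hball hq).2) _ ho' hm
  rw [he.coe_eq] at hpD
  have h1 := (he.mem_iff p hp).1 hpD
  have h2 : 0 < -σ * p.1 := hp1
  linarith

/-- A bounded domain lies on one side of its boundary curve. -/
lemma IsPlaneLoop.forall_exists_isSidePatch (hc : IsPlaneLoop x y T) (hDo : IsOpen D)
    (hDb : Bornology.IsBounded D) (hDf : frontier D = range fun t => (x t, y t)) :
    (∀ t, ∃ e, ((0 : ℝ), t) ∈ e.source ∧ IsSidePatch x y T D 1 e) ∨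
    (∀ t, ∃ e, ((0 : ℝ), t) ∈ e.source ∧ IsSidePatch x y T D (-1) e) := by
  set A : ℝ → Set ℝ := fun σ => {t | ∃ e, ((0 : ℝ), t) ∈ e.source ∧ IsSidePatch x y T D σ e}
    with hA
  set S : Set ℝ := {t | ∃ e : OpenPartialHomeomorph (ℝ × ℝ) (ℝ × ℝ), ((0 : ℝ), t) ∈ e.source ∧
    ⇑e = tube x y ∧ ∀ q ∈ e.source, tube x y q ∈ closure D} with hS
  have hpre : ∀ e : OpenPartialHomeomorph (ℝ × ℝ) (ℝ × ℝ),
      IsOpen {t : ℝ | ((0 : ℝ), t) ∈ e.source} := fun e =>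
    e.open_source.preimage (by fun_prop : Continuous fun t : ℝ => ((0 : ℝ), t))
  have hAo : ∀ σ, IsOpen (A σ) := by
    intro σ
    rw [isOpen_iff_mem_nhds]
    rintro t ⟨e, ht, he⟩
    exact mem_of_superset ((hpre e).mem_nhds ht) fun s hs => ⟨e, hs, he⟩
  have hSo : IsOpen S := by
    rw [isOpen_iff_mem_nhds]
    rintro t ⟨e, ht, he⟩
    exact mem_of_superset ((hpre e).mem_nhds ht) fun s hs => ⟨e, hs, he⟩
  have hcov : ∀ t, t ∈ A 1 ∨ t ∈ A (-1) ∨ t ∈ S := hc.exists_isSidePatch_or hDo hDf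
  have hAS : ∀ σ, |σ| = 1 → ∀ t ∈ A σ, t ∉ S := by
    rintro σ hσ t ⟨e, ht, he⟩ ⟨e', ht', -, he'⟩
    exact he.not_closure hσ ht ht' he'
  have hAA : ∀ t ∈ A 1, t ∉ A (-1) := by
    rintro t ⟨e, ht, he⟩ ⟨e', ht', he'⟩
    obtain ⟨δ, hδ, hball⟩ := exists_ball_subset_inter ht ht'
    obtain ⟨q, hq, hq1⟩ := exists_mem_half_ball (t := t) (σ := 1) (by simp) hδ
    have := (he'.mem_iff q (hball hq).2).1 ((he.mem_iff q (hball hq).1).2 hq1)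
    linarith
  have hSc : IsClopen S := by
    refine ⟨⟨?_⟩, hSo⟩
    convert (hAo 1).union (hAo (-1)) using 1
    ext t
    constructor
    · intro h
      rcases hcov t with h' | h' | h'
      · exact Or.inl h'
      · exact Or.inr h'
      · exact absurd h' h
    · rintro (h | h)
      · exact hAS 1 (by simp) t h
      · exact hAS (-1) (by simp) t h
  -- If D surrounded the whole curve from both sides, its closure would be open as well as closed,
  -- hence the whole plane, contradicting boundedness.
  have hSe : S = ∅ := by
    refine (isClopen_iff.1 hSc).resolve_right fun hu => ?_
    have hint : closure D ⊆ interior (closure D) := by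
      intro p hp
      by_cases hpD : p ∈ D
      · exact interior_mono subset_closure (by rwa [hDo.interior_eq])
      · have hf : p ∈ frontier D := by rw [hDo.frontier_eq]; exact ⟨hp, hpD⟩
        rw [hDf] at hf
        obtain ⟨t, rfl⟩ := hf
        obtain ⟨e, ht, hec, he⟩ : t ∈ S := hu ▸ mem_univ t
        rw [mem_interior]
        refine ⟨e.target, ?_, e.open_target, ?_⟩
        · intro q hq
          rw [← e.right_inv hq, hec]
          exact he _ (e.map_target hq)
        · simp only
          rw [← IsPlaneLoop.tube_zero, ← hec]; exact e.map_source ht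
    have hclo : IsClopen (closure D) :=
      ⟨isClosed_closure, by
        rw [← interior_eq_iff_isOpen]; exact subset_antisymm interior_subset hint⟩
    rcases isClopen_iff.1 hclo with h | h
    · have : (x 0, y 0) ∈ closure D := frontier_subset_closure (hDf ▸ mem_range_self 0)
      rw [h] at this
      exact this
    · have hb : Bornology.IsBounded (univ : Set (ℝ × ℝ)) := h ▸ hDb.closure
      exact NormedSpace.unbounded_univ ℝ (ℝ × ℝ) hb
  have hA1 : IsClopen (A 1) := by
    refine ⟨⟨?_⟩, hAo 1⟩
    convert hAo (-1) using 1
    ext t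
    constructor
    · intro h
      rcases hcov t with h' | h' | h'
      · exact absurd h' h
      · exact h'
      · rw [hSe] at h'; exact h'.elim
    · exact fun h h' => hAA t h' h
  rcases isClopen_iff.1 hA1 with h | h
  · refine Or.inr fun t => ?_
    rcases hcov t with h' | h' | h'
    · rw [h] at h'; exact h'.elim
    · exact h'
    · rw [hSe] at h'; exact h'.elim
  · exact Or.inl fun t => (h ▸ mem_univ t : t ∈ A 1)

end Sides

/-! ### Green's theorem: globalization -/

section Green

variable {x y : ℝ → ℝ} {T : ℝ} {D : Set (ℝ × ℝ)}

lemma deriv_comp_neg_fun (x : ℝ → ℝ) : deriv (fun t => x (-t)) = fun t => -deriv x (-t) := by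
  ext t
  exact deriv_comp_neg x t

/-- Reversing the curve also reverses its normal. The resulting point reflection preserves
orientation and exchanges the two sides. -/
lemma tube_reverse (x y : ℝ → ℝ) :
    tube (fun t => x (-t)) (fun t => y (-t)) = tube x y ∘ Neg.neg := by
  ext q <;> simp [tube, deriv_comp_neg_fun]

lemma IsPlaneLoop.reverse (hc : IsPlaneLoop x y T) :
    IsPlaneLoop (fun t => x (-t)) (fun t => y (-t)) T where
  period_pos := hc.period_pos
  smooth_fst := hc.smooth_fst.comp contDiff_neg
  smooth_snd := hc.smooth_snd.comp contDiff_neg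
  periodic_fst t := by
    show x (-(t + T)) = x (-t)
    rw [neg_add, ← sub_eq_add_neg]; exact hc.periodic_fst.sub_eq _
  periodic_snd t := by
    show y (-(t + T)) = y (-t)
    rw [neg_add, ← sub_eq_add_neg]; exact hc.periodic_snd.sub_eq _
  regular t := by
    simp only [deriv_comp_neg_fun, neg_sq]
    exact hc.regular (-t)
  injOn t ht t' ht' h := by
    have := hc.eq_of_eq (t := -t) (t' := -t') h (by
      rw [abs_lt]; constructor <;> linarith [ht.1, ht.2, ht'.1, ht'.2])
    linarith

lemma range_reverse (x y : ℝ → ℝ) :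
    (range fun t => (x (-t), y (-t))) = range fun t => (x t, y t) := by
  ext p
  constructor
  · rintro ⟨t, rfl⟩; exact ⟨-t, rfl⟩
  · rintro ⟨t, rfl⟩; exact ⟨-t, by simp⟩

lemma IsSidePatch.reverse (hc : IsPlaneLoop x y T) {e : OpenPartialHomeomorph (ℝ × ℝ) (ℝ × ℝ)}
    (he : IsSidePatch x y T D (-1) e) :
    IsSidePatch (fun t => x (-t)) (fun t => y (-t)) T D 1
      ((Homeomorph.neg (ℝ × ℝ)).toOpenPartialHomeomorph.trans e) := by
  have hs : ∀ q, q ∈ ((Homeomorph.neg (ℝ × ℝ)).toOpenPartialHomeomorph.trans e).source →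
      -q ∈ e.source := fun q hq => by simpa using hq
  refine ⟨?_, ?_, ?_, ?_⟩
  · rw [tube_reverse, ← he.coe_eq]; rfl
  · intro q hq
    have h := he.planeJac_neg _ (hs q hq)
    have hd : ∀ v, fderiv ℝ (tube x y ∘ Neg.neg) q v = -fderiv ℝ (tube x y) (-q) v := by
      intro v
      have hn : DifferentiableAt ℝ (Neg.neg : ℝ × ℝ → ℝ × ℝ) q :=
        differentiable_id.neg.differentiableAt
      rw [fderiv_comp q (hc.contDiff_tube.differentiable (by simp) _) hn]
      have : fderiv ℝ (Neg.neg : ℝ × ℝ → ℝ × ℝ) q v = -v := by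
        rw [show (Neg.neg : ℝ × ℝ → ℝ × ℝ) = fun p => -p from rfl, fderiv_fun_neg]; simp
      rw [ContinuousLinearMap.comp_apply, this, map_neg]
    rw [tube_reverse, planeJac, hd, hd]
    simpa [planeJac] using h
  · obtain ⟨m, hm⟩ := he.exists_center
    refine ⟨-m, fun q hq => ?_⟩
    have := hm _ (hs q hq)
    rw [← abs_neg]
    convert this using 2
    simp only [Prod.snd_neg]; ring
  · intro q hq
    rw [tube_reverse, Function.comp_apply, he.mem_iff _ (hs q hq)]
    simp

lemma integral_fderiv_eq_zero {h : ℝ × ℝ → ℝ} (hh : ContDiff ℝ ∞ h) (hcs : HasCompactSupport h)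
    (v : ℝ × ℝ) : ∫ p, fderiv ℝ h p v = 0 := by
  have h1 : Continuous fun p => fderiv ℝ h p v :=
    (hh.continuous_fderiv (by simp)).clm_apply continuous_const
  have h2 : Integrable (fun p => fderiv ℝ h p v) :=
    h1.integrable_of_hasCompactSupport (hcs.fderiv_apply ℝ v)
  have := integral_mul_fderiv_eq_neg_fderiv_mul_of_integrable (μ := (volume : Measure (ℝ × ℝ)))
    (f := fun _ : ℝ × ℝ => (1 : ℝ)) (g := h) (v := v) (by simp) (by simpa using h2)
    (by simpa using hh.continuous.integrable_of_hasCompactSupport hcs)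
    (fun _ _ => differentiableAt_const _) (fun _ _ => hh.differentiable (by simp) _)
  simpa using this

/-- A partition of unity reduces to functions supported in D, for which both sides vanish, and
functions supported in a side patch. -/
lemma setIntegral_fderiv_of_forall_isSidePatch (hc : IsPlaneLoop x y T) (hDo : IsOpen D)
    (hDb : Bornology.IsBounded D) (hDf : frontier D = range fun t => (x t, y t))
    (he : ∀ t, ∃ e, ((0 : ℝ), t) ∈ e.source ∧ IsSidePatch x y T D 1 e)
    {g : ℝ × ℝ → ℝ} (hg : ContDiff ℝ ∞ g) :
    ∫ p in D, fderiv ℝ g p (1, 0) = ∫ t in (0 : ℝ)..T, g (x t, y t) * deriv y t := by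
  choose e het heS using he
  have hΓc : IsCompact (frontier D) :=
    hDb.isCompact_closure.of_isClosed_subset isClosed_frontier frontier_subset_closure
  obtain ⟨s, hs⟩ := hΓc.elim_finite_subcover (fun t => (e t).target)
    (fun t => (e t).open_target) (by
      rw [hDf]
      rintro _ ⟨t, rfl⟩
      refine mem_iUnion.2 ⟨t, ?_⟩
      simp only
      rw [← IsPlaneLoop.tube_zero, ← (heS t).coe_eq]
      exact (e t).map_source (het t))
  obtain ⟨R, hR⟩ := hDb.closure.subset_ball (0 : ℝ × ℝ)
  -- The index `none` stands for D itself. Intersecting with a ball makes all supports compact.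
  set U : Option s → Set (ℝ × ℝ) := fun i =>
    i.elim D (fun t => (e t).target) ∩ Metric.ball 0 R with hU
  have hUo : ∀ i, IsOpen (U i) := by
    rintro (_ | t)
    · exact hDo.inter Metric.isOpen_ball
    · exact (e t).open_target.inter Metric.isOpen_ball
  have hUc : closure D ⊆ ⋃ i, U i := by
    intro p hp
    rw [mem_iUnion]
    by_cases hpD : p ∈ D
    · exact ⟨none, hpD, hR hp⟩
    · have hf : p ∈ frontier D := by rw [hDo.frontier_eq]; exact ⟨hp, hpD⟩
      obtain ⟨t, ht, hpt⟩ := mem_iUnion₂.1 (hs hf)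
      exact ⟨some ⟨t, ht⟩, hpt, hR hp⟩
  obtain ⟨ρ, hρ⟩ := SmoothPartitionOfUnity.exists_isSubordinate 𝓘(ℝ, ℝ × ℝ) isClosed_closure U
    hUo hUc
  have hρs : ∀ i, ContDiff ℝ ∞ (ρ i) := fun i => (ρ i).contMDiff.contDiff
  set h : Option s → ℝ × ℝ → ℝ := fun i p => ρ i p * g p with hh
  have hhs : ∀ i, ContDiff ℝ ∞ (h i) := fun i => (hρs i).mul hg
  have hht : ∀ i, tsupport (h i) ⊆ U i := fun i =>
    (tsupport_mul_subset_left (f := ρ i) (g := g)).trans (hρ i)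
  have hhc : ∀ i, HasCompactSupport (h i) := fun i =>
    Metric.isCompact_of_isClosed_isBounded (isClosed_tsupport _)
      (Metric.isBounded_ball.subset ((hht i).trans inter_subset_right))
  have hsum : ∀ p ∈ closure D, ∑ i, h i p = g p := by
    intro p hp
    rw [← Finset.sum_mul, ← finsum_eq_sum_of_fintype, ρ.sum_eq_one hp, one_mul]
  have hfd : ∀ p ∈ D, fderiv ℝ g p (1, 0) = ∑ i, fderiv ℝ (h i) p (1, 0) := by
    intro p hp
    have : g =ᶠ[𝓝 p] fun q => ∑ i, h i q := by
      filter_upwards [hDo.mem_nhds hp] with q hq using (hsum q (subset_closure hq)).symm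
    rw [this.fderiv_eq, fderiv_fun_sum (fun i _ => (hhs i).differentiable (by simp) p)]
    simp
  have hpiece : ∀ i, ∫ p in D, fderiv ℝ (h i) p (1, 0)
      = ∫ t in (0 : ℝ)..T, h i (x t, y t) * deriv y t := by
    rintro (_ | t)
    · have hz : ∀ t, h none (x t, y t) = 0 := by
        intro t
        refine image_eq_zero_of_notMem_tsupport fun hcon => ?_
        have hf : (x t, y t) ∈ frontier D := hDf ▸ mem_range_self t
        rw [hDo.frontier_eq] at hf
        exact hf.2 (hht none hcon).1
      simp only [hz, zero_mul, intervalIntegral.integral_zero]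
      rw [setIntegral_eq_integral_of_forall_compl_eq_zero, integral_fderiv_eq_zero (hhs _) (hhc _)]
      intro p hp
      have hpt : p ∉ tsupport (h none) := fun hcon => hp (hht none hcon).1
      rw [image_eq_zero_of_notMem_tsupport (fun hcon => hpt (tsupport_fderiv_subset ℝ hcon))]
      rfl
    · exact setIntegral_fderiv_of_isSidePatch hc hDo hDf (heS t) (hhs _) (hhc _)
        ((hht _).trans inter_subset_left)
  rw [setIntegral_congr_fun hDo.measurableSet hfd, integral_finsetSum]
  · simp only [hpiece]
    rw [← intervalIntegral.integral_finsetSum]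
    · refine intervalIntegral.integral_congr fun t _ => ?_
      rw [← Finset.sum_mul, hsum _ (frontier_subset_closure (hDf ▸ mem_range_self t))]
    · intro i _
      refine Continuous.intervalIntegrable ?_ _ _
      exact ((hhs i).continuous.comp hc.continuous).mul
        (IsPlaneLoop.contDiff_deriv hc.smooth_snd).continuous
  · intro i _
    refine Integrable.integrableOn ?_
    exact (((hhs i).continuous_fderiv (by simp)).clm_apply
      continuous_const).integrable_of_hasCompactSupport ((hhc i).fderiv_apply ℝ _)

/-- **Green's theorem** for a bounded domain whose boundary is a smooth embedded closed curve. -/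
theorem IsPlaneLoop.exists_setIntegral_fderiv (hc : IsPlaneLoop x y T) (hDo : IsOpen D)
    (hDb : Bornology.IsBounded D) (hDf : frontier D = range fun t => (x t, y t)) :
    ∃ σ : ℝ, |σ| = 1 ∧ ∀ g : ℝ × ℝ → ℝ, ContDiff ℝ ∞ g →
      ∫ p in D, fderiv ℝ g p (1, 0) = σ * ∫ t in (0 : ℝ)..T, g (x t, y t) * deriv y t := by
  rcases hc.forall_exists_isSidePatch hDo hDb hDf with h | h
  · refine ⟨1, by simp, fun g hg => ?_⟩
    rw [one_mul, setIntegral_fderiv_of_forall_isSidePatch hc hDo hDb hDf h hg]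
  · refine ⟨-1, by simp, fun g hg => ?_⟩
    have h' : ∀ t, ∃ e, ((0 : ℝ), t) ∈ e.source ∧
        IsSidePatch (fun t => x (-t)) (fun t => y (-t)) T D 1 e := by
      intro t
      obtain ⟨e, het, he⟩ := h (-t)
      exact ⟨_, by simpa using het, he.reverse hc⟩
    rw [setIntegral_fderiv_of_forall_isSidePatch hc.reverse hDo hDb
      (by rw [range_reverse, hDf]) h' hg]
    simp only [deriv_comp_neg_fun]
    have hper : Function.Periodic (fun t => g (x t, y t) * deriv y t) T := by
      intro t
      have : deriv y (t + T) = deriv y t := by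
        rw [← deriv_comp_add_const]
        congr 1
        ext s; exact hc.periodic_snd s
      simp only [hc.periodic_fst t, hc.periodic_snd t, this]
    have e1 := hper.intervalIntegral_add_eq (-T) 0
    have e2 := intervalIntegral.integral_comp_neg (a := 0) (b := T)
      (fun t => g (x t, y t) * -deriv y t)
    rw [e2, ← zero_add T, ← e1]
    simp

end Green

/-! ### Area, curves in R, and circles -/

section PlaneCurve

variable {γ : ℝ → Sol} {T : ℝ}

lemma IsClosedEmbeddedCurve.hasDerivAt (hγ : IsClosedEmbeddedCurve γ T) (t : ℝ) (i : Fin 3) :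
    HasDerivAt (fun s => γ s i) (deriv γ t i) t :=
  hasDerivAt_pi.1 ((hγ.smooth.differentiable (by simp)) t).hasDerivAt i

lemma IsClosedEmbeddedCurve.hasDerivAt_deriv (hγ : IsClosedEmbeddedCurve γ T) (t : ℝ)
    (i : Fin 3) : HasDerivAt (fun s => deriv γ s i) (deriv (deriv γ) t i) t :=
  hasDerivAt_pi.1 (((contDiff_infty_iff_deriv.1 hγ.smooth).2.differentiable
    (by simp)) t).hasDerivAt i

lemma IsClosedEmbeddedCurve.continuous_deriv (hγ : IsClosedEmbeddedCurve γ T) (i : Fin 3) :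
    Continuous (fun s => deriv γ s i) :=
  (continuous_apply i).comp (contDiff_infty_iff_deriv.1 hγ.smooth).2.continuous

lemma IsClosedEmbeddedCurve.deriv_two (hγ : IsClosedEmbeddedCurve γ T) (hR : ∀ t, γ t 2 = 0)
    (t : ℝ) : deriv γ t 2 = 0 := by
  have h := hγ.hasDerivAt t 2
  simp only [hR] at h
  exact h.unique (hasDerivAt_const t 0)

lemma IsClosedEmbeddedCurve.speed_pos (hγ : IsClosedEmbeddedCurve γ T) (hR : ∀ t, γ t 2 = 0)
    (t : ℝ) : 0 < deriv γ t 0 ^ 2 + deriv γ t 1 ^ 2 := by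
  by_contra hcon
  refine hγ.regular t ?_
  have h0 : deriv γ t 0 = 0 := by nlinarith [sq_nonneg (deriv γ t 0), sq_nonneg (deriv γ t 1)]
  have h1 : deriv γ t 1 = 0 := by nlinarith [sq_nonneg (deriv γ t 0), sq_nonneg (deriv γ t 1)]
  ext i
  fin_cases i
  · exact h0
  · exact h1
  · exact hγ.deriv_two hR t

lemma IsClosedEmbeddedCurve.isPlaneLoop (hγ : IsClosedEmbeddedCurve γ T)
    (hR : ∀ t, γ t 2 = 0) : IsPlaneLoop (fun t => γ t 0) (fun t => γ t 1) T where
  period_pos := hγ.period_pos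
  smooth_fst := contDiff_pi.1 hγ.smooth 0
  smooth_snd := contDiff_pi.1 hγ.smooth 1
  periodic_fst t := congrFun (hγ.periodic t) 0
  periodic_snd t := congrFun (hγ.periodic t) 1
  regular t := by
    rw [(hγ.hasDerivAt t 0).deriv, (hγ.hasDerivAt t 1).deriv]
    exact hγ.speed_pos hR t
  injOn t ht t' ht' h := by
    refine hγ.injOn ht ht' ?_
    ext i
    fin_cases i
    · exact congrArg Prod.fst h
    · exact congrArg Prod.snd h
    · exact (hR t).trans (hR t').symm

lemma norm_of_planar {p v : Sol} (hp : p 2 = 0) (hv : v 2 = 0) :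
    norm p v = √(v 0 ^ 2 + v 1 ^ 2) := by
  rw [norm, inner_apply, hp, hv]
  simp [sq]

lemma norm_killing_of_planar {p : Sol} (hp : p 2 = 0) (a b : ℝ) :
    norm p (killing a b p) = √(1 + (p 0 - a) ^ 2 + (p 1 - b) ^ 2) := by
  rw [norm, inner_apply, hp]
  simp only [killing, Matrix.cons_val_zero, Matrix.cons_val_one, Matrix.cons_val]
  congr 1
  simp
  ring

lemma area_eq (D : Set (ℝ × ℝ)) : area D = volume.real D := by
  simp [area, inner_apply, planeR]

lemma planeR_injective : Function.Injective planeR := by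
  intro p q h
  exact Prod.ext (by simpa [planeR] using congrFun h 0) (by simpa [planeR] using congrFun h 1)

lemma frontier_eq_range {D : Set (ℝ × ℝ)} (hD : planeR '' frontier D = range γ)
    (hR : ∀ t, γ t 2 = 0) : frontier D = range fun t => (γ t 0, γ t 1) := by
  have : range γ = planeR '' range fun t => (γ t 0, γ t 1) := by
    rw [← range_comp]
    congr 1
    ext t i
    fin_cases i
    · rfl
    · rfl
    · exact hR t
  exact planeR_injective.image_injective (hD.trans this)

/-- Green's theorem for g(x, y) = x, since `beta 0 0` restricts to x dy on R. -/
lemma IsClosedEmbeddedCurve.area_eq_abs (hγ : IsClosedEmbeddedCurve γ T)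
    (hR : ∀ t, γ t 2 = 0) {D : Set (ℝ × ℝ)} (hD : IsDomainBoundedBy D (range γ)) :
    area D = |∫ t in (0 : ℝ)..T, beta 0 0 (γ t) (deriv γ t)| := by
  obtain ⟨σ, hσ, h⟩ := (hγ.isPlaneLoop hR).exists_setIntegral_fderiv hD.isOpen hD.isBounded
    (frontier_eq_range hD.boundary hR)
  have h1 := h Prod.fst contDiff_fst
  have h2 : ∀ p : ℝ × ℝ, fderiv ℝ (Prod.fst : ℝ × ℝ → ℝ) p (1, 0) = 1 := by
    intro p; rw [fderiv_fst]; rfl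
  simp only [h2, (hγ.hasDerivAt _ 1).deriv] at h1
  have h3 : ∀ t, beta 0 0 (γ t) (deriv γ t) = γ t 0 * deriv γ t 1 := by
    intro t; rw [beta, hγ.deriv_two hR]; ring
  simp only [h3]
  rw [area_eq, ← abs_of_nonneg (measureReal_nonneg (μ := volume) (s := D))]
  have h4 : volume.real D = σ * ∫ t in (0 : ℝ)..T, γ t 0 * deriv γ t 1 := by
    rw [← h1]; simp
  rw [h4, abs_mul, hσ, one_mul]

lemma IsDomainBoundedBy.area_pos {D : Set (ℝ × ℝ)} {Γ : Set Sol} (hD : IsDomainBoundedBy D Γ) :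
    0 < area D := by
  rw [area_eq]
  exact ENNReal.toReal_pos (hD.isOpen.measure_pos _ hD.isConnected.nonempty).ne'
    hD.isBounded.measure_lt_top.ne

lemma abs_intervalIntegral_of_ne_zero {w : ℝ → ℝ} (hw : Continuous w) (h0 : ∀ t, w t ≠ 0)
    (hT : 0 ≤ T) : |∫ t in (0 : ℝ)..T, w t| = ∫ t in (0 : ℝ)..T, |w t| := by
  have hsgn : (∀ t, 0 < w t) ∨ ∀ t, w t < 0 := by
    by_contra hcon
    push Not at hcon
    obtain ⟨⟨s, hs⟩, t, ht⟩ := hcon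
    obtain ⟨u, hu⟩ := mem_range_of_exists_le_of_exists_ge hw ⟨s, hs⟩ ⟨t, ht⟩
    exact h0 u hu
  rcases hsgn with h | h
  · simp only [abs_of_pos (h _)]
    exact abs_of_nonneg (intervalIntegral.integral_nonneg hT fun t _ => (h t).le)
  · simp only [abs_of_neg (h _), intervalIntegral.integral_neg]
    refine abs_of_nonpos ?_
    rw [← neg_nonneg, ← intervalIntegral.integral_neg]
    exact intervalIntegral.integral_nonneg hT fun t _ => neg_nonneg.2 (h t).le

section Circle

variable {a b r : ℝ}

lemma IsClosedEmbeddedCurve.circle_deriv (hγ : IsClosedEmbeddedCurve γ T)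
    (hc : ∀ t, (γ t 0 - a) ^ 2 + (γ t 1 - b) ^ 2 = r ^ 2) (t : ℝ) :
    (γ t 0 - a) * deriv γ t 0 + (γ t 1 - b) * deriv γ t 1 = 0 := by
  have h := (((hγ.hasDerivAt t 0).sub_const a).pow 2).add (((hγ.hasDerivAt t 1).sub_const b).pow 2)
  have h' : HasDerivAt (fun t => (γ t 0 - a) ^ 2 + (γ t 1 - b) ^ 2) _ t := h
  simp only [hc] at h'
  have := h'.unique (hasDerivAt_const t _)
  simp at this
  linarith

lemma IsClosedEmbeddedCurve.circle_deriv_two (hγ : IsClosedEmbeddedCurve γ T)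
    (hc : ∀ t, (γ t 0 - a) ^ 2 + (γ t 1 - b) ^ 2 = r ^ 2) (t : ℝ) :
    (γ t 0 - a) * deriv (deriv γ) t 0 + (γ t 1 - b) * deriv (deriv γ) t 1
      = -(deriv γ t 0 ^ 2 + deriv γ t 1 ^ 2) := by
  have h := (((hγ.hasDerivAt t 0).sub_const a).mul (hγ.hasDerivAt_deriv t 0)).add
    (((hγ.hasDerivAt t 1).sub_const b).mul (hγ.hasDerivAt_deriv t 1))
  have h' : HasDerivAt (fun t => (γ t 0 - a) * deriv γ t 0 + (γ t 1 - b) * deriv γ t 1) _ t := h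
  simp only [hγ.circle_deriv hc] at h'
  have := h'.unique (hasDerivAt_const t _)
  nlinarith

/-- The parametrization is arbitrary, so the curvature is obtained by differentiating the equation
of the circle twice. -/
lemma IsClosedEmbeddedCurve.circle_curvature (hγ : IsClosedEmbeddedCurve γ T)
    (hR : ∀ t, γ t 2 = 0) (hr : 0 < r)
    (hc : ∀ t, (γ t 0 - a) ^ 2 + (γ t 1 - b) ^ 2 = r ^ 2) (t : ℝ) :
    curvatureInR γ t ^ 2 = 1 / r ^ 2 := by
  have h0 := hc t
  have h1 := hγ.circle_deriv hc t
  have h2 := hγ.circle_deriv_two hc t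
  have hv := hγ.speed_pos hR t
  rw [curvatureInR, div_pow, sq_abs, ← pow_mul, mul_comm 3 2, pow_mul, Real.sq_sqrt hv.le]
  generalize γ t 0 - a = X at *
  generalize γ t 1 - b = Y at *
  generalize deriv γ t 0 = x' at *
  generalize deriv γ t 1 = y' at *
  generalize deriv (deriv γ) t 0 = x'' at *
  generalize deriv (deriv γ) t 1 = y'' at *
  have hr2 : 0 < r ^ 2 := by positivity
  rw [div_eq_div_iff (by positivity) hr2.ne', one_mul]
  -- The velocity is orthogonal to the radius (X, Y), hence a multiple of (-Y, X).
  have e1 : r ^ 2 * x' = -Y * (X * y' - Y * x') := by rw [← h0]; linear_combination X * h1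
  have e2 : r ^ 2 * y' = X * (X * y' - Y * x') := by rw [← h0]; linear_combination Y * h1
  have e3 : (X * y' - Y * x') ^ 2 = r ^ 2 * (x' ^ 2 + y' ^ 2) := by
    rw [← h0]
    linear_combination (-(X * x' + Y * y')) * h1
  have e4 : r ^ 2 * (x' * y'' - y' * x'') = (X * y' - Y * x') * (x' ^ 2 + y' ^ 2) := by
    linear_combination y'' * e1 - x'' * e2 - (X * y' - Y * x') * h2
  have e5 : r ^ 2 * ((x' * y'' - y' * x'') ^ 2 * r ^ 2) = r ^ 2 * (x' ^ 2 + y' ^ 2) ^ 3 := by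
    calc r ^ 2 * ((x' * y'' - y' * x'') ^ 2 * r ^ 2)
        = (r ^ 2 * (x' * y'' - y' * x'')) ^ 2 := by ring
      _ = (X * y' - Y * x') ^ 2 * (x' ^ 2 + y' ^ 2) ^ 2 := by rw [e4]; ring
      _ = _ := by rw [e3]; ring
  exact mul_left_cancel₀ hr2.ne' e5

/-- Around a circle, the flux of the primitive is half the radius times the length. -/
lemma IsClosedEmbeddedCurve.circle_flux (hγ : IsClosedEmbeddedCurve γ T)
    (hR : ∀ t, γ t 2 = 0) (hr : 0 < r)
    (hc : ∀ t, (γ t 0 - a) ^ 2 + (γ t 1 - b) ^ 2 = r ^ 2) :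
    2 * |∫ t in (0 : ℝ)..T, beta a b (γ t) (deriv γ t)|
      = r * ∫ t in (0 : ℝ)..T, norm (γ t) (deriv γ t) := by
  have hc0 : ∀ i, Continuous fun t => γ t i := fun i =>
    (continuous_apply i).comp hγ.smooth.continuous
  set w : ℝ → ℝ := fun t => (γ t 0 - a) * deriv γ t 1 - (γ t 1 - b) * deriv γ t 0 with hw
  have hwc : Continuous w :=
    (((hc0 0).sub continuous_const).mul (hγ.continuous_deriv 1)).sub
      (((hc0 1).sub continuous_const).mul (hγ.continuous_deriv 0))
  have hw2 : ∀ t, w t ^ 2 = r ^ 2 * (deriv γ t 0 ^ 2 + deriv γ t 1 ^ 2) := by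
    intro t
    rw [← hc t]
    linear_combination (-((γ t 0 - a) * deriv γ t 0 + (γ t 1 - b) * deriv γ t 1)) *
      hγ.circle_deriv hc t
  have hwabs : ∀ t, |w t| = r * norm (γ t) (deriv γ t) := by
    intro t
    rw [norm_of_planar (hR t) (hγ.deriv_two hR t), ← Real.sqrt_sq_eq_abs, hw2,
      Real.sqrt_mul (sq_nonneg r), Real.sqrt_sq hr.le]
  have hw0 : ∀ t, w t ≠ 0 := by
    intro t h
    have h1 := hw2 t
    have h2 := mul_pos (pow_pos hr 2) (hγ.speed_pos hR t)
    rw [h] at h1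
    linarith
  -- The integral of d((x - a)(y - b)) over a period vanishes, so twice the integral of (x - a) dy
  -- equals that of w. By `hwabs` and the constant sign of w, this is r times the length up to sign.
  have hparts : ∫ t in (0 : ℝ)..T, (deriv γ t 0 * (γ t 1 - b) + (γ t 0 - a) * deriv γ t 1) = 0 := by
    rw [intervalIntegral.integral_eq_sub_of_hasDerivAt
      (f := fun t => (γ t 0 - a) * (γ t 1 - b))
      (fun t _ => ((hγ.hasDerivAt t 0).sub_const a).mul ((hγ.hasDerivAt t 1).sub_const b))]
    · have := hγ.periodic 0
      rw [zero_add] at this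
      simp only [this, sub_self]
    · exact (((hγ.continuous_deriv 0).mul ((hc0 1).sub continuous_const)).add
        (((hc0 0).sub continuous_const).mul (hγ.continuous_deriv 1))).intervalIntegrable _ _
  have hβ : ∀ t, beta a b (γ t) (deriv γ t) = (γ t 0 - a) * deriv γ t 1 := by
    intro t; rw [beta, hγ.deriv_two hR]; ring
  have hint : 2 * ∫ t in (0 : ℝ)..T, beta a b (γ t) (deriv γ t) = ∫ t in (0 : ℝ)..T, w t := by
    simp only [hβ]
    refine Eq.trans (sub_zero _).symm ?_
    rw [← intervalIntegral.integral_const_mul]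
    refine (congrArg _ hparts.symm).trans ?_
    rw [← intervalIntegral.integral_sub]
    · refine intervalIntegral.integral_congr fun t _ => ?_
      simp only [hw]; ring
    · exact (continuous_const.mul (((hc0 0).sub continuous_const).mul
        (hγ.continuous_deriv 1))).intervalIntegrable _ _
    · exact (((hγ.continuous_deriv 0).mul ((hc0 1).sub continuous_const)).add
        (((hc0 0).sub continuous_const).mul (hγ.continuous_deriv 1))).intervalIntegrable _ _
  rw [← abs_two, ← abs_mul, hint, abs_intervalIntegral_of_ne_zero hwc hw0 hγ.period_pos.le]
  simp only [hwabs, intervalIntegral.integral_const_mul]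

lemma IsClosedEmbeddedCurve.length_pos (hγ : IsClosedEmbeddedCurve γ T)
    (hR : ∀ t, γ t 2 = 0) : 0 < ∫ t in (0 : ℝ)..T, norm (γ t) (deriv γ t) := by
  have h : ∀ t, norm (γ t) (deriv γ t) = √(deriv γ t 0 ^ 2 + deriv γ t 1 ^ 2) := fun t =>
    norm_of_planar (hR t) (hγ.deriv_two hR t)
  simp only [h]
  refine intervalIntegral.intervalIntegral_pos_of_pos ?_
    (fun t => Real.sqrt_pos.2 (hγ.speed_pos hR t)) hγ.period_pos
  exact (Real.continuous_sqrt.comp (((hγ.continuous_deriv 0).pow 2).add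
    ((hγ.continuous_deriv 1).pow 2))).intervalIntegrable _ _

end Circle

end PlaneCurve

end SolSpace

end

theorem theorem2p4 {M : Type*} [TopologicalSpace M] [T2Space M] [CompactSpace M]
    [ChartedSpace (EuclideanHalfSpace 2) M] [IsManifold (𝓡∂ 2) ∞ M]
    (f : M → SolSpace.Sol) (hf : SolSpace.IsSmoothImmersion f)
    (γ : ℝ → SolSpace.Sol) (T : ℝ) (hγ : SolSpace.IsClosedEmbeddedCurve γ T)
    (hR : ∀ t, γ t 2 = 0) (hM : SolSpace.Spans f (range γ))
    (H : ℝ) (hH : SolSpace.HasConstantMeanCurvature f H) :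
    (∀ D : Set (ℝ × ℝ), SolSpace.IsDomainBoundedBy D (range γ) →
      |H| ≤ SolSpace.lineIntegral γ T (fun p => √(1 + p 0 ^ 2 + p 1 ^ 2))
        / (2 * SolSpace.area D)) ∧
    (∀ c : ℝ, SolSpace.IsCircleInR (range γ) → (∀ t, SolSpace.curvatureInR γ t = c) →
      |H| ≤ √(c ^ 2 + 1)) := by
  -- The flux argument orients the boundary by the sign of the mean curvature, so the trivial case H
  -- = 0 is treated separately.
  rcases eq_or_ne H 0 with h0 | h0
  · subst h0
    rw [abs_zero]
    refine ⟨fun D hD => div_nonneg ?_ (by linarith [hD.area_pos]), fun c _ _ => Real.sqrt_nonneg _⟩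
    exact intervalIntegral.integral_nonneg hγ.period_pos.le fun t _ =>
      mul_nonneg (Real.sqrt_nonneg _) (Real.sqrt_nonneg _)
  have hflux := SolSpace.flux_inequality (hH.isCMC hf h0) hγ hM
  constructor
  · intro D hD
    have h := hflux 0 0
    rw [← hγ.area_eq_abs hR hD] at h
    rw [le_div_iff₀ (by linarith [hD.area_pos])]
    simp only [SolSpace.norm_killing_of_planar (hR _), sub_zero] at h
    rw [SolSpace.lineIntegral]
    linarith
  · rintro c ⟨a, b, r, hr, hΓ⟩ hcurv
    have hc : ∀ t, (γ t 0 - a) ^ 2 + (γ t 1 - b) ^ 2 = r ^ 2 := by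
      intro t
      obtain ⟨q, hq, hqt⟩ : γ t ∈ SolSpace.planeR '' {q | (q.1 - a) ^ 2 + (q.2 - b) ^ 2 = r ^ 2} :=
        hΓ ▸ mem_range_self t
      rw [← hqt]
      exact hq
    have hk := hγ.circle_curvature hR hr hc 0
    rw [hcurv] at hk
    -- With the Killing field centred at the centre of the circle, |K| is constant on Γ and the
    -- length cancels from both sides.
    have h := hflux a b
    have hL := hγ.length_pos hR
    have hF := hγ.circle_flux hR hr hc
    have hn : ∀ t, SolSpace.norm (γ t) (SolSpace.killing a b (γ t)) = √(1 + r ^ 2) := by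
      intro t
      rw [SolSpace.norm_killing_of_planar (hR t), add_assoc, hc]
    simp only [hn, intervalIntegral.integral_const_mul] at h
    have h2 : |H| * r ≤ √(1 + r ^ 2) := by
      refine le_of_mul_le_mul_right ?_ hL
      rw [mul_assoc, ← hF, mul_left_comm, ← mul_assoc]
      exact h
    have h3 : √(c ^ 2 + 1) * r = √(1 + r ^ 2) := by
      rw [hk]
      nth_rewrite 2 [← Real.sqrt_sq hr.le]
      rw [← Real.sqrt_mul (by positivity)]
      congr 1
      field_simp
    rw [← h3] at h2
    exact le_of_mul_le_mul_right h2 hr
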